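/- Let $n\ge 0$, let $s_1,\dots,s_n$ be distinct points of $\mathbb R^2$ contained in the open ball $B(0,R_0)$, and let $\alpha_1,\dots,\alpha_n\in\mathbb R\setminus\mathbb Z$. For $\kappa\in\mathbb R$ and $p=(p_x,p_y)\in\mathbb R^2$ let $$\vec A_{\kappa,p}(x,y)=-\kappa\left(-\frac{y-p_y}{(x-p_x)^2+(y-p_y)^2},\ \frac{x-p_x}{(x-p_x)^2+(y-p_y)^2}\right)$$ be the vector potential of a solenoid of flux $\kappa$ at $p$. Put $P_{\boldsymbol\alpha}=\big(\tfrac1i\nabla-\sum_i\vec A_{\alpha_i,s_i}\big)^2$, let $\beta=\sum_i\alpha_i$ be the total flux and, if $\beta\ne0$, let $c=\beta^{-1}\sum_i\alpha_i s_i$; put $P_\beta=\big(\tfrac1i\nabla-\vec A_{\beta,c}\big)^2$ if $\beta\neq 0$ and $P_\beta=-\Delta$ if $\beta=0$. Let $f\in C^\infty(\mathbb R^2;\mathbb R)$ be such that the differential expression $e^{-if}P_\beta e^{if}$ agrees with $P_{\boldsymbol\alpha}$ on $\mathbb R^2\setminus B(0,R_0)$. Let $P_0$, with domain $\mathcal D_0\subset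 L^2(\mathbb R^2)$, be the Friedrichs extension of $e^{-if}P_\beta e^{if}$ from $C_c^\infty(\mathbb R^2\setminus\{c\})$ if $\beta\ne0$, and from $C_c^\infty(\mathbb R^2)$ if $\beta=0$; equip $\mathcal D_0$ with the graph norm. Let $\mathcal H_{0,\mathrm{comp}}$ be the space of compactly supported functions in $L^2(\mathbb R^2)$, let $\mathcal H_{0,\mathrm{loc}}=L^2_{\mathrm{loc}}(\mathbb R^2)$, and let $$\mathcal D_{0,\mathrm{loc}}=\{u\in\mathcal H_{0,\mathrm{loc}}:\ \chi u\in\mathcal D_0\text{ for all }\chi\in C_c^\infty(\mathbb R^2)\text{ with }\chi|_{B(0,R_0)}\equiv1\}.$$ Let $\Lambda$ be the logarithmic cover of $\mathbb C\setminus\{0\}$, in which $\{\operatorname{Im}\lambda>0\}$ is embedded as $\{0<\arg\lambda<\pi\}$. Then for $\operatorname{Im}\lambda>0$ the resolvent $R_0(\lambda)=(P_0-\lambda^2)^{-1}$ exists as a bounded operator on $L^2(\mathbb R^2)$ and is analytic in $\lambda$, and it has an analytic continuation to $\Lambda$ as a family of operators $\mathcal H_{0,\mathrm{comp}}\to\mathcal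 D_{0,\mathrm{loc}}$. That is, there are linear operators $R_0(\lambda):\mathcal H_{0,\mathrm{comp}}\to\mathcal D_{0,\mathrm{loc}}$, $\lambda\in\Lambda$, which coincide with the resolvent on $\mathcal H_{0,\mathrm{comp}}$ when $0<\arg\lambda<\pi$, and such that for every compact $K\subset\mathbb R^2$ and every $\chi\in C_c^\infty(\mathbb R^2)$ with $\chi|_{B(0,R_0)}\equiv1$ the map $\lambda\mapsto\chi R_0(\lambda)$ is analytic on $\Lambda$ with values in the bounded operators from $\{g\in L^2(\mathbb R^2):g=0\text{ a.e. off }K\}$ to $\mathcal D_0$, in operator norm. -/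

import Mathlib

open MeasureTheory Filter Topology TopologicalSpace
open scoped ContDiff InnerProductSpace Distributions LinearPMap

noncomputable section

namespace AharonovBohm

/-! ### Friedrichs extension of a nonnegative operator on a Hilbert space -/

section Friedrichs

variable {H : Type*} [NormedAddCommGroup H] [InnerProductSpace ℂ H]

/-- The quadratic form `u ↦ Re ⟨T u, u⟩` of an (unbounded) operator `T`. -/
def energy (T : H →ₗ.[ℂ] H) (u : T.domain) : ℝ := (⟪T u, (u : H)⟫_ℂ).re

theorem energy_smul (T : H →ₗ.[ℂ] H) (a : ℂ) (u : T.domain) :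
    energy T (a • u) = ‖a‖ ^ 2 * energy T u := by
  have h : ⟪T (a • u), ((a • u : T.domain) : H)⟫_ℂ = ((‖a‖ ^ 2 : ℝ) : ℂ) * ⟪T u, (u : H)⟫_ℂ := by
    rw [T.map_smul, Submodule.coe_smul, inner_smul_left, inner_smul_right, ← mul_assoc,
      Complex.conj_mul']
    push_cast
    ring
  rw [energy, h, Complex.re_ofReal_mul, energy]

theorem energy_add_add_sub (T : H →ₗ.[ℂ] H) (u v : T.domain) :
    energy T (u + v) + energy T (u - v) = 2 * energy T u + 2 * energy T v := by
  simp only [energy, T.map_add, T.map_sub, Submodule.coe_add, Submodule.coe_sub, inner_add_left,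
    inner_add_right, inner_sub_left, inner_sub_right, Complex.add_re, Complex.sub_re]
  ring

/-- The form domain of a nonnegative operator `T`: the completion of its domain for the norm
`(‖u‖² + Re ⟨T u, u⟩)^{1/2}`, realized inside `H` as the set of limits in `H` of sequences
in the domain of `T` which are Cauchy for the quadratic form of `T`. -/
def formDomain (T : H →ₗ.[ℂ] H) (hT : ∀ u, 0 ≤ energy T u) : Submodule ℂ H where
  carrier := {u | ∃ v : ℕ → T.domain, Tendsto (fun k => (v k : H)) atTop (𝓝 u) ∧
    ∀ ε : ℝ, 0 < ε → ∃ N : ℕ, ∀ j k : ℕ, N ≤ j → N ≤ k → energy T (v j - v k) < ε}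
  zero_mem' := ⟨fun _ => 0, by simp, fun ε hε => ⟨0, fun j k _ _ => by simpa [energy] using hε⟩⟩
  add_mem' := by
    rintro u u' ⟨v, hv, hvc⟩ ⟨v', hv', hvc'⟩
    refine ⟨fun k => v k + v' k, hv.add hv', fun ε hε => ?_⟩
    obtain ⟨N, hN⟩ := hvc (ε / 4) (by positivity)
    obtain ⟨N', hN'⟩ := hvc' (ε / 4) (by positivity)
    refine ⟨max N N', fun j k hj hk => ?_⟩
    have h1 := hN j k (le_trans (le_max_left _ _) hj) (le_trans (le_max_left _ _) hk)
    have h2 := hN' j k (le_trans (le_max_right _ _) hj) (le_trans (le_max_right _ _) hk)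
    have h3 := energy_add_add_sub T (v j - v k) (v' j - v' k)
    have h4 := hT (v j - v k - (v' j - v' k))
    have h5 : v j + v' j - (v k + v' k) = v j - v k + (v' j - v' k) := by abel
    rw [h5]
    linarith
  smul_mem' := by
    rintro a u ⟨v, hv, hvc⟩
    refine ⟨fun k => a • v k, hv.const_smul a, fun ε hε => ?_⟩
    obtain ⟨N, hN⟩ := hvc (ε / (‖a‖ ^ 2 + 1)) (by positivity)
    refine ⟨N, fun j k hj hk => ?_⟩
    have h1 := hN j k hj hk
    have h2 := hT (v j - v k)
    rw [← smul_sub, energy_smul]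
    rw [lt_div_iff₀ (by positivity)] at h1
    nlinarith

/-- The Friedrichs extension of a densely defined nonnegative symmetric operator `T`: the
restriction of the adjoint `T†` to those elements of its domain which lie in the form domain. -/
def friedrichsExtension [CompleteSpace H] (T : H →ₗ.[ℂ] H) (hT : ∀ u, 0 ≤ energy T u) :
    H →ₗ.[ℂ] H :=
  T†.domRestrict (formDomain T hT)

/-- `R` is the resolvent `(T - z)⁻¹`: a bounded operator which is a two-sided inverse of
`T - z : D(T) → H`. -/
def IsResolvent (T : H →ₗ.[ℂ] H) (z : ℂ) (R : H →L[ℂ] H) : Prop :=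
  (∀ g : H, ∃ h : R g ∈ T.domain, T ⟨R g, h⟩ - z • R g = g) ∧
    ∀ u : T.domain, R (T u - z • (u : H)) = u

end Friedrichs

/-! ### Magnetic Schrödinger operators in the plane -/

/-- The Euclidean plane. -/
abbrev Plane : Type := EuclideanSpace ℝ (Fin 2)

/-- The Hilbert space `L²(ℝ²)`. -/
abbrev L2 : Type := Lp ℂ 2 (volume : Measure Plane)

/-- The vector potential `-κ (-(y - p_y), x - p_x) / ((x - p_x)² + (y - p_y)²)` of a solenoid of
flux `κ` at the point `p`. -/
def potential (κ : ℝ) (p : Plane) (x : Plane) : Plane :=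
  !₂[-κ * (-(x 1 - p 1) / ((x 0 - p 0) ^ 2 + (x 1 - p 1) ^ 2)),
    -κ * ((x 0 - p 0) / ((x 0 - p 0) ^ 2 + (x 1 - p 1) ^ 2))]

/-- The `j`-th component `(1/i) ∂_j - A_j` of `(1/i) ∇ - A`. -/
def covDeriv (A : Plane → Plane) (j : Fin 2) (φ : Plane → ℂ) (x : Plane) : ℂ :=
  1 / Complex.I * fderiv ℝ φ x (EuclideanSpace.single j 1) - (A x j : ℂ) * φ x

/-- The differential expression `((1/i) ∇ - A)²`. -/
def magneticLaplacian (A : Plane → Plane) (φ : Plane → ℂ) (x : Plane) : ℂ :=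
  ∑ j : Fin 2, covDeriv A j (covDeriv A j φ) x

/-- The differential expression `P_α = ((1/i) ∇ - ∑ᵢ Aᵢ)²` of several solenoids of fluxes `α i`
at the points `s i`. -/
def multiFluxExpr {n : ℕ} (α : Fin n → ℝ) (s : Fin n → Plane) (φ : Plane → ℂ) (x : Plane) : ℂ :=
  magneticLaplacian (fun y => ∑ i, potential (α i) (s i) y) φ x

/-- The differential expression `P₀ = e^{-if} P_β e^{if}`, where `P_β = ((1/i) ∇ - A_β)²` is the
Hamiltonian of a single solenoid of flux `β` at `c`. -/
def freeExpr (β : ℝ) (c : Plane) (f : Plane → ℝ) (φ : Plane → ℂ) (x : Plane) : ℂ :=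
  Complex.exp (-(Complex.I * f x)) *
    magneticLaplacian (potential β c) (fun y => Complex.exp (Complex.I * f y) * φ y) x

/-- The total flux `β = ∑ᵢ αᵢ`. -/
def totalFlux {n : ℕ} (α : Fin n → ℝ) : ℝ := ∑ i, α i

/-- The center of flux `c = β⁻¹ ∑ᵢ αᵢ sᵢ`. If `β = 0` the value is irrelevant, since then
`A_β = 0` and the domain `regularSet β c` below is the whole plane. -/
def fluxCenter {n : ℕ} (α : Fin n → ℝ) (s : Fin n → Plane) : Plane :=
  (totalFlux α)⁻¹ • ∑ i, α i • s i

/-- The open set on which `P_β` is a differential operator with smooth coefficients: the plane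
punctured at `c` if `β ≠ 0`, the whole plane if `β = 0` (when `P_β` is the free Laplacian). -/
def regularSet (β : ℝ) (c : Plane) : Opens Plane :=
  open Classical in if β = 0 then ⊤ else ⟨{c}ᶜ, isOpen_compl_singleton⟩

/-! ### The operator on test functions -/

section TestFunctions

variable {Ω : Opens Plane}

/-- Multiplication of test functions on `Ω` by a function which is smooth on `Ω`. -/
def mulTest (g : Plane → ℂ) (hg : ContDiffOn ℝ ∞ g Ω) : 𝓓(Ω, ℂ) →ₗ[ℂ] 𝓓(Ω, ℂ) where
  toFun φ :=
    { toFun := fun x => g x * φ x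
      contDiff' := by
        refine contDiff_iff_contDiffAt.2 fun x => ?_
        by_cases hx : x ∈ tsupport φ
        · exact (hg.contDiffAt (Ω.isOpen.mem_nhds (φ.tsupport_subset hx))).mul
            φ.contDiff.contDiffAt
        · refine (contDiffAt_const (c := (0 : ℂ))).congr_of_eventuallyEq ?_
          filter_upwards [notMem_tsupport_iff_eventuallyEq.1 hx] with y hy
          simp [hy]
      hasCompactSupport' := φ.hasCompactSupport.mul_left
      tsupport_subset' := (tsupport_mul_subset_right (f := g)).trans φ.tsupport_subset }
  map_add' φ ψ := by ext x; exact mul_add _ _ _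
  map_smul' a φ := by ext x; exact mul_left_comm _ _ _

/-- The operator `(1/i) ∂_j` on test functions. -/
def derivTest (j : Fin 2) : 𝓓(Ω, ℂ) →ₗ[ℂ] 𝓓(Ω, ℂ) where
  toFun φ :=
    { toFun := fun x => 1 / Complex.I * fderiv ℝ φ x (EuclideanSpace.single j 1)
      contDiff' := contDiff_const.mul
        ((φ.contDiff.fderiv_right (m := ∞) (by simp)).clm_apply contDiff_const)
      hasCompactSupport' := (φ.hasCompactSupport.fderiv_apply ℝ _).mul_left
      tsupport_subset' := (tsupport_mul_subset_right (f := fun _ => 1 / Complex.I)).trans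
        ((tsupport_fderiv_apply_subset ℝ _).trans φ.tsupport_subset) }
  map_add' φ ψ := by
    ext x
    change 1 / Complex.I * fderiv ℝ (⇑φ + ⇑ψ) x _ = 1 / Complex.I * fderiv ℝ φ x _ +
      1 / Complex.I * fderiv ℝ ψ x _
    rw [fderiv_add (φ.contDiff.differentiable (by simp) x)
      (ψ.contDiff.differentiable (by simp) x)]
    exact mul_add _ _ _
  map_smul' a φ := by
    ext x
    change 1 / Complex.I * fderiv ℝ (a • ⇑φ) x _ = a * (1 / Complex.I * fderiv ℝ φ x _)
    rw [fderiv_const_smul (φ.contDiff.differentiable (by simp) x)]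
    exact mul_left_comm _ _ _

theorem component_contDiffOn {A : Plane → Plane} (hA : ContDiffOn ℝ ∞ A Ω) (j : Fin 2) :
    ContDiffOn ℝ ∞ (fun x => (A x j : ℂ)) Ω :=
  Complex.ofRealCLM.contDiff.comp_contDiffOn (contDiffOn_euclidean.1 hA j)

/-- The operator `(1/i) ∂_j - A_j` on test functions on an open set where `A` is smooth. -/
def covDerivTest (A : Plane → Plane) (hA : ContDiffOn ℝ ∞ A Ω) (j : Fin 2) :
    𝓓(Ω, ℂ) →ₗ[ℂ] 𝓓(Ω, ℂ) :=
  derivTest j - mulTest (fun x => (A x j : ℂ)) (component_contDiffOn hA j)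

theorem coe_covDerivTest (A : Plane → Plane) (hA : ContDiffOn ℝ ∞ A Ω) (j : Fin 2)
    (φ : 𝓓(Ω, ℂ)) : ⇑(covDerivTest A hA j φ) = covDeriv A j φ := rfl

end TestFunctions

theorem potential_contDiffOn (β : ℝ) (c : Plane) :
    ContDiffOn ℝ ∞ (potential β c) (regularSet β c) := by
  by_cases hβ : β = 0
  · have : potential β c = fun _ => 0 := by
      funext x
      ext j
      fin_cases j <;> simp [potential, hβ]
    rw [this]
    exact contDiffOn_const
  · rw [contDiffOn_euclidean]
    have hne : ∀ x ∈ (regularSet β c : Set Plane),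
        (x 0 - c 0) ^ 2 + (x 1 - c 1) ^ 2 ≠ 0 := by
      intro x hx h
      have hx' : x ≠ c := by simpa [regularSet, hβ] using hx
      apply hx'
      ext j
      fin_cases j <;> simp <;> nlinarith [sq_nonneg (x 0 - c 0), sq_nonneg (x 1 - c 1)]
    have hc : ∀ j : Fin 2, ContDiffOn ℝ ∞ (fun x : Plane => x j - c j) (regularSet β c) :=
      fun j => (contDiffOn_euclidean.1 contDiffOn_id j).sub contDiffOn_const
    intro j
    fin_cases j
    · exact contDiffOn_const.mul
        (((hc 1).neg).div (((hc 0).pow 2).add ((hc 1).pow 2)) hne)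
    · exact contDiffOn_const.mul
        ((hc 0).div (((hc 0).pow 2).add ((hc 1).pow 2)) hne)

theorem phase_contDiff {f : Plane → ℝ} (hf : ContDiff ℝ ∞ f) :
    ContDiff ℝ ∞ fun x => Complex.exp (Complex.I * f x) :=
  (contDiff_const.mul (Complex.ofRealCLM.contDiff.comp hf)).cexp

theorem phase_neg_contDiff {f : Plane → ℝ} (hf : ContDiff ℝ ∞ f) :
    ContDiff ℝ ∞ fun x => Complex.exp (-(Complex.I * f x)) :=
  (contDiff_const.mul (Complex.ofRealCLM.contDiff.comp hf)).neg.cexp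

/-- The operator `P₀ = e^{-if} P_β e^{if}` on test functions on `regularSet β c`. -/
def freeTest (β : ℝ) (c : Plane) (f : Plane → ℝ) (hf : ContDiff ℝ ∞ f) :
    𝓓(regularSet β c, ℂ) →ₗ[ℂ] 𝓓(regularSet β c, ℂ) :=
  mulTest (fun x => Complex.exp (-(Complex.I * f x))) (phase_neg_contDiff hf).contDiffOn ∘ₗ
    (∑ j : Fin 2, covDerivTest (potential β c) (potential_contDiffOn β c) j ∘ₗ
      covDerivTest (potential β c) (potential_contDiffOn β c) j) ∘ₗ
    mulTest (fun x => Complex.exp (Complex.I * f x)) (phase_contDiff hf).contDiffOn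

theorem coe_freeTest (β : ℝ) (c : Plane) (f : Plane → ℝ) (hf : ContDiff ℝ ∞ f)
    (φ : 𝓓(regularSet β c, ℂ)) : ⇑(freeTest β c f hf φ) = freeExpr β c f φ := by
  funext x
  simp only [freeTest, freeExpr, magneticLaplacian, LinearMap.comp_apply, Fin.sum_univ_two]
  rfl

/-! ### The operator on `L²(ℝ²)` -/

section Minimal

variable {Ω : Opens Plane}

theorem memLp_test (φ : 𝓓(Ω, ℂ)) : MemLp φ 2 (volume : Measure Plane) :=
  φ.continuous.memLp_of_hasCompactSupport φ.hasCompactSupport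

/-- The inclusion of the test functions into `L²(ℝ²)`. -/
def testToL2 (Ω : Opens Plane) : 𝓓(Ω, ℂ) →ₗ[ℂ] L2 where
  toFun φ := (memLp_test φ).toLp φ
  map_add' _ _ := rfl
  map_smul' _ _ := rfl

theorem testToL2_injective : Function.Injective (testToL2 Ω) := by
  intro φ ψ h
  have h1 : (φ : Plane → ℂ) =ᵐ[volume] ψ :=
    (memLp_test φ).coeFn_toLp.symm.trans
      ((Lp.ext_iff.1 h).trans (memLp_test ψ).coeFn_toLp)
  exact DFunLike.coe_injective ((φ.continuous.ae_eq_iff_eq volume ψ.continuous).1 h1)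

/-- The unbounded operator in `L²(ℝ²)` with domain the test functions on `Ω` which is given there
by `P`. -/
def minimalOperator (P : 𝓓(Ω, ℂ) →ₗ[ℂ] 𝓓(Ω, ℂ)) : L2 →ₗ.[ℂ] L2 where
  domain := LinearMap.range (testToL2 Ω)
  toFun := testToL2 Ω ∘ₗ P ∘ₗ (LinearEquiv.ofInjective (testToL2 Ω) testToL2_injective).symm

theorem inner_testToL2 (φ ψ : 𝓓(Ω, ℂ)) :
    ⟪testToL2 Ω φ, testToL2 Ω ψ⟫_ℂ = ∫ x, ψ x * starRingEnd ℂ (φ x) := by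
  rw [L2.inner_def]
  refine integral_congr_ae ?_
  filter_upwards [(memLp_test φ).coeFn_toLp, (memLp_test ψ).coeFn_toLp] with x h1 h2
  have h1' : (testToL2 Ω φ : Plane → ℂ) x = φ x := h1
  have h2' : (testToL2 Ω ψ : Plane → ℂ) x = ψ x := h2
  rw [h1', h2']
  rfl

theorem integrable_mul_conj (φ ψ : 𝓓(Ω, ℂ)) :
    Integrable (fun x => ψ x * starRingEnd ℂ (φ x)) (volume : Measure Plane) :=
  (ψ.continuous.mul (Complex.continuous_conj.comp φ.continuous)).integrable_of_hasCompactSupport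
    ψ.hasCompactSupport.mul_right

theorem fderiv_conj (φ : 𝓓(Ω, ℂ)) (x v : Plane) :
    fderiv ℝ (fun y => starRingEnd ℂ (φ y)) x v = starRingEnd ℂ (fderiv ℝ φ x v) := by
  have h : HasFDerivAt (fun y => starRingEnd ℂ (φ y))
      ((Complex.conjCLE : ℂ →L[ℝ] ℂ).comp (fderiv ℝ φ x)) x :=
    (Complex.conjCLE : ℂ →L[ℝ] ℂ).hasFDerivAt.comp x
      (φ.contDiff.differentiable (by simp) x).hasFDerivAt
  rw [h.fderiv]
  rfl

theorem inner_derivTest (j : Fin 2) (φ ψ : 𝓓(Ω, ℂ)) :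
    ⟪testToL2 Ω (derivTest j φ), testToL2 Ω ψ⟫_ℂ =
      ⟪testToL2 Ω φ, testToL2 Ω (derivTest j ψ)⟫_ℂ := by
  rw [inner_testToL2, inner_testToL2]
  set e : Plane := EuclideanSpace.single j 1
  have hφ : Continuous fun x => fderiv ℝ φ x e :=
    ((φ.contDiff.fderiv_right (m := ∞) (by simp)).clm_apply contDiff_const).continuous
  have hψ : Continuous fun x => fderiv ℝ ψ x e :=
    ((ψ.contDiff.fderiv_right (m := ∞) (by simp)).clm_apply contDiff_const).continuous
  have hc : Continuous fun x => starRingEnd ℂ (φ x) := Complex.continuous_conj.comp φ.continuous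
  have hφ' : Continuous fun x => fderiv ℝ (fun y => starRingEnd ℂ (φ y)) x e := by
    simp only [fderiv_conj]
    exact Complex.continuous_conj.comp hφ
  have key := integral_mul_fderiv_eq_neg_fderiv_mul_of_integrable (μ := (volume : Measure Plane))
    (f := ψ) (g := fun x => starRingEnd ℂ (φ x)) (v := e)
    ((hψ.mul hc).integrable_of_hasCompactSupport
      (ψ.hasCompactSupport.fderiv_apply ℝ e).mul_right)
    ((ψ.continuous.mul hφ').integrable_of_hasCompactSupport
      ψ.hasCompactSupport.mul_right)
    (integrable_mul_conj φ ψ)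
    (fun x _ => ψ.contDiff.differentiable (by simp) x)
    (fun x _ => (Complex.conjCLE : ℂ →L[ℝ] ℂ).differentiableAt.comp x
      (φ.contDiff.differentiable (by simp) x))
  have h1 : ∀ x, ψ x * starRingEnd ℂ ((derivTest j φ : 𝓓(Ω, ℂ)) x) =
      Complex.I * (ψ x * fderiv ℝ (fun y => starRingEnd ℂ (φ y)) x e) := by
    intro x
    rw [fderiv_conj]
    change ψ x * starRingEnd ℂ (1 / Complex.I * fderiv ℝ φ x e) = _
    simp only [one_div, Complex.inv_I, map_mul, map_neg, Complex.conj_I]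
    ring
  have h2 : ∀ x, (derivTest j ψ : 𝓓(Ω, ℂ)) x * starRingEnd ℂ (φ x) =
      -Complex.I * (fderiv ℝ ψ x e * starRingEnd ℂ (φ x)) := by
    intro x
    change 1 / Complex.I * fderiv ℝ ψ x e * _ = _
    simp only [one_div, Complex.inv_I]
    ring
  simp only [h1, h2, integral_const_mul, key]
  ring

theorem inner_mulTest (g g' : Plane → ℂ) (hg : ContDiffOn ℝ ∞ g Ω) (hg' : ContDiffOn ℝ ∞ g' Ω)
    (h : ∀ x, starRingEnd ℂ (g x) = g' x) (φ ψ : 𝓓(Ω, ℂ)) :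
    ⟪testToL2 Ω (mulTest g hg φ), testToL2 Ω ψ⟫_ℂ =
      ⟪testToL2 Ω φ, testToL2 Ω (mulTest g' hg' ψ)⟫_ℂ := by
  rw [inner_testToL2, inner_testToL2]
  congr 1
  funext x
  change ψ x * starRingEnd ℂ (g x * φ x) = g' x * ψ x * starRingEnd ℂ (φ x)
  rw [map_mul, h]
  ring

theorem inner_covDerivTest (A : Plane → Plane) (hA : ContDiffOn ℝ ∞ A Ω) (j : Fin 2)
    (φ ψ : 𝓓(Ω, ℂ)) :
    ⟪testToL2 Ω (covDerivTest A hA j φ), testToL2 Ω ψ⟫_ℂ =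
      ⟪testToL2 Ω φ, testToL2 Ω (covDerivTest A hA j ψ)⟫_ℂ := by
  simp only [covDerivTest, LinearMap.sub_apply, map_sub, inner_sub_left, inner_sub_right]
  exact congrArg₂ (· - ·) (inner_derivTest j φ ψ)
    (inner_mulTest _ _ _ _ (fun x => Complex.conj_ofReal (A x j)) φ ψ)

end Minimal

theorem energy_freeTest_nonneg (β : ℝ) (c : Plane) (f : Plane → ℝ) (hf : ContDiff ℝ ∞ f)
    (u : (minimalOperator (freeTest β c f hf)).domain) :
    0 ≤ energy (minimalOperator (freeTest β c f hf)) u := by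
  obtain ⟨φ, rfl⟩ := (LinearEquiv.ofInjective (testToL2 (regularSet β c))
    testToL2_injective).surjective u
  have h1 : minimalOperator (freeTest β c f hf)
      (LinearEquiv.ofInjective (testToL2 (regularSet β c)) testToL2_injective φ) =
        testToL2 _ (freeTest β c f hf φ) := by
    change testToL2 _ (freeTest β c f hf ((LinearEquiv.ofInjective (testToL2 (regularSet β c))
      testToL2_injective).symm _)) = _
    rw [LinearEquiv.symm_apply_apply]
  have h2 : ∀ x, starRingEnd ℂ (Complex.exp (-(Complex.I * f x))) =
      Complex.exp (Complex.I * f x) := by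
    intro x
    rw [← Complex.exp_conj]
    simp
  unfold energy
  rw [h1, LinearEquiv.ofInjective_apply]
  change 0 ≤ (⟪testToL2 _ (mulTest _ (phase_neg_contDiff hf).contDiffOn _), _⟫_ℂ).re
  rw [inner_mulTest _ _ (phase_neg_contDiff hf).contDiffOn (phase_contDiff hf).contDiffOn h2]
  simp only [LinearMap.comp_apply, LinearMap.sum_apply, map_sum, sum_inner, inner_covDerivTest,
    Complex.re_sum]
  refine Finset.sum_nonneg fun j _ => ?_
  rw [← inner_covDerivTest]
  exact inner_self_nonneg (𝕜 := ℂ)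

/-- The Hamiltonian `P₀ = e^{-if} P_β e^{if}`: the Friedrichs extension in `L²(ℝ²)` of this
operator on the test functions which vanish near the solenoid (if `β ≠ 0`), respectively on all
test functions (if `β = 0`). -/
def freeHamiltonian (β : ℝ) (c : Plane) (f : Plane → ℝ) (hf : ContDiff ℝ ∞ f) : L2 →ₗ.[ℂ] L2 :=
  friedrichsExtension (minimalOperator (freeTest β c f hf)) (energy_freeTest_nonneg β c f hf)

/-! ### Compactly supported and local spaces -/

/-- `L²` functions vanishing almost everywhere off `K`, with the `L²` norm. -/
def L2On (K : Set Plane) : Submodule ℂ L2 where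
  carrier := {u | ∀ᵐ x, x ∉ K → (u : Plane → ℂ) x = 0}
  zero_mem' := by
    filter_upwards [Lp.coeFn_zero ℂ 2 (volume : Measure Plane)] with x hx _
    simp
  add_mem' := by
    intro u v hu hv
    filter_upwards [hu, hv, Lp.coeFn_add u v] with x h1 h2 h3 hx
    rw [h3, Pi.add_apply, h1 hx, h2 hx, add_zero]
  smul_mem' := by
    intro a u hu
    filter_upwards [hu, Lp.coeFn_smul a u] with x h1 h2 hx
    simp [h2, h1 hx]

theorem L2On_mono {K L : Set Plane} (h : K ⊆ L) : L2On K ≤ L2On L := by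
  intro u hu
  change ∀ᵐ x, x ∉ K → (u : Plane → ℂ) x = 0 at hu
  change ∀ᵐ x, x ∉ L → (u : Plane → ℂ) x = 0
  filter_upwards [hu] with x hx hxL using hx fun hxK => hxL (h hxK)

/-- The space `H_comp = L²(B(0,R₀)) ⊕ L²_comp(ℝ² \ B(0,R₀))` of compactly supported `L²`
functions, the union of the spaces `L2On K` over the compact sets `K`. -/
def Hcomp : Submodule ℂ L2 where
  carrier := {u | ∃ K : Set Plane, IsCompact K ∧ u ∈ L2On K}
  zero_mem' := ⟨∅, isCompact_empty, zero_mem _⟩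
  add_mem' := by
    rintro u v ⟨K, hK, hu⟩ ⟨L, hL, hv⟩
    exact ⟨K ∪ L, hK.union hL, add_mem (L2On_mono Set.subset_union_left hu)
      (L2On_mono Set.subset_union_right hv)⟩
  smul_mem' := by
    rintro a u ⟨K, hK, hu⟩
    exact ⟨K, hK, Submodule.smul_mem _ a hu⟩

theorem L2On_le_Hcomp {K : Set Plane} (hK : IsCompact K) : L2On K ≤ Hcomp :=
  fun _ hu => ⟨K, hK, hu⟩

/-- The space `H_loc = L²(B(0,R₀)) ⊕ L²_loc(ℝ² \ B(0,R₀))` of locally square integrable functions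
(modulo equality almost everywhere). -/
def Hloc : Submodule ℂ (Plane →ₘ[(volume : Measure Plane)] ℂ) where
  carrier := {u | ∀ K : Set Plane, IsCompact K → MemLp u 2 (volume.restrict K)}
  zero_mem' := fun _ _ =>
    (memLp_congr_ae (ae_restrict_of_ae AEEqFun.coeFn_zero)).2 MemLp.zero
  add_mem' := fun {u v} hu hv K hK =>
    (memLp_congr_ae (ae_restrict_of_ae (AEEqFun.coeFn_add u v))).2 ((hu K hK).add (hv K hK))
  smul_mem' := fun a u hu K hK =>
    (memLp_congr_ae (ae_restrict_of_ae (AEEqFun.coeFn_smul a u))).2 ((hu K hK).const_smul a)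

/-- Cutoff functions: smooth compactly supported functions on `ℝ²` which are equal to `1` on
`B(0,R₀)`. -/
def IsCutoff (R₀ : ℝ) (χ : 𝓓((⊤ : Opens Plane), ℂ)) : Prop :=
  ∀ x ∈ Metric.ball (0 : Plane) R₀, χ x = 1

/-- The local domain `D_loc` of an operator `P` in `L²(ℝ²)`: those `u ∈ H_loc` such that `χ u` lies
in the domain of `P` for all cutoff functions `χ`. -/
def Dloc (P : L2 →ₗ.[ℂ] L2) (R₀ : ℝ) : Submodule ℂ (Plane →ₘ[(volume : Measure Plane)] ℂ) where
  carrier := {u | u ∈ Hloc ∧ ∀ χ, IsCutoff R₀ χ →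
    ∃ v ∈ P.domain, (v : Plane → ℂ) =ᵐ[volume] fun x => χ x * u x}
  zero_mem' := by
    refine ⟨zero_mem _, fun χ _ => ⟨0, zero_mem _, ?_⟩⟩
    filter_upwards [Lp.coeFn_zero ℂ 2 (volume : Measure Plane),
      AEEqFun.coeFn_zero (μ := (volume : Measure Plane)) (β := ℂ)] with x h1 h2
    simp [h2]
  add_mem' := by
    rintro u u' ⟨hu, hu'⟩ ⟨hv, hv'⟩
    refine ⟨add_mem hu hv, fun χ hχ => ?_⟩
    obtain ⟨w, hw, h⟩ := hu' χ hχ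
    obtain ⟨w', hw', h'⟩ := hv' χ hχ
    refine ⟨w + w', add_mem hw hw', ?_⟩
    filter_upwards [h, h', Lp.coeFn_add w w', AEEqFun.coeFn_add u u'] with x h1 h2 h3 h4
    rw [h3, h4, Pi.add_apply, Pi.add_apply, h1, h2, mul_add]
  smul_mem' := by
    rintro a u ⟨hu, hu'⟩
    refine ⟨Submodule.smul_mem _ a hu, fun χ hχ => ?_⟩
    obtain ⟨w, hw, h⟩ := hu' χ hχ
    refine ⟨a • w, Submodule.smul_mem _ a hw, ?_⟩
    filter_upwards [h, Lp.coeFn_smul a w, AEEqFun.coeFn_smul a u] with x h1 h2 h3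
    simp [h1, h2, h3, mul_left_comm]

/-! ### The logarithmic cover and analytic families of operators -/

/-- The logarithmic cover `Λ` of `ℂ \ {0}`, in its global holomorphic coordinate `ζ = log λ`:
the point `ζ = log r + i θ` lies over `λ = r e^{iθ}`, with `arg λ = θ ∈ ℝ`. -/
abbrev LogCover : Type := ℂ

/-- The covering map `Λ → ℂ \ {0}`. -/
def LogCover.proj (ζ : LogCover) : ℂ := Complex.exp ζ

/-- The physical half plane `{Im λ > 0}`, embedded into `Λ` as `{0 < arg λ < π}`. -/
def LogCover.physical : Set LogCover := {ζ | 0 < ζ.im ∧ ζ.im < Real.pi}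

/-- A family of operators `H_comp → D_loc` is analytic on `Λ` if, for every compact set `K` and
every cutoff function `χ`, the operators `g ↦ χ R(ζ) g` from `L²` functions supported in `K` to the
domain of `P` (with the graph norm, that is, to the graph of `P` in `L² × L²`) are bounded and
depend analytically on `ζ ∈ Λ` in operator norm. -/
def IsAnalyticFamily (P : L2 →ₗ.[ℂ] L2) (R₀ : ℝ) (R : LogCover → Hcomp →ₗ[ℂ] Dloc P R₀) : Prop :=
  ∀ (K : Set Plane) (hK : IsCompact K) (χ : 𝓓((⊤ : Opens Plane), ℂ)), IsCutoff R₀ χ →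
    ∃ F : LogCover → (L2On K →L[ℂ] P.graph), AnalyticOnNhd ℂ F Set.univ ∧
      ∀ (ζ : LogCover) (g : L2On K),
        (((F ζ g : L2 × L2).1 : L2) : Plane → ℂ) =ᵐ[volume]
          fun x => χ x * (R ζ (Submodule.inclusion (L2On_le_Hcomp hK) g) :
            Plane →ₘ[(volume : Measure Plane)] ℂ) x

end AharonovBohm

end

/-! Work in the coordinate ζ = log λ, with spectral parameter z = e^{2ζ} and physical sheet 0 < Im ζ
< π. The Friedrichs extension P₀ is nonnegative and self-adjoint: Riesz representation on the form
domain produces its resolvent G at -1 (`exists_isPosResolvent_friedrichsExtension`), a positive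
contraction, and (P₀ - z)⁻¹ = G (1 - (z+1) G)⁻¹ for z off [0,∞). This settles the physical half
plane.

For the continuation, decompose into angular momenta k about c, with ν = |k + β|. Up to the phase
e^{-if}, the Gaussians h_τ = τ^{-(ν+1)} r^ν e^{ikθ} e^{-r²/4τ} solve the heat equation ∂_τ h = -P₀ h
(`hasDerivAt_heatVec`), and ⟨h_b, h_a⟩ = C_k (a+b)^{-(ν+1)}. Hence ∂_τ (e^{zτ} R(z) h_τ) = -e^{zτ}
h_τ, and ⟨h_b, R(z) h_a⟩ = C_k F(a+b), where F(σ) = e^{-zσ} ∫_σ^∞ e^{zt} t^{-(ν+1)} dt for z < 0.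
This F is an incomplete Gamma function, entire in ζ (`exists_modeKernel`,
`inner_resolvent_heatVec`).

Entire matrix elements between a dense family of vectors do not yet give bounded operators. The
missing bound comes from the monodromy: under ζ ↦ ζ + πi the kernel F(a+b) jumps by κ z^ν e^{-za}
e^{-zb}, which in each mode is of rank one, given by the regular Bessel solutions. After
multiplication by e^{-δr²} on both sides the sum of these jumps over k is a bounded operator as long
as |z| ≤ δ (`norm_jumpOp_le`). So form bounds pass from one half turn to the next. On the lines Im ζ
∈ πℤ the self-adjoint bound 1/|Im z| is only of order one over the distance to the line, and the
maximum principle removes this singularity (`exists_continuation`). Locally bounded families with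
analytic matrix elements are analytic in operator norm. With δ = e^{2L} this continues the weighted
resolvent to Re ζ < L.

On balls the weight is invertible, so the resolvent cut off to balls is entire in ζ, and these
localizations glue to operators into L²_loc. Values in the graph norm come from the Caccioppoli
inequality: χu and P₀(χu) are controlled by u and P₀u on a ball (`exists_norm_cutoff_le`), hence are
the image under a bounded map of a pair which is already continued (`exists_graph_map`,
`exists_graph_family`). -/

noncomputable section

namespace AharonovBohm

/-! ### The resolvent of a Friedrichs extension -/

section FormGraph

variable {H K : Type*} [NormedAddCommGroup H] [InnerProductSpace ℂ H]
  [NormedAddCommGroup K] [InnerProductSpace ℂ K]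

/-- The graph of the closure of an operator `D` defined on the domain of `T`. -/
def formGraph (T : H →ₗ.[ℂ] H) (D : T.domain →ₗ[ℂ] K) : Submodule ℂ (WithLp 2 (H × K)) :=
  (LinearMap.range ((WithLp.linearEquiv 2 ℂ (H × K)).symm.toLinearMap ∘ₗ
    (T.domain.subtype.prod D))).topologicalClosure

theorem mem_formGraph_of_mem (T : H →ₗ.[ℂ] H) (D : T.domain →ₗ[ℂ] K) (v : T.domain) :
    WithLp.toLp 2 ((v : H), D v) ∈ formGraph T D :=
  Submodule.le_topologicalClosure _ ⟨v, rfl⟩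

theorem mem_formGraph_iff {T : H →ₗ.[ℂ] H} {D : T.domain →ₗ[ℂ] K} {u : H} {d : K} :
    WithLp.toLp 2 (u, d) ∈ formGraph T D ↔ ∃ v : ℕ → T.domain,
      Tendsto (fun k => (v k : H)) atTop (𝓝 u) ∧ Tendsto (fun k => D (v k)) atTop (𝓝 d) := by
  constructor
  · intro h
    obtain ⟨x, hx, hlim⟩ := mem_closure_iff_seq_limit.1 h
    choose v hv using hx
    refine ⟨v, ?_, ?_⟩
    · have := ((WithLp.prod_continuous_ofLp 2 H K).tendsto _).comp hlim
      have h2 := (continuous_fst.tendsto _).comp this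
      refine h2.congr fun k => ?_
      simp [← hv k]
    · have := ((WithLp.prod_continuous_ofLp 2 H K).tendsto _).comp hlim
      have h2 := (continuous_snd.tendsto _).comp this
      refine h2.congr fun k => ?_
      simp [← hv k]
  · rintro ⟨v, h1, h2⟩
    refine mem_closure_of_tendsto (((WithLp.prod_continuous_toLp 2 H K).tendsto _).comp
      (h1.prodMk_nhds h2)) (Eventually.of_forall fun k => ⟨v k, rfl⟩)

variable {T : H →ₗ.[ℂ] H} {D : T.domain →ₗ[ℂ] K}

theorem energy_eq_norm_sq (hD : ∀ u v : T.domain, ⟪T u, (v : H)⟫_ℂ = ⟪D u, D v⟫_ℂ)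
    (u : T.domain) : energy T u = ‖D u‖ ^ 2 := by
  rw [energy, hD, ← inner_self_eq_norm_sq (𝕜 := ℂ)]
  rfl

/-- The energy is ‖D ·‖², so being Cauchy for the form means that D converges. This realizes the
form domain as the projection of a complete space. -/
theorem mem_formDomain_iff [CompleteSpace K]
    (hD : ∀ u v : T.domain, ⟪T u, (v : H)⟫_ℂ = ⟪D u, D v⟫_ℂ) (hT : ∀ u, 0 ≤ energy T u) {u : H} :
    u ∈ formDomain T hT ↔ ∃ d : K, WithLp.toLp 2 (u, d) ∈ formGraph T D := by
  simp only [mem_formGraph_iff]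
  constructor
  · rintro ⟨v, hv, hc⟩
    have : CauchySeq fun k => D (v k) := by
      refine Metric.cauchySeq_iff.2 fun ε hε => ?_
      obtain ⟨N, hN⟩ := hc (ε ^ 2) (by positivity)
      refine ⟨N, fun j hj k hk => ?_⟩
      have := hN j k hj hk
      rw [energy_eq_norm_sq hD, map_sub, ← dist_eq_norm] at this
      exact lt_of_pow_lt_pow_left₀ 2 hε.le this
    obtain ⟨d, hd⟩ := cauchySeq_tendsto_of_complete this
    exact ⟨d, v, hv, hd⟩
  · rintro ⟨d, v, hv, hd⟩
    refine ⟨v, hv, fun ε hε => ?_⟩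
    obtain ⟨N, hN⟩ := Metric.cauchySeq_iff.1 hd.cauchySeq (√ε) (by positivity)
    refine ⟨N, fun j k hj hk => ?_⟩
    have := hN j hj k hk
    rw [energy_eq_norm_sq hD, map_sub, ← dist_eq_norm]
    calc dist (D (v j)) (D (v k)) ^ 2 < √ε ^ 2 := by gcongr
      _ = ε := Real.sq_sqrt hε.le

/-- Only the left slot is approximated, so no convergence of `T` is needed. -/
theorem inner_formGraph_domain (hD : ∀ u v : T.domain, ⟪T u, (v : H)⟫_ℂ = ⟪D u, D v⟫_ℂ) {u : H}
    {d : K} (h : WithLp.toLp 2 (u, d) ∈ formGraph T D) (φ : T.domain) :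
    ⟪u, T φ⟫_ℂ = ⟪d, D φ⟫_ℂ := by
  obtain ⟨v, hv, hd⟩ := mem_formGraph_iff.1 h
  refine tendsto_nhds_unique (hv.inner tendsto_const_nhds)
    ((hd.inner (tendsto_const_nhds (x := D φ))).congr fun k => ?_)
  rw [← inner_conj_symm, ← hD, inner_conj_symm]

/-- Green's identity with the second slot closed up as well. It rests on u lying in the form domain;
for a general element of the domain of `T†` a boundary term could survive. -/
theorem inner_adjoint_formGraph [CompleteSpace H] (hdense : Dense (T.domain : Set H))
    (hD : ∀ u v : T.domain, ⟪T u, (v : H)⟫_ℂ = ⟪D u, D v⟫_ℂ) (u : T†.domain) {d : K}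
    (hu : WithLp.toLp 2 ((u : H), d) ∈ formGraph T D) {w : H} {e : K}
    (hw : WithLp.toLp 2 (w, e) ∈ formGraph T D) : ⟪T† u, w⟫_ℂ = ⟪d, e⟫_ℂ := by
  obtain ⟨v, hv, he⟩ := mem_formGraph_iff.1 hw
  refine tendsto_nhds_unique (tendsto_const_nhds.inner hv)
    ((tendsto_const_nhds.inner he).congr fun k => ?_)
  rw [← inner_formGraph_domain hD hu]
  exact (LinearPMap.adjoint_isFormalAdjoint hdense u (v k)).symm

end FormGraph

/-! ### Resolvents of nonnegative self-adjoint operators. -/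

section Resolvent

variable {H : Type*} [NormedAddCommGroup H] [InnerProductSpace ℂ H]

/-- `G` is the resolvent of `P` at `-1`, and `P` is nonnegative and self-adjoint. -/
structure IsPosResolvent (P : H →ₗ.[ℂ] H) (G : H →L[ℂ] H) : Prop where
  isPositive : G.IsPositive
  norm_le : ‖G‖ ≤ 1
  isResolvent : IsResolvent P (-1) G

/-- Let J be the projection of the form graph to H and G = J J*. Then J* f is the Riesz
representative of v ↦ ⟨f, J v⟩ for the inner product ⟨u,v⟩ + ⟨Du,Dv⟩, that is, the weak solution of
(T + 1) u = f. Positivity and ‖G‖ ≤ 1 are immediate from this factorization. -/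
theorem exists_isPosResolvent_friedrichsExtension [CompleteSpace H] {K : Type*} [NormedAddCommGroup K]
    [InnerProductSpace ℂ K] [CompleteSpace K] {T : H →ₗ.[ℂ] H} {D : T.domain →ₗ[ℂ] K}
    (hdense : Dense (T.domain : Set H))
    (hD : ∀ u v : T.domain, ⟪T u, (v : H)⟫_ℂ = ⟪D u, D v⟫_ℂ) (hT : ∀ u, 0 ≤ energy T u) :
    ∃ G : H →L[ℂ] H, IsPosResolvent (friedrichsExtension T hT) G := by
  have : CompleteSpace (formGraph T D) :=
    (Submodule.isClosed_topologicalClosure _).completeSpace_coe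
  let J : formGraph T D →L[ℂ] H :=
    ((ContinuousLinearMap.fst ℂ H K).comp
      (WithLp.prodContinuousLinearEquiv 2 ℂ H K).toContinuousLinearMap).comp
        (formGraph T D).subtypeL
  have hJ : ∀ v, J v = (WithLp.ofLp (v : WithLp 2 (H × K))).1 := fun _ => rfl
  have hJn : ‖J‖ ≤ 1 := by
    refine J.opNorm_le_bound zero_le_one fun v => ?_
    rw [one_mul, hJ]
    exact WithLp.norm_fst_le H (v : WithLp 2 (H × K))
  let G : H →L[ℂ] H := J ∘L J.adjoint
  have hG : ∀ f, G f = J (J.adjoint f) := fun _ => rfl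
  have hGpair : ∀ f, ∃ d, (WithLp.toLp 2 (G f, d) ∈ formGraph T D) ∧ ∀ φ : T.domain,
      ⟪G f, (φ : H)⟫_ℂ + ⟪d, D φ⟫_ℂ = ⟪f, (φ : H)⟫_ℂ := by
    intro f
    refine ⟨(WithLp.ofLp (J.adjoint f : WithLp 2 (H × K))).2, (J.adjoint f).2, fun φ => ?_⟩
    have := J.adjoint_inner_left ⟨_, mem_formGraph_of_mem T D φ⟩ f
    rw [hJ] at this
    simpa [WithLp.prod_inner_apply, hG, hJ] using this
  have hadj : ∀ f, ∃ h : G f ∈ T†.domain, T† ⟨G f, h⟩ = f - G f := by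
    intro f
    obtain ⟨d, hd, hφ⟩ := hGpair f
    have key : ∀ φ : T.domain, ⟪f - G f, (φ : H)⟫_ℂ = ⟪G f, T φ⟫_ℂ := by
      intro φ
      rw [inner_sub_left, ← hφ φ, inner_formGraph_domain hD hd]
      ring
    exact ⟨LinearPMap.mem_adjoint_domain_of_exists _ ⟨_, key⟩,
      LinearPMap.adjoint_apply_eq hdense _ key⟩
  have hdom : ∀ f, ∃ h : G f ∈ (friedrichsExtension T hT).domain,
      friedrichsExtension T hT ⟨G f, h⟩ = f - G f := by
    intro f
    obtain ⟨h, hf⟩ := hadj f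
    obtain ⟨d, hd, -⟩ := hGpair f
    refine ⟨⟨(mem_formDomain_iff hD hT).2 ⟨d, hd⟩, h⟩, ?_⟩
    rw [← hf]
    exact LinearPMap.domRestrict_apply rfl
  -- If T†u = -u, Green's identity with w = u reads -‖u‖² = ‖d‖².
  have hinj : ∀ u : (friedrichsExtension T hT).domain,
      friedrichsExtension T hT u + (u : H) = 0 → (u : H) = 0 := by
    rintro ⟨u, hu1, hu2⟩ h0
    obtain ⟨d, hd⟩ := (mem_formDomain_iff hD hT).1 hu1
    have h1 : friedrichsExtension T hT ⟨u, hu1, hu2⟩ = T† ⟨u, hu2⟩ :=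
      LinearPMap.domRestrict_apply rfl
    have h2 := inner_adjoint_formGraph hdense hD ⟨u, hu2⟩ hd hd
    rw [h1] at h0
    have h3 : T† ⟨u, hu2⟩ = -u := eq_neg_of_add_eq_zero_left h0
    rw [h3, inner_neg_left] at h2
    have h4 := congrArg Complex.re h2
    have h5 : (0 : ℝ) ≤ (⟪d, d⟫_ℂ).re := inner_self_nonneg (𝕜 := ℂ)
    have h6 : (⟪u, u⟫_ℂ).re = ‖u‖ ^ 2 := inner_self_eq_norm_sq (𝕜 := ℂ) u
    rw [Complex.neg_re, h6] at h4
    have : ‖u‖ ^ 2 = 0 := le_antisymm (by linarith) (by positivity)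
    simpa using this
  refine ⟨G, ContinuousLinearMap.isPositive_self_comp_adjoint J, ?_, ?_, ?_⟩
  · calc ‖G‖ ≤ ‖J‖ * ‖J.adjoint‖ := ContinuousLinearMap.opNorm_comp_le _ _
      _ ≤ 1 * 1 := by
        gcongr
        rwa [LinearIsometryEquiv.norm_map]
      _ = 1 := one_mul 1
  · intro f
    obtain ⟨h, hf⟩ := hdom f
    refine ⟨h, ?_⟩
    rw [hf]
    simp
  · intro u
    obtain ⟨h, hf⟩ := hdom (friedrichsExtension T hT u - (-1 : ℂ) • (u : H))
    have := hinj (⟨_, h⟩ - u) (by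
      rw [LinearPMap.map_sub, hf, Submodule.coe_sub]
      module)
    simpa [sub_eq_zero] using this

variable {P : H →ₗ.[ℂ] H} {G : H →L[ℂ] H}

/-- Writing u = G f gives ⟨P u, u⟩ = ⟨f, G f⟩ - ‖u‖², which is real because G is positive. -/
theorem IsPosResolvent.inner_im_eq_zero (hG : IsPosResolvent P G) (u : P.domain) :
    (⟪P u, (u : H)⟫_ℂ).im = 0 := by
  have h := hG.isResolvent.2 u
  set f := P u - (-1 : ℂ) • (u : H) with hf
  have h1 : P u = f - (u : H) := by simp [hf]
  rw [h1, inner_sub_left, Complex.sub_im]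
  have h2 : (⟪(u : H), u⟫_ℂ).im = 0 := inner_self_im (𝕜 := ℂ) (u : H)
  have h3 : (⟪f, (u : H)⟫_ℂ).im = 0 := by
    rw [← h]
    have h4 := (ContinuousLinearMap.isPositive_iff_complex G).1 hG.isPositive f
    have h5 := congrArg Complex.im h4.1
    have h6 : (⟪f, G f⟫_ℂ).im = -(⟪G f, f⟫_ℂ).im := by rw [← inner_conj_symm]; rfl
    rw [h6, ← h5]
    simp
  rw [h2, h3, sub_zero]

/-- Take imaginary parts in ⟨(P - z) R g, R g⟩ = ⟨g, R g⟩; the term with P is real. -/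
theorem IsPosResolvent.norm_resolvent_le (hG : IsPosResolvent P G) {z : ℂ} {R : H →L[ℂ] H}
    (hR : IsResolvent P z R) (hz : z.im ≠ 0) : ‖R‖ ≤ |z.im|⁻¹ := by
  refine R.opNorm_le_bound (by positivity) fun g => ?_
  obtain ⟨hm, he⟩ := hR.1 g
  have h1 := hG.inner_im_eq_zero ⟨R g, hm⟩
  have h2 : P ⟨R g, hm⟩ = g + z • R g := eq_add_of_sub_eq he
  rw [h2, inner_add_left, inner_smul_left, inner_self_eq_norm_sq_to_K] at h1
  have h3 : (starRingEnd ℂ z * ((‖R g‖ : ℂ)) ^ 2).im = -z.im * ‖R g‖ ^ 2 := by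
    rw [← Complex.ofReal_pow, Complex.im_mul_ofReal]
    simp
  have h4 : |z.im| * ‖R g‖ ^ 2 ≤ ‖g‖ * ‖R g‖ := by
    have h5 : (⟪g, R g⟫_ℂ).im = z.im * ‖R g‖ ^ 2 := by
      have h1' : (⟪g, R g⟫_ℂ).im + (starRingEnd ℂ z * ((‖R g‖ : ℂ)) ^ 2).im = 0 := h1
      rw [h3] at h1'
      linarith
    calc |z.im| * ‖R g‖ ^ 2 = |(⟪g, R g⟫_ℂ).im| := by
          rw [h5, abs_mul, abs_of_nonneg (by positivity : 0 ≤ ‖R g‖ ^ 2)]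
      _ ≤ ‖⟪g, R g⟫_ℂ‖ := Complex.abs_im_le_norm _
      _ ≤ _ := norm_inner_le_norm _ _
  have hpos : 0 < |z.im| := abs_pos.2 hz
  rw [inv_mul_eq_div, le_div_iff₀ hpos]
  rcases eq_or_lt_of_le (norm_nonneg (R g)) with h0 | h0
  · rw [← h0, zero_mul]
    positivity
  · have : (‖R g‖ * |z.im|) * ‖R g‖ ≤ ‖g‖ * ‖R g‖ := by nlinarith
    exact le_of_mul_le_mul_right this h0

/-- The graph becomes the solution set of a continuous equation, hence closed, and complete in the
graph norm. -/
theorem IsPosResolvent.mem_graph_iff (hG : IsPosResolvent P G) (x : H × H) :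
    x ∈ P.graph ↔ G (x.2 + x.1) = x.1 := by
  rw [LinearPMap.mem_graph_iff]
  constructor
  · rintro ⟨u, h1, h2⟩
    rw [← h1, ← h2]
    simpa using hG.isResolvent.2 u
  · intro h
    obtain ⟨hm, he⟩ := hG.isResolvent.1 (x.2 + x.1)
    refine ⟨⟨_, hm⟩, h, ?_⟩
    have h1 : P ⟨_, hm⟩ = x.2 + x.1 - G (x.2 + x.1) := eq_sub_of_add_eq
      (by rwa [neg_one_smul, sub_neg_eq_add] at he)
    rw [h1, h, add_sub_cancel_right]

theorem IsPosResolvent.isClosed_graph (hG : IsPosResolvent P G) :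
    IsClosed (P.graph : Set (H × H)) := by
  have : (P.graph : Set (H × H)) = {x | G (x.2 + x.1) = x.1} := by
    ext x
    exact hG.mem_graph_iff x
  rw [this]
  exact isClosed_eq (by fun_prop) (by fun_prop)

/-- The resolvent at `z` expressed through the resolvent `G` at `-1`. -/
def resolventOf (G : H →L[ℂ] H) (z : ℂ) : H →L[ℂ] H := G * Ring.inverse (1 - (z + 1) • G)

variable [CompleteSpace H]

-- The spectrum of a positive contraction lies in [0,1], and (z+1)⁻¹ ∈ (0,1] exactly when z ∈ [0,∞).
open scoped ComplexOrder in
theorem IsPosResolvent.isUnit (hG : IsPosResolvent P G) {z : ℂ} (hz : ∀ r : ℝ, 0 ≤ r → z ≠ r) :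
    IsUnit (1 - (z + 1) • G) := by
  by_cases h : z + 1 = 0
  · simp [h]
  have h1 : (z + 1)⁻¹ ∉ spectrum ℂ G := by
    intro hm
    have hsa : IsSelfAdjoint G := hG.isPositive.isSelfAdjoint
    have h2 : (z + 1)⁻¹ = (((z + 1)⁻¹).re : ℂ) := hsa.mem_spectrum_eq_re hm
    have h3 : 0 ≤ (z + 1)⁻¹ :=
      spectrum_nonneg_of_nonneg ((ContinuousLinearMap.nonneg_iff_isPositive G).2 hG.isPositive) hm
    have h4 : ‖(z + 1)⁻¹‖ ≤ 1 := by
      have := spectrum.norm_le_norm_mul_of_mem hm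
      have h1 : ‖(1 : H →L[ℂ] H)‖ ≤ 1 := ContinuousLinearMap.norm_id_le
      calc _ ≤ ‖G‖ * ‖(1 : H →L[ℂ] H)‖ := this
        _ ≤ 1 * 1 := by gcongr; exact hG.norm_le
        _ = 1 := one_mul 1
    set t := ((z + 1)⁻¹).re
    have h5 : 0 ≤ t := (Complex.le_def.1 h3).1
    have h6 : t ≤ 1 := by
      rw [h2, Complex.norm_real] at h4
      exact (le_abs_self t).trans h4
    have h7 : t ≠ 0 := by
      intro h0
      rw [h0] at h2
      exact h (by simpa using h2)
    have h8 : z = ((t⁻¹ - 1 : ℝ) : ℂ) := by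
      push_cast
      rw [← h2, inv_inv]
      ring
    refine hz (t⁻¹ - 1) ?_ h8
    have : 0 < t := lt_of_le_of_ne h5 (Ne.symm h7)
    rw [sub_nonneg]
    exact (one_le_inv₀ this).2 h6
  rw [spectrum.notMem_iff] at h1
  have h2 : 1 - (z + 1) • G = (z + 1) • (algebraMap ℂ (H →L[ℂ] H) (z + 1)⁻¹ - G) := by
    rw [smul_sub, Algebra.algebraMap_eq_smul_one, smul_smul, mul_inv_cancel₀ h, one_smul]
  rw [h2]
  exact (IsUnit.smul (Units.mk0 _ h) h1 :)

/-- From (P + 1) G = 1 follows (P - z) G = 1 - (z+1) G. The inverse of the right side commutes with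
G, which yields both one-sided identities. -/
theorem IsPosResolvent.isResolvent_resolventOf (hG : IsPosResolvent P G) {z : ℂ}
    (hz : ∀ r : ℝ, 0 ≤ r → z ≠ r) : IsResolvent P z (resolventOf G z) := by
  have hu := hG.isUnit hz
  set A := 1 - (z + 1) • G with hA
  have h1 : A * Ring.inverse A = 1 := Ring.mul_inverse_cancel _ hu
  have h2 : Ring.inverse A * A = 1 := Ring.inverse_mul_cancel _ hu
  have hcomm : A * G = G * A := by
    rw [hA]
    simp [sub_mul, mul_sub]
  have hcomm' : resolventOf G z = Ring.inverse A * G := by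
    rw [resolventOf, ← hA]
    calc G * Ring.inverse A = (Ring.inverse A * A) * G * Ring.inverse A := by rw [h2, one_mul]
      _ = Ring.inverse A * (A * G) * Ring.inverse A := by simp only [mul_assoc]
      _ = Ring.inverse A * G * (A * Ring.inverse A) := by rw [hcomm]; simp only [mul_assoc]
      _ = Ring.inverse A * G := by rw [h1, mul_one]
  constructor
  · intro g
    obtain ⟨hm, he⟩ := hG.isResolvent.1 (Ring.inverse A g)
    refine ⟨hm, ?_⟩
    have h3 : A (Ring.inverse A g) = g := by
      rw [← mul_apply_eq_comp, h1]
      rfl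
    have h4 : (resolventOf G z) g = G (Ring.inverse A g) := rfl
    change P ⟨G (Ring.inverse A g), hm⟩ - z • G (Ring.inverse A g) = g
    conv_rhs => rw [← h3]
    have h5 : A (Ring.inverse A g) = Ring.inverse A g - (z + 1) • G (Ring.inverse A g) := rfl
    rw [h5]
    nth_rewrite 3 [← he]
    module
  · intro u
    rw [hcomm']
    have h3 := hG.isResolvent.2 u
    change Ring.inverse A (G _) = _
    have h4 : G (P u - z • (u : H)) = A u := by
      have h5 : P u - z • (u : H) = (P u - (-1 : ℂ) • (u : H)) - (z + 1) • (u : H) := by module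
      rw [h5, map_sub, h3, map_smul]
      rfl
    rw [h4, ← mul_apply_eq_comp, h2]
    rfl

theorem IsPosResolvent.differentiableAt_resolventOf (hG : IsPosResolvent P G) {z : ℂ}
    (hz : ∀ r : ℝ, 0 ≤ r → z ≠ r) : DifferentiableAt ℂ (resolventOf G) z := by
  have hu := hG.isUnit hz
  have h1 : DifferentiableAt ℂ (fun z : ℂ => 1 - (z + 1) • G) z := by fun_prop
  have h2 : DifferentiableAt ℂ Ring.inverse (1 - (z + 1) • G) := by
    obtain ⟨x, hx⟩ := hu
    rw [← hx]
    exact differentiableAt_inverse x.isUnit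
  exact (h2.comp z h1).const_mul G

end Resolvent

/-! ### Analytic continuation of operator families from matrix elements -/

section Continuation

/-- Two Cauchy estimates on discs of radii up to r/4 bound g'' by 16 m / r² on the half disc. The
constant involves only the supremum m, so the Taylor remainder is uniform over a family of matrix
elements. -/
theorem norm_sub_sub_deriv_mul_le {g : ℂ → ℂ} {z₀ : ℂ} {r m : ℝ} (hr : 0 < r)
    (hg : DifferentiableOn ℂ g (Metric.ball z₀ r)) (hm : ∀ z ∈ Metric.ball z₀ r, ‖g z‖ ≤ m)
    {z : ℂ} (hz : z ∈ Metric.ball z₀ (r / 2)) :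
    ‖g z - g z₀ - (z - z₀) * deriv g z₀‖ ≤ 16 * m / r ^ 2 * ‖z - z₀‖ ^ 2 := by
  have hd1 : ∀ w ∈ Metric.ball z₀ (3 * r / 4), ‖deriv g w‖ ≤ 4 * m / r := by
    intro w hw
    have hsub : Metric.closedBall w (r / 8) ⊆ Metric.ball z₀ r := by
      intro x hx
      simp only [Metric.mem_ball, Metric.mem_closedBall] at *
      linarith [dist_triangle x w z₀]
    have hsub' : ∀ s < r / 4, Metric.closedBall w s ⊆ Metric.ball z₀ r := by
      intro s hs x hx
      simp only [Metric.mem_ball, Metric.mem_closedBall] at *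
      linarith [dist_triangle x w z₀]
    have key : ∀ s, 0 < s → s < r / 4 → ‖deriv g w‖ ≤ m / s := fun s hs hs' =>
      Complex.norm_deriv_le_of_forall_mem_sphere_norm_le hs
        ((hg.mono (hsub' s hs')).diffContOnCl_ball subset_rfl)
        fun x hx => hm x (hsub' s hs' (Metric.sphere_subset_closedBall hx))
    have hlim : Tendsto (fun s => m / s) (𝓝[<] (r / 4)) (𝓝 (m / (r / 4))) :=
      ((continuousAt_const.div continuousAt_id (by simp; positivity)).tendsto).mono_left
        nhdsWithin_le_nhds
    have h2 : ‖deriv g w‖ ≤ m / (r / 4) := by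
      refine ge_of_tendsto hlim ?_
      filter_upwards [Ioo_mem_nhdsLT (by positivity : (0 : ℝ) < r / 4)] with s hs
      exact key s hs.1 hs.2
    calc _ ≤ _ := h2
      _ = 4 * m / r := by field_simp
  have hdiff : DifferentiableOn ℂ (deriv g) (Metric.ball z₀ r) := hg.deriv Metric.isOpen_ball
  have hd2 : ∀ w ∈ Metric.ball z₀ (r / 2), ‖deriv (deriv g) w‖ ≤ 16 * m / r ^ 2 := by
    intro w hw
    have hsub' : ∀ s < r / 4, Metric.closedBall w s ⊆ Metric.ball z₀ (3 * r / 4) := by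
      intro s hs x hx
      simp only [Metric.mem_ball, Metric.mem_closedBall] at *
      linarith [dist_triangle x w z₀]
    have hsub : Metric.ball z₀ (3 * r / 4) ⊆ Metric.ball z₀ r :=
      Metric.ball_subset_ball (by linarith)
    have key : ∀ s, 0 < s → s < r / 4 → ‖deriv (deriv g) w‖ ≤ 4 * m / r / s := fun s hs hs' =>
      Complex.norm_deriv_le_of_forall_mem_sphere_norm_le hs
        ((hdiff.mono ((hsub' s hs').trans hsub)).diffContOnCl_ball subset_rfl)
        fun x hx => hd1 x (hsub' s hs' (Metric.sphere_subset_closedBall hx))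
    have hlim : Tendsto (fun s => 4 * m / r / s) (𝓝[<] (r / 4)) (𝓝 (4 * m / r / (r / 4))) :=
      ((continuousAt_const.div continuousAt_id (by simp; positivity)).tendsto).mono_left
        nhdsWithin_le_nhds
    have h2 : ‖deriv (deriv g) w‖ ≤ 4 * m / r / (r / 4) := by
      refine ge_of_tendsto hlim ?_
      filter_upwards [Ioo_mem_nhdsLT (by positivity : (0 : ℝ) < r / 4)] with s hs
      exact key s hs.1 hs.2
    calc _ ≤ _ := h2
      _ = _ := by field_simp; ring
  have hhalf : Metric.ball z₀ (r / 2) ⊆ Metric.ball z₀ r := Metric.ball_subset_ball (by linarith)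
  have hz₀ : z₀ ∈ Metric.ball z₀ (r / 2) := Metric.mem_ball_self (by positivity)
  have hd3 : ∀ w ∈ Metric.ball z₀ (r / 2),
      ‖deriv g w - deriv g z₀‖ ≤ 16 * m / r ^ 2 * ‖w - z₀‖ := by
    intro w hw
    exact (convex_ball z₀ (r / 2)).norm_image_sub_le_of_norm_deriv_le (𝕜 := ℂ)
      (fun x hx => hdiff.differentiableAt (Metric.isOpen_ball.mem_nhds (hhalf hx))) hd2 hz₀ hw
  have hm0 : 0 ≤ m := (norm_nonneg _).trans (hm z₀ (hhalf hz₀))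
  let k : ℂ → ℂ := fun x => g x - x * deriv g z₀
  have hk : ∀ x ∈ Metric.ball z₀ (r / 2), HasDerivAt k (deriv g x - deriv g z₀) x := by
    intro x hx
    have h1 := (hg.differentiableAt (Metric.isOpen_ball.mem_nhds (hhalf hx))).hasDerivAt
    have h2 := h1.fun_sub ((hasDerivAt_id' x).mul_const (deriv g z₀))
    rwa [one_mul] at h2
  have hseg : segment ℝ z₀ z ⊆ Metric.ball z₀ (r / 2) :=
    (convex_ball z₀ (r / 2)).segment_subset hz₀ hz
  have hk' := (convex_segment z₀ z).norm_image_sub_le_of_norm_hasDerivWithin_le (𝕜 := ℂ)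
    (f := k) (C := 16 * m / r ^ 2 * ‖z - z₀‖)
    (fun x hx => (hk x (hseg hx)).hasDerivWithinAt)
    (fun x hx => by
      refine (hd3 x (hseg hx)).trans ?_
      gcongr
      exact norm_sub_le_of_mem_segment hx)
    (left_mem_segment ℝ z₀ z) (right_mem_segment ℝ z₀ z)
  calc _ = ‖k z - k z₀‖ := by congr 1; simp only [k]; ring
    _ ≤ _ := hk'
    _ = _ := by ring

/-- For real z₀ and |w - z₀| = r one has |(w - z₀)² - r²| = 2r |Im w|, since r² = (w - z₀) times its
conjugate. Multiplying g by this factor cancels the singular bound on the circle; the maximum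
principle applies, and on the half disc the factor is at least 3r²/4. -/
theorem norm_le_of_norm_mul_abs_im_le {g : ℂ → ℂ} (hg : Differentiable ℂ g) {z₀ : ℂ}
    (hz₀ : z₀.im = 0) {r c : ℝ} (hr : 0 < r)
    (h : ∀ w ∈ Metric.closedBall z₀ r, ‖g w‖ * |w.im| ≤ c) {z : ℂ}
    (hz : z ∈ Metric.ball z₀ (r / 2)) : ‖g z‖ ≤ 4 * c / r := by
  have hc : 0 ≤ c := le_trans (by positivity) (h z₀ (Metric.mem_closedBall_self hr.le))
  let k : ℂ → ℂ := fun w => ((w - z₀) ^ 2 - r ^ 2) * g w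
  have hk : Differentiable ℂ k := by fun_prop
  have hfr : ∀ w ∈ frontier (Metric.ball z₀ r), ‖k w‖ ≤ 2 * r * c := by
    intro w hw
    rw [frontier_ball z₀ hr.ne'] at hw
    have hw1 : ‖w - z₀‖ = r := by simpa [dist_eq_norm] using hw
    have h1 : ‖(w - z₀) ^ 2 - (r : ℂ) ^ 2‖ = 2 * r * |w.im| := by
      have h2 : (r : ℂ) ^ 2 = (w - z₀) * starRingEnd ℂ (w - z₀) := by
        rw [Complex.mul_conj']
        rw [hw1]
      have h3 : w - z₀ - starRingEnd ℂ (w - z₀) = ((2 * w.im : ℝ) : ℂ) * Complex.I := by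
        rw [Complex.sub_conj]
        simp [hz₀]
      rw [h2, pow_two, ← mul_sub, h3, norm_mul, norm_mul, Complex.norm_I, mul_one, hw1,
        Complex.norm_real, Real.norm_eq_abs, abs_mul]
      norm_num
      ring
    have h4 := h w (Metric.sphere_subset_closedBall hw)
    calc ‖k w‖ = 2 * r * (‖g w‖ * |w.im|) := by rw [norm_mul, h1]; ring
      _ ≤ 2 * r * c := by gcongr
  have hz1 : ‖z - z₀‖ < r / 2 := by simpa [dist_eq_norm] using hz
  have h5 : ‖k z‖ ≤ 2 * r * c :=
    Complex.norm_le_of_forall_mem_frontier_norm_le Metric.isBounded_ball hk.diffContOnCl hfr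
      (subset_closure (Metric.ball_subset_ball (by linarith) hz))
  have h6 : 3 / 4 * r ^ 2 ≤ ‖(z - z₀) ^ 2 - (r : ℂ) ^ 2‖ := by
    have h7 : ‖(r : ℂ) ^ 2‖ = r ^ 2 := by simp
    have h8 : ‖(z - z₀) ^ 2‖ ≤ (r / 2) ^ 2 := by
      rw [norm_pow]
      gcongr
    have h9 := norm_sub_norm_le ((r : ℂ) ^ 2) ((z - z₀) ^ 2)
    rw [norm_sub_rev] at h9
    nlinarith
  have h10 : 3 / 4 * r ^ 2 * ‖g z‖ ≤ 2 * r * c := by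
    refine le_trans ?_ h5
    rw [norm_mul]
    gcongr
  rw [le_div_iff₀ hr]
  have : r * (3 * (‖g z‖ * r)) ≤ r * (8 * c) := by nlinarith
  have := le_of_mul_le_mul_left this hr
  linarith

variable {H X : Type*} [NormedAddCommGroup H] [InnerProductSpace ℂ H] [AddCommGroup X] [Module ℂ X]
  {E : X →ₗ[ℂ] H}

theorem opNorm_le_of_inner_le (hE : DenseRange E) {A : H →L[ℂ] H} {C : ℝ} (hC : 0 ≤ C)
    (h : ∀ y x, ‖⟪E y, A (E x)⟫_ℂ‖ ≤ C * ‖E y‖ * ‖E x‖) : ‖A‖ ≤ C := by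
  have h1 : ∀ v w : H, ‖⟪v, A w⟫_ℂ‖ ≤ C * ‖v‖ * ‖w‖ := by
    intro v w
    refine hE.induction_on₂ (p := fun v w => ‖⟪v, A w⟫_ℂ‖ ≤ C * ‖v‖ * ‖w‖)
      (isClosed_le (by fun_prop) (by fun_prop)) h v w
  refine A.opNorm_le_bound hC fun w => ?_
  have h2 := h1 (A w) w
  rw [inner_self_eq_norm_sq_to_K] at h2
  have h3 : ‖(((‖A w‖ : ℝ) : ℂ)) ^ 2‖ = ‖A w‖ * ‖A w‖ := by simp [pow_two]
  have h4 : ‖A w‖ * ‖A w‖ ≤ ‖A w‖ * (C * ‖w‖) := by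
    rw [← h3]
    refine h2.trans (le_of_eq ?_)
    ring
  rcases eq_or_lt_of_le (norm_nonneg (A w)) with h0 | h0
  · rw [← h0]
    positivity
  · exact le_of_mul_le_mul_left h4 h0

theorem eq_of_inner_eq (hE : DenseRange E) {A A' : H →L[ℂ] H}
    (h : ∀ y x, ⟪E y, A (E x)⟫_ℂ = ⟪E y, A' (E x)⟫_ℂ) : A = A' := by
  rw [← sub_eq_zero, ← norm_le_zero_iff]
  refine opNorm_le_of_inner_le hE le_rfl fun y x => ?_
  simp [h]

variable [CompleteSpace H]

/-- The bound forces φ to factor through E. For fixed y, Riesz turns φ y into a vector a(y); the map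
a is again bounded relative to E and extends to H, and its adjoint is the operator sought. -/
theorem exists_operator_of_sesquilinear (hE : DenseRange E) (φ : X →ₗ⋆[ℂ] X →ₗ[ℂ] ℂ) {C : ℝ}
    (h : ∀ y x, ‖φ y x‖ ≤ C * ‖E y‖ * ‖E x‖) :
    ∃ A : H →L[ℂ] H, ∀ y x, ⟪E y, A (E x)⟫_ℂ = φ y x := by
  have h1 : ∀ y, ∃ a : H, ‖a‖ ≤ C * ‖E y‖ ∧ ∀ x, ⟪a, E x⟫_ℂ = φ y x := by
    intro y
    by_cases hy : 0 ≤ C * ‖E y‖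
    · refine ⟨(InnerProductSpace.toDual ℂ H).symm ((φ y).extendOfNorm E), ?_, fun x => ?_⟩
      · rw [LinearIsometryEquiv.norm_map]
        exact LinearMap.opNorm_extendOfNorm_le hE hy (h y)
      · rw [InnerProductSpace.toDual_symm_apply]
        exact LinearMap.extendOfNorm_eq hE ⟨_, h y⟩ x
    -- A negative C leaves room only for E = 0, and then `hy` fails.
    · have h2 : ∀ x, E x = 0 := by
        intro x
        have h3 := (norm_nonneg _).trans (h y x)
        have h4 : ‖E x‖ ≤ 0 := by
          by_contra h5
          push Not at hy h5
          nlinarith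
        simpa using h4
      exact absurd (by rw [h2 y]; simp) hy
  choose a ha1 ha2 using h1
  have hext : ∀ u v : H, (∀ x, ⟪u, E x⟫_ℂ = ⟪v, E x⟫_ℂ) → u = v := by
    intro u v huv
    refine ext_inner_right ℂ fun w => ?_
    exact hE.induction_on (p := fun w => ⟪u, w⟫_ℂ = ⟪v, w⟫_ℂ) w
      (isClosed_eq (by fun_prop) (by fun_prop)) huv
  let f : X →ₗ[ℂ] H :=
    { toFun := a
      map_add' := fun y y' => hext _ _ fun x => by
        rw [inner_add_left, ha2, ha2, ha2, map_add]
        rfl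
      map_smul' := fun c y => hext _ _ fun x => by
        rw [RingHom.id_apply, inner_smul_left, ha2, ha2, map_smulₛₗ]
        rfl }
  refine ⟨(f.extendOfNorm E).adjoint, fun y x => ?_⟩
  rw [ContinuousLinearMap.adjoint_inner_right, LinearMap.extendOfNorm_eq hE ⟨C, ha1⟩]
  exact ha2 y x

/-- Weak analyticity together with local boundedness gives norm analyticity: the second-order Taylor
bound is uniform over matrix elements, so the difference quotients are Cauchy in operator norm. -/
theorem differentiableAt_of_differentiableAt_inner (hE : DenseRange E) {A : ℂ → H →L[ℂ] H} {z₀ : ℂ}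
    {r C : ℝ} (hr : 0 < r) (hC : ∀ z ∈ Metric.ball z₀ r, ‖A z‖ ≤ C)
    (hA : ∀ y x, DifferentiableOn ℂ (fun z => ⟪E y, A z (E x)⟫_ℂ) (Metric.ball z₀ r)) :
    DifferentiableAt ℂ A z₀ := by
  have hC0 : 0 ≤ C := (norm_nonneg _).trans (hC z₀ (Metric.mem_ball_self hr))
  have hslope : ∀ z ∈ Metric.ball z₀ (r / 2), ∀ w ∈ Metric.ball z₀ (r / 2), z ≠ z₀ → w ≠ z₀ →
      ‖slope A z₀ z - slope A z₀ w‖ ≤ 16 * C / r ^ 2 * (‖z - z₀‖ + ‖w - z₀‖) := by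
    intro z hz w hw hz0 hw0
    refine opNorm_le_of_inner_le hE (by positivity) fun y x => ?_
    set g : ℂ → ℂ := fun z => ⟪E y, A z (E x)⟫_ℂ with hg
    have hb : ∀ z ∈ Metric.ball z₀ r, ‖g z‖ ≤ C * ‖E y‖ * ‖E x‖ := by
      intro z hz
      calc ‖g z‖ ≤ ‖E y‖ * ‖A z (E x)‖ := norm_inner_le_norm _ _
        _ ≤ ‖E y‖ * (C * ‖E x‖) := by
          gcongr
          exact (A z).le_of_opNorm_le (hC z hz) _
        _ = _ := by ring
    have key : ∀ z ∈ Metric.ball z₀ (r / 2), z ≠ z₀ → ‖⟪E y, slope A z₀ z (E x)⟫_ℂ - deriv g z₀‖ ≤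
        16 * (C * ‖E y‖ * ‖E x‖) / r ^ 2 * ‖z - z₀‖ := by
      intro z hz hz0
      have h1 := norm_sub_sub_deriv_mul_le hr (hA y x) hb hz
      have h2 : ⟪E y, slope A z₀ z (E x)⟫_ℂ = (z - z₀)⁻¹ * (g z - g z₀) := by
        rw [slope_def_module, smul_apply, inner_smul_right,
          sub_apply, inner_sub_right]
      have h0 : z - z₀ ≠ 0 := sub_ne_zero.2 hz0
      have h3 : ⟪E y, slope A z₀ z (E x)⟫_ℂ - deriv g z₀ =
          (z - z₀)⁻¹ * (g z - g z₀ - (z - z₀) * deriv g z₀) := by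
        rw [h2]
        field_simp
      rw [h3, norm_mul, norm_inv, inv_mul_le_iff₀ (norm_pos_iff.2 h0)]
      refine h1.trans (le_of_eq ?_)
      ring
    rw [sub_apply, inner_sub_right]
    calc _ = ‖(⟪E y, slope A z₀ z (E x)⟫_ℂ - deriv g z₀) -
          (⟪E y, slope A z₀ w (E x)⟫_ℂ - deriv g z₀)‖ := by congr 1; ring
      _ ≤ _ := norm_sub_le _ _
      _ ≤ _ := add_le_add (key z hz hz0) (key w hw hw0)
      _ = _ := by ring
  have hcauchy : Cauchy (map (slope A z₀) (𝓝[≠] z₀)) := by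
    rw [Metric.cauchy_iff]
    refine ⟨inferInstance, fun ε hε => ?_⟩
    set K := 16 * C / r ^ 2
    have hK : 0 ≤ K := by positivity
    set s := min (r / 2) (ε / (2 * (K + 1))) with hs
    have hs0 : 0 < s := by positivity
    refine ⟨slope A z₀ '' (Metric.ball z₀ s ∩ {z₀}ᶜ), image_mem_map
      (inter_mem (mem_nhdsWithin_of_mem_nhds (Metric.ball_mem_nhds _ hs0)) self_mem_nhdsWithin),
      ?_⟩
    rintro _ ⟨z, ⟨hz, hz0⟩, rfl⟩ _ ⟨w, ⟨hw, hw0⟩, rfl⟩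
    have hsub : Metric.ball z₀ s ⊆ Metric.ball z₀ (r / 2) :=
      Metric.ball_subset_ball (min_le_left _ _)
    rw [dist_eq_norm]
    refine (hslope z (hsub hz) w (hsub hw) hz0 hw0).trans_lt ?_
    rw [mem_ball_iff_norm] at hz hw
    have h1 : s ≤ ε / (2 * (K + 1)) := min_le_right _ _
    rw [le_div_iff₀ (by positivity)] at h1
    nlinarith
  obtain ⟨A', hA'⟩ := CompleteSpace.complete hcauchy
  exact (hasDerivAt_iff_tendsto_slope.2 hA').differentiableAt

/-- Continuation of an operator family `B` on the strip `0 < Im ζ < π` to a half plane. The matrix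
elements of `B` between the vectors `E y`, `E x` are assumed to extend to entire functions whose
increments under `ζ ↦ ζ + π i` are bounded by the norms of the vectors. -/
theorem exists_continuation (hE : DenseRange E) {L C : ℝ} {B : ℂ → H →L[ℂ] H}
    {φ : ℂ → X →ₗ⋆[ℂ] X →ₗ[ℂ] ℂ} (hφ : ∀ y x, Differentiable ℂ fun ζ => φ ζ y x)
    (hB : ∀ ζ ∈ LogCover.physical, ∀ y x, ⟪E y, B ζ (E x)⟫_ℂ = φ ζ y x)
    (hBc : ContinuousOn B LogCover.physical)
    (hBn : ∀ a : ℝ, ∃ c : ℝ, ∀ ζ ∈ LogCover.physical, |ζ.re - a| ≤ 1 / 2 →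
      (ζ.im ≤ 1 / 2 → ‖B ζ‖ * ζ.im ≤ c) ∧ (Real.pi - 1 / 2 ≤ ζ.im → ‖B ζ‖ * (Real.pi - ζ.im) ≤ c))
    (hJ : ∀ ζ : ℂ, ζ.re < L → ∀ y x,
      ‖φ (ζ + Real.pi * Complex.I) y x - φ ζ y x‖ ≤ C * ‖E y‖ * ‖E x‖) :
    ∃ A : ℂ → H →L[ℂ] H, DifferentiableOn ℂ A {ζ | ζ.re < L} ∧
      ∀ ζ ∈ LogCover.physical, ζ.re < L → A ζ = B ζ := by
  have hshift : ∀ (m : ℕ) (ζ : ℂ), ζ.re < L → ∀ y x,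
      ‖φ (ζ + m * (Real.pi * Complex.I)) y x - φ ζ y x‖ ≤ m * C * ‖E y‖ * ‖E x‖ := by
    intro m
    induction m with
    | zero => intro ζ _ y x; simp
    | succ m ih =>
      intro ζ hζ y x
      have h1 := hJ (ζ + m * (Real.pi * Complex.I)) (by simpa using hζ) y x
      have h2 := ih ζ hζ y x
      have h3 : ζ + ((m + 1 : ℕ) : ℂ) * (Real.pi * Complex.I) =
          ζ + m * (Real.pi * Complex.I) + Real.pi * Complex.I := by push_cast; ring
      rw [h3]
      calc _ ≤ _ := norm_sub_le_norm_sub_add_norm_sub _ (φ (ζ + m * (Real.pi * Complex.I)) y x) _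
        _ ≤ _ := add_le_add h1 h2
        _ = _ := by push_cast; ring
  -- `LB z₀` is a form bound uniform near z₀. It suffices to prove it everywhere to the left of L;
  -- bounded jumps make it invariant under translation by πi.
  let LB : ℂ → Prop := fun z₀ => ∃ r > 0, ∃ c, 0 ≤ c ∧ ∀ z ∈ Metric.ball z₀ r, z.re < L ∧
    ∀ y x, ‖φ z y x‖ ≤ c * ‖E y‖ * ‖E x‖
  have hLB_shift : ∀ (m : ℕ) (z₀ : ℂ),
      (LB z₀ ↔ LB (z₀ + m * (Real.pi * Complex.I))) := by
    intro m z₀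
    constructor
    · rintro ⟨r, hr, c, hc, h⟩
      refine ⟨r, hr, c + |m * C|, by positivity, fun z hz => ?_⟩
      have hz' : z - m * (Real.pi * Complex.I) ∈ Metric.ball z₀ r := by
        rw [mem_ball_iff_norm] at hz ⊢
        convert hz using 2
        ring
      obtain ⟨h1, h2⟩ := h _ hz'
      refine ⟨by simpa using h1, fun y x => ?_⟩
      have h3 := hshift m _ h1 y x
      rw [sub_add_cancel] at h3
      have h4 := h2 y x
      have h5 := norm_sub_norm_le (φ z y x) (φ (z - m * (Real.pi * Complex.I)) y x)
      have h6 : m * C * ‖E y‖ * ‖E x‖ ≤ |m * C| * ‖E y‖ * ‖E x‖ := by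
        gcongr
        exact le_abs_self _
      calc _ ≤ c * ‖E y‖ * ‖E x‖ + |m * C| * ‖E y‖ * ‖E x‖ := by linarith
        _ = _ := by ring
    · rintro ⟨r, hr, c, hc, h⟩
      refine ⟨r, hr, c + |m * C|, by positivity, fun z hz => ?_⟩
      have hz' : z + m * (Real.pi * Complex.I) ∈
          Metric.ball (z₀ + m * (Real.pi * Complex.I)) r := by
        rw [mem_ball_iff_norm] at hz ⊢
        convert hz using 2
        ring
      obtain ⟨h1, h2⟩ := h _ hz'
      have h1' : z.re < L := by simpa using h1
      refine ⟨h1', fun y x => ?_⟩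
      have h3 := hshift m z h1' y x
      have h4 := h2 y x
      rw [norm_sub_rev] at h3
      have h5 := norm_sub_norm_le (φ z y x) (φ (z + m * (Real.pi * Complex.I)) y x)
      have h6 : m * C * ‖E y‖ * ‖E x‖ ≤ |m * C| * ‖E y‖ * ‖E x‖ := by
        gcongr
        exact le_abs_self _
      calc _ ≤ c * ‖E y‖ * ‖E x‖ + |m * C| * ‖E y‖ * ‖E x‖ := by linarith
        _ = _ := by ring
  have hinner : ∀ ζ ∈ LogCover.physical, ∀ y x, ‖φ ζ y x‖ ≤ ‖B ζ‖ * ‖E y‖ * ‖E x‖ := by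
    intro ζ hζ y x
    rw [← hB ζ hζ]
    calc _ ≤ ‖E y‖ * ‖B ζ (E x)‖ := norm_inner_le_norm _ _
      _ ≤ ‖E y‖ * (‖B ζ‖ * ‖E x‖) := by
        gcongr
        exact (B ζ).le_opNorm _
      _ = _ := by ring
  have hopen : IsOpen LogCover.physical :=
    (isOpen_lt continuous_const Complex.continuous_im).inter
      (isOpen_lt Complex.continuous_im continuous_const)
  have hopenL : IsOpen {ζ : ℂ | ζ.re < L} := isOpen_lt Complex.continuous_re continuous_const
  -- One fundamental strip. Inside it continuity of B suffices. On the line Im ζ = 0 the matrix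
  -- elements are only O(1/|Im ζ|) from either side, but they are entire, so
  -- `norm_le_of_norm_mul_abs_im_le` applies.
  have hLB0 : ∀ z₀ : ℂ, z₀.re < L → 0 ≤ z₀.im → z₀.im < Real.pi → LB z₀ := by
    intro z₀ hz₀ hi hi'
    rcases eq_or_lt_of_le hi with h0 | h0
    · obtain ⟨c, hc⟩ := hBn z₀.re
      obtain ⟨r', hr', hsub⟩ := Metric.isOpen_iff.1 hopenL z₀ hz₀
      set r := min (r' / 2) (1 / 2) with hr
      have hr0 : 0 < r := by positivity
      set c' := max c 0 + |C| with hc'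
      have hc0 : 0 ≤ c' := by positivity
      refine ⟨r / 2, by positivity, 4 * c' / r, by positivity, fun z hz => ⟨hsub ?_, fun y x => ?_⟩⟩
      · refine Metric.ball_subset_ball ?_ hz
        have := min_le_left (r' / 2) (1 / 2)
        linarith
      · have key : ∀ w ∈ Metric.closedBall z₀ r,
            ‖φ w y x‖ * |w.im| ≤ c' * ‖E y‖ * ‖E x‖ := by
          intro w hw
          have hw1 : ‖w - z₀‖ ≤ r := by simpa [dist_eq_norm] using hw
          have hwre : |w.re - z₀.re| ≤ 1 / 2 :=
            ((Complex.abs_re_le_norm (w - z₀)).trans hw1).trans (min_le_right _ _)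
          have hwim : |w.im| ≤ 1 / 2 := by
            have := ((Complex.abs_im_le_norm (w - z₀)).trans hw1).trans (min_le_right _ _)
            simpa [← h0] using this
          have hwL : w.re < L := by
            refine hsub (Metric.mem_ball.2 (lt_of_le_of_lt hw ?_))
            have := min_le_left (r' / 2) (1 / 2)
            linarith
          have hpi := Real.pi_gt_three
          rcases lt_trichotomy w.im 0 with hneg | h00 | hpos
          -- Below the line, w + πi is physical at distance |Im w| from the upper edge; its form
          -- bound transfers to w at the cost of one jump.
          · have hp : w + Real.pi * Complex.I ∈ LogCover.physical := by
              rw [abs_of_neg hneg] at hwim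
              constructor <;> simp <;> linarith
            have h1 := (hc _ hp (by simpa using hwre)).2 (by
              rw [abs_of_neg hneg] at hwim
              simp; linarith)
            have h2 := hinner _ hp y x
            have h3 := hJ w hwL y x
            rw [norm_sub_rev] at h3
            have h4 := norm_sub_norm_le (φ w y x) (φ (w + Real.pi * Complex.I) y x)
            have h5 : Real.pi - (w + Real.pi * Complex.I).im = |w.im| := by
              rw [abs_of_neg hneg]; simp
            rw [h5] at h1
            have h7 : ‖φ w y x‖ ≤ (‖B (w + Real.pi * Complex.I)‖ + |C|) * (‖E y‖ * ‖E x‖) := by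
              have h8 : C * (‖E y‖ * ‖E x‖) ≤ |C| * (‖E y‖ * ‖E x‖) := by
                gcongr
                exact le_abs_self _
              nlinarith
            calc _ ≤ (‖B (w + Real.pi * Complex.I)‖ + |C|) * (‖E y‖ * ‖E x‖) * |w.im| := by gcongr
              _ = (‖B (w + Real.pi * Complex.I)‖ * |w.im| + |C| * |w.im|) * (‖E y‖ * ‖E x‖) := by
                ring
              _ ≤ (max c 0 + |C| * 1) * (‖E y‖ * ‖E x‖) := by
                gcongr
                · exact h1.trans (le_max_left _ _)
                · linarith
              _ = _ := by rw [hc']; ring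
          · rw [h00, abs_zero, mul_zero]
            positivity
          · rw [abs_of_pos hpos] at hwim ⊢
            have hp : w ∈ LogCover.physical := ⟨hpos, by linarith⟩
            have h1 := (hc _ hp hwre).1 hwim
            have h2 := hinner _ hp y x
            calc _ ≤ ‖B w‖ * ‖E y‖ * ‖E x‖ * w.im := by gcongr
              _ = ‖B w‖ * w.im * (‖E y‖ * ‖E x‖) := by ring
              _ ≤ c' * (‖E y‖ * ‖E x‖) := by
                gcongr
                have := le_max_left c 0
                have := abs_nonneg C
                linarith
              _ = _ := by ring
        refine (norm_le_of_norm_mul_abs_im_le (hφ y x) h0.symm hr0 key hz).trans (le_of_eq ?_)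
        ring
    · have h1 : ContinuousAt B z₀ := hBc.continuousAt (hopen.mem_nhds ⟨h0, hi'⟩)
      have h2 : ∀ᶠ z in 𝓝 z₀, ‖B z‖ < ‖B z₀‖ + 1 :=
        h1.norm.eventually_lt_const (lt_add_one _)
      obtain ⟨r, hr, hb⟩ := Metric.eventually_nhds_iff_ball.1
        (h2.and ((hopen.eventually_mem ⟨h0, hi'⟩).and (hopenL.eventually_mem hz₀)))
      refine ⟨r, hr, ‖B z₀‖ + 1, by positivity, fun z hz => ?_⟩
      obtain ⟨h3, h4, h5⟩ := hb z hz
      refine ⟨h5, fun y x => (hinner z h4 y x).trans ?_⟩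
      gcongr
  have hLBall : ∀ z₀ : ℂ, z₀.re < L → LB z₀ := by
    intro z₀ hz₀
    have hpi := Real.pi_pos
    -- The number of half turns leading back to the fundamental strip; it may have either sign.
    set m := ⌊z₀.im / Real.pi⌋ with hm
    have h1 : (m : ℝ) * Real.pi ≤ z₀.im := by
      have := Int.floor_le (z₀.im / Real.pi)
      rwa [le_div_iff₀ hpi] at this
    have h2 : z₀.im < (m + 1) * Real.pi := by
      have := Int.lt_floor_add_one (z₀.im / Real.pi)
      rwa [div_lt_iff₀ hpi] at this
    have h3 : LB (z₀ - m * (Real.pi * Complex.I)) := by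
      refine hLB0 _ (by simpa using hz₀) ?_ ?_ <;> simp <;> linarith
    rcases Int.eq_nat_or_neg m with ⟨k, hk | hk⟩
    · have := (hLB_shift k _).1 h3
      simpa [hk] using this
    · refine (hLB_shift k _).2 ?_
      simpa [hk] using h3
  have hex : ∀ ζ : ℂ, ∃ A : H →L[ℂ] H, ζ.re < L → ∀ y x, ⟪E y, A (E x)⟫_ℂ = φ ζ y x := by
    intro ζ
    by_cases hζ : ζ.re < L
    · obtain ⟨r, hr, c, -, h⟩ := hLBall ζ hζ
      obtain ⟨A, hA⟩ := exists_operator_of_sesquilinear hE (φ ζ)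
        (h ζ (Metric.mem_ball_self hr)).2
      exact ⟨A, fun _ => hA⟩
    · exact ⟨0, fun h => absurd h hζ⟩
  choose A hA using hex
  refine ⟨A, fun z₀ hz₀ => ?_, fun ζ hζ hL => ?_⟩
  · obtain ⟨r, hr, c, hc, h⟩ := hLBall z₀ hz₀
    refine (differentiableAt_of_differentiableAt_inner hE hr (C := c) (fun z hz => ?_)
      fun y x => ?_).differentiableWithinAt
    · refine opNorm_le_of_inner_le hE hc fun y x => ?_
      rw [hA z (h z hz).1]
      exact (h z hz).2 y x
    · refine (hφ y x).differentiableOn.congr fun z hz => ?_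
      exact hA z (h z hz).1 y x
  · refine eq_of_inner_eq hE fun y x => ?_
    rw [hA ζ hL, hB ζ hζ]

end Continuation

/-! ### Multiplication operators -/

section Multipliers

/-- Bounded measurable functions, which act on `L²(ℝ²)` by multiplication. -/
structure IsMultiplier (m : Plane → ℂ) : Prop where
  measurable : Measurable m
  bounded : ∃ C, ∀ x, ‖m x‖ ≤ C

theorem IsMultiplier.memLp_mul {m : Plane → ℂ} (hm : IsMultiplier m) (u : L2) :
    MemLp (fun x => m x * u x) 2 (volume : Measure Plane) := by
  obtain ⟨C, hC⟩ := hm.bounded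
  refine (Lp.memLp u).of_le_mul (c := C)
    (hm.measurable.aestronglyMeasurable.mul (Lp.aestronglyMeasurable u)) ?_
  exact Eventually.of_forall fun x => by rw [norm_mul]; gcongr; exact hC x

open Classical in
/-- The operator on `L²(ℝ²)` of multiplication by a bounded measurable function. -/
def mulOp (m : Plane → ℂ) : L2 →L[ℂ] L2 :=
  if hm : IsMultiplier m then
    LinearMap.mkContinuousOfExistsBound
      { toFun := fun u => (hm.memLp_mul u).toLp _
        map_add' := fun u v => by
          refine Lp.ext ?_
          filter_upwards [(hm.memLp_mul (u + v)).coeFn_toLp, (hm.memLp_mul u).coeFn_toLp,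
            (hm.memLp_mul v).coeFn_toLp, Lp.coeFn_add u v,
            Lp.coeFn_add ((hm.memLp_mul u).toLp _) ((hm.memLp_mul v).toLp _)] with x h1 h2 h3 h4 h5
          rw [h1, h5, Pi.add_apply, h2, h3, h4, Pi.add_apply, mul_add]
        map_smul' := fun a u => by
          refine Lp.ext ?_
          filter_upwards [(hm.memLp_mul (a • u)).coeFn_toLp, (hm.memLp_mul u).coeFn_toLp,
            Lp.coeFn_smul a u, Lp.coeFn_smul a ((hm.memLp_mul u).toLp _)] with x h1 h2 h3 h4
          rw [h1, RingHom.id_apply, h4, Pi.smul_apply, h2, h3, Pi.smul_apply, smul_eq_mul,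
            smul_eq_mul, mul_left_comm] }
      (by
        obtain ⟨C, hC⟩ := hm.bounded
        refine ⟨C, fun u => Lp.norm_le_mul_norm_of_ae_le_mul ?_⟩
        filter_upwards [(hm.memLp_mul u).coeFn_toLp] with x h1
        change ‖((hm.memLp_mul u).toLp _ : Plane → ℂ) x‖ ≤ _
        rw [h1, norm_mul]
        gcongr
        exact hC x)
  else 0

theorem coeFn_mulOp {m : Plane → ℂ} (hm : IsMultiplier m) (u : L2) :
    mulOp m u =ᵐ[volume] fun x => m x * u x := by
  rw [mulOp, dif_pos hm]
  exact (hm.memLp_mul u).coeFn_toLp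

theorem norm_mulOp_apply_le {m : Plane → ℂ} (hm : IsMultiplier m) {C : ℝ} (hC : ∀ x, ‖m x‖ ≤ C)
    (u : L2) : ‖mulOp m u‖ ≤ C * ‖u‖ := by
  refine Lp.norm_le_mul_norm_of_ae_le_mul ?_
  filter_upwards [coeFn_mulOp hm u] with x h1
  rw [h1, norm_mul]
  gcongr
  exact hC x

theorem norm_mulOp_le {m : Plane → ℂ} (hm : IsMultiplier m) {C : ℝ} (hC : ∀ x, ‖m x‖ ≤ C) :
    ‖mulOp m‖ ≤ C :=
  (mulOp m).opNorm_le_bound ((norm_nonneg _).trans (hC 0)) (norm_mulOp_apply_le hm hC)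

theorem IsMultiplier.mul {m m' : Plane → ℂ} (hm : IsMultiplier m) (hm' : IsMultiplier m') :
    IsMultiplier fun x => m x * m' x := by
  refine ⟨hm.measurable.mul hm'.measurable, ?_⟩
  obtain ⟨C, hC⟩ := hm.bounded
  obtain ⟨C', hC'⟩ := hm'.bounded
  refine ⟨C * C', fun x => ?_⟩
  rw [norm_mul]
  gcongr
  · exact (norm_nonneg _).trans (hC x)
  · exact hC x
  · exact hC' x

theorem IsMultiplier.conj {m : Plane → ℂ} (hm : IsMultiplier m) :
    IsMultiplier fun x => starRingEnd ℂ (m x) := by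
  refine ⟨Complex.continuous_conj.measurable.comp hm.measurable, ?_⟩
  obtain ⟨C, hC⟩ := hm.bounded
  exact ⟨C, fun x => by simpa using hC x⟩

theorem mulOp_mulOp {m m' : Plane → ℂ} (hm : IsMultiplier m) (hm' : IsMultiplier m') (u : L2) :
    mulOp m (mulOp m' u) = mulOp (fun x => m x * m' x) u := by
  refine Lp.ext ?_
  filter_upwards [coeFn_mulOp hm (mulOp m' u), coeFn_mulOp hm' u, coeFn_mulOp (hm.mul hm') u]
    with x h1 h2 h3
  rw [h1, h2, h3, mul_assoc]

theorem inner_eq_integral (u v : L2) : ⟪u, v⟫_ℂ = ∫ x, v x * starRingEnd ℂ (u x) := by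
  rw [L2.inner_def]
  rfl

theorem inner_mulOp_left {m : Plane → ℂ} (hm : IsMultiplier m) (u v : L2) :
    ⟪mulOp m u, v⟫_ℂ = ⟪u, mulOp (fun x => starRingEnd ℂ (m x)) v⟫_ℂ := by
  rw [inner_eq_integral, inner_eq_integral]
  refine integral_congr_ae ?_
  filter_upwards [coeFn_mulOp hm u, coeFn_mulOp hm.conj v] with x h1 h2
  rw [h1, h2, map_mul]
  ring

theorem isMultiplier_test (χ : 𝓓((⊤ : Opens Plane), ℂ)) : IsMultiplier χ :=
  ⟨χ.continuous.measurable, χ.continuous.bounded_above_of_compact_support χ.hasCompactSupport⟩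

/-- The characteristic function of the closed ball of radius `r`. -/
def ballIndicator (r : ℝ) : Plane → ℂ := (Metric.closedBall (0 : Plane) r).indicator 1

theorem norm_ballIndicator_le (r : ℝ) (x : Plane) : ‖ballIndicator r x‖ ≤ 1 := by
  unfold ballIndicator
  by_cases h : x ∈ Metric.closedBall (0 : Plane) r
  · simp [Set.indicator_of_mem h]
  · simp [Set.indicator_of_notMem h]

theorem isMultiplier_ballIndicator (r : ℝ) : IsMultiplier (ballIndicator r) :=
  ⟨measurable_one.indicator Metric.isClosed_closedBall.measurableSet,
    1, norm_ballIndicator_le r⟩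

theorem mulOp_mul_ballIndicator {m : Plane → ℂ} (hm : IsMultiplier m) {r : ℝ}
    (h : ∀ x ∉ Metric.closedBall (0 : Plane) r, m x = 0) (u : L2) :
    mulOp m (mulOp (ballIndicator r) u) = mulOp m u := by
  refine Lp.ext ?_
  filter_upwards [coeFn_mulOp hm (mulOp (ballIndicator r) u), coeFn_mulOp hm u,
    coeFn_mulOp (isMultiplier_ballIndicator r) u] with x h1 h2 h3
  rw [h1, h2, h3]
  by_cases hx : x ∈ Metric.closedBall (0 : Plane) r
  · simp [ballIndicator, Set.indicator_of_mem hx]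
  · simp [h x hx]

end Multipliers

/-! ### The form domain and the domain of the Hamiltonian -/

section Domain

variable {Ω : Opens Plane}

theorem testToL2_mulTest {g : Plane → ℂ} (hg : ContDiffOn ℝ ∞ g Ω) (hm : IsMultiplier g)
    (φ : 𝓓(Ω, ℂ)) : testToL2 Ω (mulTest g hg φ) = mulOp g (testToL2 Ω φ) := by
  refine Lp.ext ?_
  filter_upwards [(memLp_test (mulTest g hg φ)).coeFn_toLp, coeFn_mulOp hm (testToL2 Ω φ),
    (memLp_test φ).coeFn_toLp] with x h1 h2 h3
  have h3' : (testToL2 Ω φ : Plane → ℂ) x = φ x := h3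
  rw [h2, h3']
  exact h1

/-- A vector orthogonal to the test functions vanishes almost everywhere on Ω, and the complement of
Ω is at most a point. -/
theorem dense_range_testToL2_of_compl {c : Plane} (hΩ : {c}ᶜ ⊆ (Ω : Set Plane)) :
    Dense (LinearMap.range (testToL2 Ω) : Set L2) := by
  rw [Submodule.dense_iff_topologicalClosure_eq_top, Submodule.topologicalClosure_eq_top_iff,
    Submodule.eq_bot_iff]
  intro u hu
  rw [Submodule.mem_orthogonal] at hu
  have hloc : LocallyIntegrable u (volume : Measure Plane) :=
    (Lp.memLp u).locallyIntegrable (by norm_num)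
  have h1 : ∀ᵐ x ∂(volume : Measure Plane), x ∈ (Ω : Set Plane) → u x = 0 := by
    refine Ω.isOpen.ae_eq_zero_of_integral_contDiff_smul_eq_zero
      (hloc.locallyIntegrableOn _) fun g hg hgc hgs => ?_
    let φ : 𝓓(Ω, ℂ) :=
      { toFun := fun x => (g x : ℂ)
        contDiff' := Complex.ofRealCLM.contDiff.comp hg
        hasCompactSupport' := hgc.comp_left (g := fun r : ℝ => (r : ℂ)) (by simp)
        tsupport_subset' := (tsupport_comp_subset (g := fun r : ℝ => (r : ℂ)) (by simp) _).trans
          hgs }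
    have h2 := hu _ ⟨φ, rfl⟩
    rw [inner_eq_integral] at h2
    rw [← h2]
    refine integral_congr_ae ?_
    filter_upwards [(memLp_test φ).coeFn_toLp] with x hx
    have hx' : (testToL2 Ω φ : Plane → ℂ) x = (g x : ℂ) := hx
    rw [hx', Complex.conj_ofReal, mul_comm]
    simp
  refine (Lp.eq_zero_iff_ae_eq_zero).2 ?_
  have h3 : ∀ᵐ x ∂(volume : Measure Plane), x ≠ c := by
    exact compl_mem_ae_iff.2 (measure_singleton c)
  filter_upwards [h1, h3] with x hx hxc using hx (hΩ hxc)

theorem compl_subset_regularSet (β : ℝ) (c : Plane) : {c}ᶜ ⊆ (regularSet β c : Set Plane) := by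
  intro x hx
  unfold regularSet
  split_ifs
  · trivial
  · exact hx

variable (β : ℝ) (c : Plane) (f : Plane → ℝ) (hf : ContDiff ℝ ∞ f)

/-- The covariant derivative `e^{-if} ((1/i) ∂_j - A_j) e^{if}` on test functions. -/
def gaugeDeriv (j : Fin 2) : 𝓓(regularSet β c, ℂ) →ₗ[ℂ] 𝓓(regularSet β c, ℂ) :=
  mulTest (fun x => Complex.exp (-(Complex.I * f x))) (phase_neg_contDiff hf).contDiffOn ∘ₗ
    covDerivTest (potential β c) (potential_contDiffOn β c) j ∘ₗ
    mulTest (fun x => Complex.exp (Complex.I * f x)) (phase_contDiff hf).contDiffOn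

theorem gaugeDeriv_apply (j : Fin 2) (φ : 𝓓(regularSet β c, ℂ)) (x : Plane) :
    gaugeDeriv β c f hf j φ x = Complex.exp (-(Complex.I * f x)) *
      covDeriv (potential β c) j (fun y => Complex.exp (Complex.I * f y) * φ y) x := rfl

/-- The phases between the two covariant derivatives cancel. Since each factor is symmetric, this is
the factorization of P₀ as D*D on which the form graph is built. -/
theorem freeTest_eq_sum (φ : 𝓓(regularSet β c, ℂ)) :
    freeTest β c f hf φ = ∑ j, gaugeDeriv β c f hf j (gaugeDeriv β c f hf j φ) := by
  simp only [freeTest, gaugeDeriv, LinearMap.comp_apply, LinearMap.sum_apply, map_sum]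
  refine Finset.sum_congr rfl fun j _ => ?_
  congr 2
  ext x
  change _ = Complex.exp (Complex.I * f x) * (Complex.exp (-(Complex.I * f x)) * _)
  rw [← mul_assoc, ← Complex.exp_add]
  simp

theorem inner_gaugeDeriv (j : Fin 2) (φ ψ : 𝓓(regularSet β c, ℂ)) :
    ⟪testToL2 _ (gaugeDeriv β c f hf j φ), testToL2 _ ψ⟫_ℂ =
      ⟪testToL2 _ φ, testToL2 _ (gaugeDeriv β c f hf j ψ)⟫_ℂ := by
  have h1 : ∀ x, starRingEnd ℂ (Complex.exp (-(Complex.I * f x))) =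
      Complex.exp (Complex.I * f x) := by
    intro x
    rw [← Complex.exp_conj]
    simp
  have h2 : ∀ x, starRingEnd ℂ (Complex.exp (Complex.I * f x)) =
      Complex.exp (-(Complex.I * f x)) := by
    intro x
    rw [← Complex.exp_conj]
    simp
  simp only [gaugeDeriv, LinearMap.comp_apply]
  rw [inner_mulTest _ _ (phase_neg_contDiff hf).contDiffOn (phase_contDiff hf).contDiffOn h1,
    inner_covDerivTest,
    inner_mulTest _ _ (phase_contDiff hf).contDiffOn (phase_neg_contDiff hf).contDiffOn h2]

/-- Potential and gauge phase commute with multiplication by χ, so the commutator is the bounded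
function (1/i)∂_jχ, whatever happens at c. -/
theorem gaugeDeriv_mulTest (j : Fin 2) (χ : 𝓓((⊤ : Opens Plane), ℂ)) (φ : 𝓓(regularSet β c, ℂ)) :
    gaugeDeriv β c f hf j (mulTest χ χ.contDiff.contDiffOn φ) =
      mulTest χ χ.contDiff.contDiffOn (gaugeDeriv β c f hf j φ) +
      mulTest (derivTest j χ) (derivTest j χ).contDiff.contDiffOn φ := by
  ext x
  change Complex.exp (-(Complex.I * f x)) * (1 / Complex.I *
      fderiv ℝ (fun y => Complex.exp (Complex.I * f y) * (χ y * φ y)) x _ -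
        _ * (Complex.exp (Complex.I * f x) * (χ x * φ x))) =
    χ x * (Complex.exp (-(Complex.I * f x)) * (1 / Complex.I *
      fderiv ℝ (fun y => Complex.exp (Complex.I * f y) * φ y) x _ -
        _ * (Complex.exp (Complex.I * f x) * φ x))) +
    1 / Complex.I * fderiv ℝ χ x _ * φ x
  have hd1 : DifferentiableAt ℝ χ x := χ.contDiff.differentiable (by simp) x
  have hd2 : DifferentiableAt ℝ (fun y => Complex.exp (Complex.I * f y) * φ y) x :=
    ((phase_contDiff hf).differentiable (by simp) x).mul (φ.contDiff.differentiable (by simp) x)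
  have h1 : (fun y => Complex.exp (Complex.I * f y) * (χ y * φ y)) =
      fun y => χ y * (Complex.exp (Complex.I * f y) * φ y) := by
    funext y
    ring
  rw [h1, fderiv_fun_mul hd1 hd2]
  have h2 : Complex.exp (-(Complex.I * f x)) * Complex.exp (Complex.I * f x) = 1 := by
    rw [← Complex.exp_add]
    simp
  simp only [_root_.add_apply, _root_.smul_apply, smul_eq_mul]
  linear_combination (1 / Complex.I * fderiv ℝ χ x (EuclideanSpace.single j 1) * φ x) * h2

/-- `d` is the covariant gradient of `u`, an element of the form domain. -/
def FormPair (u : L2) (d : Fin 2 → L2) : Prop :=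
  ∃ φ : ℕ → 𝓓(regularSet β c, ℂ), Tendsto (fun k => testToL2 _ (φ k)) atTop (𝓝 u) ∧
    ∀ j, Tendsto (fun k => testToL2 _ (gaugeDeriv β c f hf j (φ k))) atTop (𝓝 (d j))

variable {β c f hf}

theorem FormPair.inner_gaugeDeriv {u : L2} {d : Fin 2 → L2} (h : FormPair β c f hf u d)
    (j : Fin 2) (φ : 𝓓(regularSet β c, ℂ)) :
    ⟪u, testToL2 _ (gaugeDeriv β c f hf j φ)⟫_ℂ = ⟪d j, testToL2 _ φ⟫_ℂ := by
  obtain ⟨ψ, h1, h2⟩ := h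
  refine tendsto_nhds_unique (h1.inner tendsto_const_nhds)
    (((h2 j).inner tendsto_const_nhds).congr fun k => ?_)
  exact AharonovBohm.inner_gaugeDeriv β c f hf j _ _

theorem FormPair.mulOp {u : L2} {d : Fin 2 → L2} (h : FormPair β c f hf u d)
    (χ : 𝓓((⊤ : Opens Plane), ℂ)) :
    FormPair β c f hf (mulOp χ u) fun j =>
      AharonovBohm.mulOp χ (d j) + AharonovBohm.mulOp (derivTest j χ) u := by
  obtain ⟨ψ, h1, h2⟩ := h
  refine ⟨fun k => mulTest χ χ.contDiff.contDiffOn (ψ k), ?_, fun j => ?_⟩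
  · simp only [testToL2_mulTest _ (isMultiplier_test χ)]
    exact ((AharonovBohm.mulOp χ).continuous.tendsto _).comp h1
  · simp only [gaugeDeriv_mulTest, map_add, testToL2_mulTest _ (isMultiplier_test χ),
      testToL2_mulTest _ (isMultiplier_test (derivTest j χ))]
    exact (((AharonovBohm.mulOp χ).continuous.tendsto _).comp (h2 j)).add
      (((AharonovBohm.mulOp (derivTest j χ)).continuous.tendsto _).comp h1)

variable (β c f hf)

theorem mem_domain_minimalOperator {P : 𝓓(Ω, ℂ) →ₗ[ℂ] 𝓓(Ω, ℂ)} (φ : 𝓓(Ω, ℂ)) :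
    testToL2 Ω φ ∈ (minimalOperator P).domain := ⟨φ, rfl⟩

theorem minimalOperator_apply (P : 𝓓(Ω, ℂ) →ₗ[ℂ] 𝓓(Ω, ℂ)) (φ : 𝓓(Ω, ℂ)) :
    minimalOperator P ⟨testToL2 Ω φ, mem_domain_minimalOperator φ⟩ = testToL2 Ω (P φ) := by
  exact congrArg (fun ψ => testToL2 Ω (P ψ))
    ((LinearEquiv.ofInjective (testToL2 Ω) testToL2_injective).symm_apply_apply φ)

/-- The covariant gradient on the domain of the minimal operator. -/
def minimalGradient : (minimalOperator (freeTest β c f hf)).domain →ₗ[ℂ]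
    PiLp 2 (fun _ : Fin 2 => L2) :=
  (WithLp.linearEquiv 2 ℂ (Fin 2 → L2)).symm.toLinearMap ∘ₗ
    (LinearMap.pi fun j => testToL2 _ ∘ₗ gaugeDeriv β c f hf j) ∘ₗ
      (LinearEquiv.ofInjective (testToL2 _) testToL2_injective).symm.toLinearMap

theorem minimalGradient_apply (φ : 𝓓(regularSet β c, ℂ)) (j : Fin 2) :
    minimalGradient β c f hf ⟨testToL2 _ φ, mem_domain_minimalOperator φ⟩ j =
      testToL2 _ (gaugeDeriv β c f hf j φ) := by
  exact congrArg (fun ψ => testToL2 _ (gaugeDeriv β c f hf j ψ))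
    ((LinearEquiv.ofInjective (testToL2 _) testToL2_injective).symm_apply_apply φ)

theorem inner_minimalOperator (u v : (minimalOperator (freeTest β c f hf)).domain) :
    ⟪minimalOperator (freeTest β c f hf) u, (v : L2)⟫_ℂ =
      ⟪minimalGradient β c f hf u, minimalGradient β c f hf v⟫_ℂ := by
  obtain ⟨_, φ, rfl⟩ := u
  obtain ⟨_, ψ, rfl⟩ := v
  have h1 := minimalOperator_apply (freeTest β c f hf) φ
  rw [PiLp.inner_apply]
  have h2 : ∀ j, minimalGradient β c f hf ⟨testToL2 _ φ, ⟨φ, rfl⟩⟩ j = _ :=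
    minimalGradient_apply β c f hf φ
  have h3 : ∀ j, minimalGradient β c f hf ⟨testToL2 _ ψ, ⟨ψ, rfl⟩⟩ j = _ :=
    minimalGradient_apply β c f hf ψ
  simp only [h2, h3]
  refine (congrArg (fun x => ⟪x, testToL2 _ ψ⟫_ℂ) h1).trans ?_
  simp only [freeTest_eq_sum, map_sum, sum_inner, AharonovBohm.inner_gaugeDeriv]

theorem dense_domain_minimalOperator :
    Dense ((minimalOperator (freeTest β c f hf)).domain : Set L2) :=
  dense_range_testToL2_of_compl (compl_subset_regularSet β c)

theorem formPair_iff {u : L2} {d : Fin 2 → L2} : FormPair β c f hf u d ↔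
    WithLp.toLp 2 (u, (WithLp.toLp 2 d : PiLp 2 (fun _ : Fin 2 => L2))) ∈
      formGraph (minimalOperator (freeTest β c f hf)) (minimalGradient β c f hf) := by
  rw [mem_formGraph_iff]
  constructor
  · rintro ⟨φ, h1, h2⟩
    refine ⟨fun k => ⟨testToL2 _ (φ k), mem_domain_minimalOperator _⟩, h1, ?_⟩
    have h3 := ((PiLp.continuous_toLp 2 fun _ : Fin 2 => L2).tendsto d).comp
      (tendsto_pi_nhds.2 h2)
    refine h3.congr fun k => ?_
    ext1 j
    exact (minimalGradient_apply β c f hf (φ k) j).symm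
  · rintro ⟨v, h1, h2⟩
    have h0 : ∀ k, ∃ φ, testToL2 _ φ = (v k : L2) := fun k => (v k).2
    choose φ hφ using h0
    have hv : ∀ k, v k = ⟨testToL2 _ (φ k), mem_domain_minimalOperator _⟩ :=
      fun k => Subtype.ext (hφ k).symm
    refine ⟨φ, by simpa only [hφ] using h1, fun j => ?_⟩
    have h3 := tendsto_pi_nhds.1
      (((PiLp.continuous_ofLp 2 fun _ : Fin 2 => L2).tendsto _).comp h2) j
    refine h3.congr fun k => ?_
    rw [← minimalGradient_apply β c f hf (φ k) j, ← hv k]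
    rfl

theorem exists_isPosResolvent :
    ∃ G : L2 →L[ℂ] L2, IsPosResolvent (freeHamiltonian β c f hf) G :=
  exists_isPosResolvent_friedrichsExtension (dense_domain_minimalOperator β c f hf)
    (inner_minimalOperator β c f hf) _

theorem mem_domain_freeHamiltonian {u w : L2} {d : Fin 2 → L2} (hd : FormPair β c f hf u d)
    (hw : ∀ φ : 𝓓(regularSet β c, ℂ),
      ⟪w, testToL2 _ φ⟫_ℂ = ⟪u, testToL2 _ (freeTest β c f hf φ)⟫_ℂ) :
    ∃ h : u ∈ (freeHamiltonian β c f hf).domain, freeHamiltonian β c f hf ⟨u, h⟩ = w := by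
  have key : ∀ φ : (minimalOperator (freeTest β c f hf)).domain,
      ⟪w, (φ : L2)⟫_ℂ = ⟪u, minimalOperator (freeTest β c f hf) φ⟫_ℂ := by
    rintro ⟨_, φ, rfl⟩
    have h1 := minimalOperator_apply (freeTest β c f hf) φ
    exact (hw φ).trans (congrArg _ h1.symm)
  have h1 : u ∈ (minimalOperator (freeTest β c f hf))†.domain :=
    LinearPMap.mem_adjoint_domain_of_exists _ ⟨w, key⟩
  refine ⟨⟨(mem_formDomain_iff (inner_minimalOperator β c f hf) _).2
    ⟨_, (formPair_iff β c f hf).1 hd⟩, h1⟩, ?_⟩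
  have h2 : (minimalOperator (freeTest β c f hf))† ⟨u, h1⟩ = w :=
    LinearPMap.adjoint_apply_eq (dense_domain_minimalOperator β c f hf) _ key
  rw [← h2]
  exact LinearPMap.domRestrict_apply rfl

theorem exists_formPair (u : (freeHamiltonian β c f hf).domain) :
    ∃ d, FormPair β c f hf u d := by
  obtain ⟨d, hd⟩ := (mem_formDomain_iff (inner_minimalOperator β c f hf) _).1 u.2.1
  exact ⟨WithLp.ofLp d, (formPair_iff β c f hf).2 hd⟩

theorem inner_freeHamiltonian (u : (freeHamiltonian β c f hf).domain) {d : Fin 2 → L2}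
    (hd : FormPair β c f hf u d) {w : L2} {e : Fin 2 → L2} (he : FormPair β c f hf w e) :
    ⟪freeHamiltonian β c f hf u, w⟫_ℂ = ∑ j, ⟪d j, e j⟫_ℂ := by
  have h1 := inner_adjoint_formGraph (dense_domain_minimalOperator β c f hf)
    (inner_minimalOperator β c f hf) ⟨u, u.2.2⟩ ((formPair_iff β c f hf).1 hd)
    ((formPair_iff β c f hf).1 he)
  have h2 : freeHamiltonian β c f hf u =
      (minimalOperator (freeTest β c f hf))† ⟨u, u.2.2⟩ := LinearPMap.domRestrict_apply rfl
  rw [h2, h1, PiLp.inner_apply]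

theorem FormPair.testToL2 (φ : 𝓓(regularSet β c, ℂ)) : FormPair β c f hf
    (testToL2 _ φ) fun j => AharonovBohm.testToL2 _ (gaugeDeriv β c f hf j φ) :=
  ⟨fun _ => φ, tendsto_const_nhds, fun _ => tendsto_const_nhds⟩

end Domain

/-! ### Cutoffs of elements of the domain -/

section Cutoff

/-- The complex conjugate of a test function. -/
def conjTest (χ : 𝓓((⊤ : Opens Plane), ℂ)) : 𝓓((⊤ : Opens Plane), ℂ) where
  toFun x := starRingEnd ℂ (χ x)
  contDiff' := (Complex.conjCLE : ℂ →L[ℝ] ℂ).contDiff.comp χ.contDiff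
  hasCompactSupport' := χ.hasCompactSupport.comp_left (g := starRingEnd ℂ) (map_zero _)
  tsupport_subset' := fun _ _ => trivial

theorem derivTest_apply (j : Fin 2) (χ : 𝓓((⊤ : Opens Plane), ℂ)) (x : Plane) :
    derivTest j χ x = 1 / Complex.I * fderiv ℝ χ x (EuclideanSpace.single j 1) := rfl

theorem derivTest_conjTest (j : Fin 2) (χ : 𝓓((⊤ : Opens Plane), ℂ)) :
    derivTest j (conjTest χ) = -conjTest (derivTest j χ) := by
  ext x
  change 1 / Complex.I * fderiv ℝ (fun y => starRingEnd ℂ (χ y)) x _ =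
    -starRingEnd ℂ (1 / Complex.I * fderiv ℝ χ x _)
  rw [fderiv_conj]
  simp

theorem derivTest_mul_of_eq_one {χ η : 𝓓((⊤ : Opens Plane), ℂ)} (h : ∀ x ∈ tsupport χ, η x = 1)
    (j : Fin 2) (x : Plane) : derivTest j χ x * η x = derivTest j χ x := by
  by_cases hx : x ∈ tsupport χ
  · rw [h x hx, mul_one]
  · have h1 : fderiv ℝ χ x = 0 := by
      by_contra h2
      exact hx (support_fderiv_subset ℝ h2)
    rw [derivTest_apply, h1]
    simp

theorem exists_real_cutoff (χ : 𝓓((⊤ : Opens Plane), ℂ)) :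
    ∃ η : 𝓓((⊤ : Opens Plane), ℂ), conjTest η = η ∧ ∀ x ∈ tsupport χ, η x = 1 := by
  obtain ⟨N, hN⟩ := χ.hasCompactSupport.isCompact.isBounded.subset_closedBall (0 : Plane)
  let b : ContDiffBump (0 : Plane) := ⟨max N 1, max N 1 + 1, by positivity, by linarith⟩
  refine ⟨⟨fun x => (b x : ℂ), Complex.ofRealCLM.contDiff.comp b.contDiff,
    b.hasCompactSupport.comp_left (g := fun r : ℝ => (r : ℂ)) (by simp), fun _ _ => trivial⟩,
    ?_, fun x hx => ?_⟩
  · ext x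
    exact Complex.conj_ofReal _
  · have h1 : b x = 1 := b.one_of_mem_closedBall
      (Metric.closedBall_subset_closedBall (le_max_left _ _) (hN hx))
    change (b x : ℂ) = 1
    rw [h1, Complex.ofReal_one]

variable {β : ℝ} {c : Plane} {f : Plane → ℝ} {hf : ContDiff ℝ ∞ f}

/-- The Leibniz rule applied twice, in weak form: χ is moved onto the test function, and the
first-order terms are integrated by parts. -/
theorem mulOp_mem_domain (χ : 𝓓((⊤ : Opens Plane), ℂ)) (u : (freeHamiltonian β c f hf).domain)
    {d : Fin 2 → L2} (hd : FormPair β c f hf u d) :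
    ∃ h : mulOp χ u ∈ (freeHamiltonian β c f hf).domain,
      freeHamiltonian β c f hf ⟨mulOp χ u, h⟩ = mulOp χ (freeHamiltonian β c f hf u) +
        ∑ j, ((2 : ℂ) • mulOp (derivTest j χ) (d j) + mulOp (derivTest j (derivTest j χ)) u) := by
  refine mem_domain_freeHamiltonian β c f hf (hd.mulOp χ) fun φ => ?_
  set φ' := mulTest (conjTest χ) (conjTest χ).contDiff.contDiffOn φ with hφ'
  have h1 : ∀ (ψ : 𝓓((⊤ : Opens Plane), ℂ)) (v : L2),
      ⟪mulOp ψ v, testToL2 _ φ⟫_ℂ =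
        ⟪v, testToL2 _ (mulTest (conjTest ψ) (conjTest ψ).contDiff.contDiffOn φ)⟫_ℂ := by
    intro ψ v
    rw [inner_mulOp_left (isMultiplier_test ψ), testToL2_mulTest _ (isMultiplier_test _)]
    rfl
  have h2 : ∀ j, ⟪mulOp χ (d j), testToL2 _ (gaugeDeriv β c f hf j φ)⟫_ℂ =
      ⟪d j, testToL2 _ (gaugeDeriv β c f hf j φ')⟫_ℂ +
        ⟪mulOp (derivTest j χ) (d j), testToL2 _ φ⟫_ℂ := by
    intro j
    rw [h1, hφ', gaugeDeriv_mulTest, map_add, inner_add_right,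
      testToL2_mulTest _ (isMultiplier_test _), testToL2_mulTest _ (isMultiplier_test _),
      testToL2_mulTest _ (isMultiplier_test _), inner_mulOp_left (isMultiplier_test χ), add_assoc,
      ← inner_add_right]
    -- Because of the factor 1/i, conjugating χ changes the sign of its derivative, so these two
    -- contributions cancel.
    have h3 : mulOp (derivTest j (conjTest χ)) (testToL2 _ φ) +
        mulOp (conjTest (derivTest j χ)) (testToL2 _ φ) = 0 := by
      rw [derivTest_conjTest]
      refine Lp.ext ?_
      filter_upwards [coeFn_mulOp (isMultiplier_test (-conjTest (derivTest j χ))) (testToL2 _ φ),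
        coeFn_mulOp (isMultiplier_test (conjTest (derivTest j χ))) (testToL2 _ φ),
        Lp.coeFn_add (mulOp (-conjTest (derivTest j χ) : 𝓓((⊤ : Opens Plane), ℂ)) (testToL2 _ φ))
          (mulOp (conjTest (derivTest j χ)) (testToL2 _ φ)),
        Lp.coeFn_zero ℂ 2 (volume : Measure Plane)] with x h4 h5 h6 h7
      rw [h6, Pi.add_apply, h4, h5, h7]
      change -conjTest (derivTest j χ) x * _ + _ = (0 : ℂ)
      ring
    rw [h3, inner_zero_right, add_zero]
    rfl
  have h3 := inner_freeHamiltonian β c f hf u hd (FormPair.testToL2 β c f hf φ')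
  rw [freeTest_eq_sum, map_sum, inner_sum, inner_add_left, h1 χ, ← hφ', h3, sum_inner,
    ← Finset.sum_add_distrib]
  refine Finset.sum_congr rfl fun j _ => ?_
  have h4 := (hd.mulOp (derivTest j χ)).inner_gaugeDeriv j φ
  rw [(hd.mulOp χ).inner_gaugeDeriv, inner_add_left, inner_add_left, h2, h4, inner_add_left,
    inner_smul_left]
  simp only [map_ofNat]
  ring

/-- Caccioppoli's inequality: pair P₀u with η²u. The result is ∑ ‖η d_j‖² plus cross terms 2⟨η d_j,
(D_jη) u⟩, which are absorbed. Only values of u and P₀u on the support of η enter. -/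
theorem norm_mulOp_formPair_le {η : 𝓓((⊤ : Opens Plane), ℂ)} (hη : conjTest η = η) {r : ℝ}
    (hr : tsupport η ⊆ Metric.closedBall (0 : Plane) r) :
    ∃ C, 0 ≤ C ∧ ∀ (u : (freeHamiltonian β c f hf).domain) (d : Fin 2 → L2),
      FormPair β c f hf u d → ∀ j, ‖mulOp η (d j)‖ ≤
        C * (‖mulOp (ballIndicator r) u‖ + ‖mulOp (ballIndicator r) (freeHamiltonian β c f hf u)‖) := by
  have hout : ∀ x ∉ Metric.closedBall (0 : Plane) r, η x = 0 :=
    fun x hx => image_eq_zero_of_notMem_tsupport fun h => hx (hr h)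
  have hout' : ∀ j, ∀ x ∉ Metric.closedBall (0 : Plane) r, derivTest j η x = 0 := by
    intro j x hx
    have h1 : fderiv ℝ η x = 0 := by
      by_contra h2
      exact hx (hr (support_fderiv_subset ℝ h2))
    rw [derivTest_apply, h1]
    simp
  have hself : ∀ v w, ⟪mulOp η v, w⟫_ℂ = ⟪v, mulOp η w⟫_ℂ := by
    intro v w
    have h1 : (fun x => starRingEnd ℂ (η x)) = η := by
      funext x
      exact DFunLike.congr_fun hη x
    rw [inner_mulOp_left (isMultiplier_test η), h1]
  set C := ‖mulOp η‖ + ∑ j, ‖mulOp (derivTest j η)‖ with hC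
  have hC0 : 0 ≤ C := by positivity
  have hCη : ‖mulOp η‖ ≤ C := le_add_of_nonneg_right (by positivity)
  have hCj : ∀ j, ‖mulOp (derivTest j η)‖ ≤ C := fun j =>
    (Finset.single_le_sum (f := fun j => ‖mulOp (derivTest j η)‖) (fun _ _ => norm_nonneg _)
      (Finset.mem_univ j)).trans (le_add_of_nonneg_left (norm_nonneg _))
  refine ⟨4 * C, by positivity, fun u d hd j => ?_⟩
  set a := ‖mulOp (ballIndicator r) u‖
  set b := ‖mulOp (ballIndicator r) (freeHamiltonian β c f hf u)‖
  have ha : 0 ≤ a := norm_nonneg _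
  have hb : 0 ≤ b := norm_nonneg _
  have h1 : ‖mulOp η u‖ ≤ C * a := by
    rw [← mulOp_mul_ballIndicator (isMultiplier_test η) hout]
    exact (mulOp η).le_of_opNorm_le hCη _
  have h2 : ‖mulOp η (freeHamiltonian β c f hf u)‖ ≤ C * b := by
    rw [← mulOp_mul_ballIndicator (isMultiplier_test η) hout]
    exact (mulOp η).le_of_opNorm_le hCη _
  have h3 : ∀ j, ‖mulOp (derivTest j η) u‖ ≤ C * a := by
    intro j
    rw [← mulOp_mul_ballIndicator (isMultiplier_test _) (hout' j)]
    exact (mulOp _).le_of_opNorm_le (hCj j) _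
  have h4 := inner_freeHamiltonian β c f hf u hd ((hd.mulOp η).mulOp η)
  rw [← hself] at h4
  have hcomm : ∀ j v, mulOp (derivTest j η) (mulOp η v) = mulOp η (mulOp (derivTest j η) v) := by
    intro j v
    rw [mulOp_mulOp (isMultiplier_test _) (isMultiplier_test _),
      mulOp_mulOp (isMultiplier_test _) (isMultiplier_test _)]
    simp only [mul_comm]
  have h5 : ∀ j, ⟪d j, mulOp η (mulOp η (d j) + mulOp (derivTest j η) u) +
      mulOp (derivTest j η) (mulOp η u)⟫_ℂ = ((‖mulOp η (d j)‖ ^ 2 : ℝ) : ℂ) +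
        2 * ⟪mulOp η (d j), mulOp (derivTest j η) u⟫_ℂ := by
    intro j
    have hn : ⟪mulOp η (d j), mulOp η (d j)⟫_ℂ = ((‖mulOp η (d j)‖ ^ 2 : ℝ) : ℂ) := by
      rw [inner_self_eq_norm_sq_to_K]
      push_cast
      rfl
    rw [hcomm, ← map_add, ← hself, inner_add_right, inner_add_right, hn]
    ring
  simp only [h5, Finset.sum_add_distrib, ← Complex.ofReal_sum] at h4
  set S := ∑ j, ‖mulOp η (d j)‖ ^ 2
  have h6 : S ≤ C * b * (C * a) + ∑ j, 2 * (‖mulOp η (d j)‖ * (C * a)) := by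
    have h7 : S = ‖((S : ℝ) : ℂ)‖ := by
      rw [Complex.norm_real, Real.norm_of_nonneg (Finset.sum_nonneg fun _ _ => by positivity)]
    rw [h7, eq_sub_of_add_eq h4.symm]
    refine (norm_sub_le _ _).trans (add_le_add ?_ ?_)
    · refine (norm_inner_le_norm _ _).trans ?_
      gcongr
    · refine (norm_sum_le _ _).trans (Finset.sum_le_sum fun j _ => ?_)
      rw [norm_mul]
      have h8 : ‖(2 : ℂ)‖ = 2 := by norm_num
      rw [h8]
      gcongr
      refine (norm_inner_le_norm _ _).trans ?_
      gcongr
      exact h3 j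
  -- 2xy ≤ x²/2 + 2y² for each of the two components leaves half of S to be absorbed.
  have h9 : ∑ j, 2 * (‖mulOp η (d j)‖ * (C * a)) ≤ S / 2 + 4 * (C * a) ^ 2 := by
    simp only [S, Fin.sum_univ_two]
    nlinarith [sq_nonneg (‖mulOp η (d 0)‖ - 2 * (C * a)), sq_nonneg (‖mulOp η (d 1)‖ - 2 * (C * a))]
  have h10 : ‖mulOp η (d j)‖ ^ 2 ≤ S :=
    Finset.single_le_sum (f := fun j => ‖mulOp η (d j)‖ ^ 2) (fun _ _ => by positivity)
      (Finset.mem_univ j)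
  have h11 : ‖mulOp η (d j)‖ ^ 2 ≤ (4 * C * (a + b)) ^ 2 := by
    have : 0 ≤ C * a := by positivity
    have : 0 ≤ C * b := by positivity
    nlinarith [mul_nonneg ‹0 ≤ C * a› ‹0 ≤ C * b›]
  exact (pow_le_pow_iff_left₀ (norm_nonneg _) (by positivity) two_ne_zero).1 h11

/-- Multiplication by a test function maps the domain of the Hamiltonian to itself, with a bound
involving only the restriction to a ball. -/
theorem exists_norm_cutoff_le (χ : 𝓓((⊤ : Opens Plane), ℂ)) : ∃ r₀ : ℝ, ∀ r, r₀ ≤ r →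
    ∃ C, 0 ≤ C ∧ ∀ u : (freeHamiltonian β c f hf).domain,
      ∃ h : mulOp χ u ∈ (freeHamiltonian β c f hf).domain,
        ‖mulOp χ u‖ ≤ C * (‖mulOp (ballIndicator r) u‖ +
          ‖mulOp (ballIndicator r) (freeHamiltonian β c f hf u)‖) ∧
        ‖freeHamiltonian β c f hf ⟨mulOp χ u, h⟩‖ ≤ C * (‖mulOp (ballIndicator r) u‖ +
          ‖mulOp (ballIndicator r) (freeHamiltonian β c f hf u)‖) := by
  obtain ⟨η, hη, hη1⟩ := exists_real_cutoff χ
  obtain ⟨r₁, hr₁⟩ := η.hasCompactSupport.isCompact.isBounded.subset_closedBall (0 : Plane)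
  obtain ⟨r₂, hr₂⟩ := χ.hasCompactSupport.isCompact.isBounded.subset_closedBall (0 : Plane)
  refine ⟨max r₁ r₂, fun r hr => ?_⟩
  have hη2 : tsupport η ⊆ Metric.closedBall (0 : Plane) r :=
    hr₁.trans (Metric.closedBall_subset_closedBall ((le_max_left _ _).trans hr))
  have hχ2 : tsupport χ ⊆ Metric.closedBall (0 : Plane) r :=
    hr₂.trans (Metric.closedBall_subset_closedBall ((le_max_right _ _).trans hr))
  have hzero : ∀ ψ : 𝓓((⊤ : Opens Plane), ℂ), tsupport ψ ⊆ tsupport χ →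
      ∀ x ∉ Metric.closedBall (0 : Plane) r, ψ x = 0 := fun ψ hψ x hx =>
    image_eq_zero_of_notMem_tsupport fun h => hx (hχ2 (hψ h))
  have hder : ∀ (j : Fin 2) (ψ : 𝓓((⊤ : Opens Plane), ℂ)),
      tsupport (derivTest j ψ) ⊆ tsupport ψ := by
    intro j ψ
    refine closure_minimal (fun x hx => ?_) (isClosed_tsupport _)
    by_contra h1
    apply hx
    have h2 : fderiv ℝ ψ x = 0 := by
      by_contra h2
      exact h1 (support_fderiv_subset ℝ h2)
    rw [derivTest_apply, h2]
    simp
  obtain ⟨C₁, hC₁, hbound⟩ := norm_mulOp_formPair_le (β := β) (c := c) (hf := hf) hη hη2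
  set C₂ := ‖mulOp χ‖ + ∑ j, (2 * ‖mulOp (derivTest j χ)‖ * C₁ +
    ‖mulOp (derivTest j (derivTest j χ))‖) with hC₂
  refine ⟨C₂, by positivity, fun u => ?_⟩
  obtain ⟨d, hd⟩ := exists_formPair β c f hf u
  obtain ⟨h, hP⟩ := mulOp_mem_domain χ u hd
  set a := ‖mulOp (ballIndicator r) u‖
  set b := ‖mulOp (ballIndicator r) (freeHamiltonian β c f hf u)‖
  have ha : 0 ≤ a := norm_nonneg _
  have hb : 0 ≤ b := norm_nonneg _
  have hle : ∀ (ψ : 𝓓((⊤ : Opens Plane), ℂ)), tsupport ψ ⊆ tsupport χ → ∀ v,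
      ‖mulOp ψ v‖ ≤ ‖mulOp ψ‖ * ‖mulOp (ballIndicator r) v‖ := by
    intro ψ hψ v
    rw [← mulOp_mul_ballIndicator (isMultiplier_test ψ) (hzero ψ hψ)]
    exact (mulOp ψ).le_opNorm _
  refine ⟨h, ?_, ?_⟩
  · calc ‖mulOp χ u‖ ≤ ‖mulOp χ‖ * a := hle χ subset_rfl u
      _ ≤ C₂ * (a + b) := by
        gcongr
        · exact le_add_of_nonneg_right (by positivity)
        · linarith
  · rw [hP]
    -- As η = 1 on the support of χ, inserting η is free and makes the Caccioppoli bound available.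
    have h1 : ∀ j, mulOp (derivTest j χ) (d j) = mulOp (derivTest j χ) (mulOp η (d j)) := by
      intro j
      rw [mulOp_mulOp (isMultiplier_test _) (isMultiplier_test _)]
      congr 2
      funext x
      exact (derivTest_mul_of_eq_one hη1 j x).symm
    calc _ ≤ ‖mulOp χ‖ * (a + b) + ∑ j, (2 * ‖mulOp (derivTest j χ)‖ * (C₁ * (a + b)) +
          ‖mulOp (derivTest j (derivTest j χ))‖ * (a + b)) := by
          refine (norm_add_le _ _).trans (add_le_add ?_ ((norm_sum_le _ _).trans
            (Finset.sum_le_sum fun j _ => (norm_add_le _ _).trans (add_le_add ?_ ?_))))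
          · refine (hle χ subset_rfl _).trans ?_
            gcongr
            linarith
          · rw [norm_smul, h1]
            have h8 : ‖(2 : ℂ)‖ = 2 := by norm_num
            rw [h8, mul_assoc]
            gcongr
            refine ((mulOp _).le_opNorm _).trans ?_
            gcongr
            exact hbound u d hd j
          · refine (hle _ ((hder j _).trans (hder j χ)) _).trans ?_
            gcongr
            linarith
      _ = _ := by
          rw [hC₂, add_mul, Finset.sum_mul]
          congr 1
          refine Finset.sum_congr rfl fun j _ => ?_
          ring

/-- The cutoff depends boundedly, in graph norm, on the pair (1_B u, 1_B P₀u) alone. Such pairs are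
what can be continued analytically, so a linear map defined on all pairs is needed. -/
theorem exists_graph_map (χ : 𝓓((⊤ : Opens Plane), ℂ)) : ∃ r₀ : ℝ, ∀ r, r₀ ≤ r →
    ∃ Θ : WithLp 2 (L2 × L2) →L[ℂ] (freeHamiltonian β c f hf).graph,
      ∀ u : (freeHamiltonian β c f hf).domain,
        ((Θ (WithLp.toLp 2 (mulOp (ballIndicator r) u,
          mulOp (ballIndicator r) (freeHamiltonian β c f hf u))) : _) : L2 × L2).1 = mulOp χ u := by
  obtain ⟨G, hG⟩ := exists_isPosResolvent β c f hf
  set P := freeHamiltonian β c f hf with hP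
  have hcomplete : CompleteSpace P.graph := hG.isClosed_graph.completeSpace_coe
  obtain ⟨r₀, hr₀⟩ := exists_norm_cutoff_le (β := β) (c := c) (hf := hf) χ
  refine ⟨r₀, fun r hr => ?_⟩
  obtain ⟨C, hC, hχ⟩ := hr₀ r hr
  choose hmem hn1 hn2 using hχ
  let Γ : P.domain →ₗ[ℂ] WithLp 2 (L2 × L2) := (WithLp.linearEquiv 2 ℂ (L2 × L2)).symm.toLinearMap ∘ₗ
    (((mulOp (ballIndicator r)).toLinearMap ∘ₗ P.domain.subtype).prod
      ((mulOp (ballIndicator r)).toLinearMap ∘ₗ P.toFun))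
  let Ξ : P.domain →ₗ[ℂ] P.domain := LinearMap.codRestrict P.domain
    ((mulOp χ).toLinearMap ∘ₗ P.domain.subtype) hmem
  let T₀ : P.domain →ₗ[ℂ] P.graph := LinearMap.codRestrict P.graph
    ((P.domain.subtype ∘ₗ Ξ).prod (P.toFun ∘ₗ Ξ)) fun u => P.mem_graph (Ξ u)
  let N : Submodule ℂ (WithLp 2 (L2 × L2)) := (LinearMap.range Γ).topologicalClosure
  have hNc : CompleteSpace N := (Submodule.isClosed_topologicalClosure _).completeSpace_coe
  let e : P.domain →ₗ[ℂ] N := LinearMap.codRestrict N Γ fun u =>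
    Submodule.le_topologicalClosure _ ⟨u, rfl⟩
  have hdense : DenseRange e := by
    intro x
    rw [closure_subtype]
    have h1 : ((↑) : N → WithLp 2 (L2 × L2)) '' Set.range e = LinearMap.range Γ := by
      ext y
      constructor
      · rintro ⟨_, ⟨u, rfl⟩, rfl⟩
        exact ⟨u, rfl⟩
      · rintro ⟨u, rfl⟩
        exact ⟨_, ⟨u, rfl⟩, rfl⟩
    rw [h1]
    exact x.2
  have hnorm : ∀ u, ‖T₀ u‖ ≤ 2 * C * ‖e u‖ := by
    intro u
    have h1 : ‖mulOp (ballIndicator r) u‖ ≤ ‖e u‖ := WithLp.norm_fst_le L2 (Γ u)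
    have h2 : ‖mulOp (ballIndicator r) (P u)‖ ≤ ‖e u‖ := WithLp.norm_snd_le L2 (Γ u)
    have h3 : C * (‖mulOp (ballIndicator r) u‖ + ‖mulOp (ballIndicator r) (P u)‖) ≤
        2 * C * ‖e u‖ := by nlinarith
    exact max_le ((hn1 u).trans h3) ((hn2 u).trans h3)
  -- The map is extended from the local data to their closure N, and then by zero on the orthogonal
  -- complement of N.
  refine ⟨(T₀.extendOfNorm e).comp N.orthogonalProjectionOnto, fun u => ?_⟩
  have h1 : N.orthogonalProjectionOnto (e u : WithLp 2 (L2 × L2)) = e u :=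
    Submodule.orthogonalProjectionOnto_mem_subspace_eq_self _
  have h2 : (T₀.extendOfNorm e).comp N.orthogonalProjectionOnto (e u : WithLp 2 (L2 × L2)) = T₀ u := by
    rw [ContinuousLinearMap.comp_apply, h1]
    exact LinearMap.extendOfNorm_eq hdense ⟨_, hnorm⟩ u
  exact congrArg (fun x : P.graph => (x : L2 × L2).1) h2

end Cutoff

/-! ### Complex coordinate and angular modes -/

section Angular

/-- The complex coordinate centered at `c`. -/
def cx (c x : Plane) : ℂ := ((x 0 - c 0 : ℝ) : ℂ) + ((x 1 - c 1 : ℝ) : ℂ) * Complex.I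

/-- The squared distance to `c`. -/
def rho (c x : Plane) : ℝ := (x 0 - c 0) ^ 2 + (x 1 - c 1) ^ 2

theorem cx_re (c x : Plane) : (cx c x).re = x 0 - c 0 := by simp [cx]

theorem cx_im (c x : Plane) : (cx c x).im = x 1 - c 1 := by simp [cx]

theorem normSq_cx (c x : Plane) : Complex.normSq (cx c x) = rho c x := by
  rw [Complex.normSq_apply, cx_re, cx_im, rho]
  ring

theorem norm_cx_sq (c x : Plane) : ‖cx c x‖ ^ 2 = rho c x := by
  rw [← normSq_cx, Complex.normSq_eq_norm_sq]

theorem rho_nonneg (c x : Plane) : 0 ≤ rho c x := by unfold rho; positivity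

theorem rho_eq_zero_iff {c x : Plane} : rho c x = 0 ↔ x = c := by
  constructor
  · intro h
    unfold rho at h
    ext j
    fin_cases j <;> simp <;> nlinarith [sq_nonneg (x 0 - c 0), sq_nonneg (x 1 - c 1)]
  · rintro rfl
    simp [rho]

theorem rho_pos {c x : Plane} (h : x ≠ c) : 0 < rho c x :=
  lt_of_le_of_ne (rho_nonneg c x) fun h0 => h (rho_eq_zero_iff.1 h0.symm)

theorem cx_ne_zero {c x : Plane} (h : x ≠ c) : cx c x ≠ 0 := by
  intro h0
  have := norm_cx_sq c x
  rw [h0] at this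
  simp only [norm_zero] at this
  exact (rho_pos h).ne' (by rw [← this]; norm_num)

theorem cx_eq (c x : Plane) : cx c x = Complex.orthonormalBasisOneI.repr.symm (x - c) := by
  rw [Complex.orthonormalBasisOneI_repr_symm_apply]
  simp [cx]

theorem measurePreserving_cx (c : Plane) :
    MeasurePreserving (cx c) (volume : Measure Plane) (volume : Measure ℂ) := by
  have h1 : cx c = fun x => Complex.orthonormalBasisOneI.repr.symm (x - c) := funext (cx_eq c)
  rw [h1]
  exact (Complex.orthonormalBasisOneI.repr.symm.measurePreserving).comp
    (measurePreserving_sub_right volume c)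

theorem measurableEmbedding_cx (c : Plane) : MeasurableEmbedding (cx c) := by
  have h1 : cx c = (Complex.orthonormalBasisOneI.repr.symm.toHomeomorph) ∘
    (Homeomorph.subRight c) := funext (cx_eq c)
  rw [h1]
  exact (Homeomorph.measurableEmbedding _).comp (Homeomorph.measurableEmbedding _)

theorem integral_comp_cx {E : Type*} [NormedAddCommGroup E] [NormedSpace ℝ E] (c : Plane)
    (F : ℂ → E) : ∫ x, F (cx c x) = ∫ z, F z :=
  (measurePreserving_cx c).integral_comp (measurableEmbedding_cx c) F

theorem contDiff_cx (c : Plane) : ContDiff ℝ ∞ (cx c) := by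
  have h : ∀ j : Fin 2, ContDiff ℝ ∞ fun x : Plane => x j - c j :=
    fun j => (contDiff_euclidean.1 contDiff_id j).sub contDiff_const
  exact (Complex.ofRealCLM.contDiff.comp (h 0)).add
    ((Complex.ofRealCLM.contDiff.comp (h 1)).mul contDiff_const)

theorem contDiff_rho (c : Plane) : ContDiff ℝ ∞ (rho c) := by
  have h : ∀ j : Fin 2, ContDiff ℝ ∞ fun x : Plane => x j - c j :=
    fun j => (contDiff_euclidean.1 contDiff_id j).sub contDiff_const
  exact ((h 0).pow 2).add ((h 1).pow 2)

/-- The vector field orthogonal to `x - c`. -/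
def perp (c : Plane) (j : Fin 2) (x : Plane) : ℝ := ![-(x 1 - c 1), x 0 - c 0] j

theorem hasFDerivAt_coord (c x : Plane) (j : Fin 2) :
    HasFDerivAt (fun y : Plane => y j - c j) (EuclideanSpace.proj j : Plane →L[ℝ] ℝ) x :=
  ((EuclideanSpace.proj j : Plane →L[ℝ] ℝ).hasFDerivAt).sub_const (c j)

theorem exists_hasFDerivAt_rho (c x : Plane) : ∃ L : Plane →L[ℝ] ℝ, HasFDerivAt (rho c) L x ∧
    ∀ j, L (EuclideanSpace.single j 1) = 2 * (x j - c j) := by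
  refine ⟨_, ((hasFDerivAt_coord c x 0).pow 2).add ((hasFDerivAt_coord c x 1).pow 2), fun j => ?_⟩
  fin_cases j <;> simp

theorem exists_hasFDerivAt_cx (c x : Plane) : ∃ L : Plane →L[ℝ] ℂ, HasFDerivAt (cx c) L x ∧
    ∀ j, L (EuclideanSpace.single j 1) * starRingEnd ℂ (cx c x) =
      ((x j - c j : ℝ) : ℂ) + Complex.I * perp c j x := by
  have h0 := Complex.ofRealCLM.hasFDerivAt.comp x (hasFDerivAt_coord c x 0)
  have h1 := Complex.ofRealCLM.hasFDerivAt.comp x (hasFDerivAt_coord c x 1)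
  refine ⟨_, h0.add (h1.mul_const Complex.I), fun j => ?_⟩
  fin_cases j
  · simp [cx, perp]
    ring
  · simp [cx, perp]
    ring_nf
    simp
    ring

/-- The homogeneous harmonic polynomial `z ^ k` or `z̄ ^ |k|`. -/
def harmonicPoly (k : ℤ) (z : ℂ) : ℂ :=
  if 0 ≤ k then z ^ k.toNat else (starRingEnd ℂ z) ^ (-k).toNat

theorem norm_harmonicPoly (k : ℤ) (z : ℂ) : ‖harmonicPoly k z‖ = ‖z‖ ^ k.natAbs := by
  unfold harmonicPoly
  split_ifs with h
  · rw [norm_pow]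
    congr 1
    omega
  · rw [norm_pow, RCLike.norm_conj]
    congr 1
    omega

theorem harmonicPoly_rotate (k : ℤ) (α : ℝ) (z : ℂ) :
    harmonicPoly k (Complex.exp (α * Complex.I) * z) =
      Complex.exp (k * α * Complex.I) * harmonicPoly k z := by
  unfold harmonicPoly
  split_ifs with h
  · rw [mul_pow, ← Complex.exp_nat_mul]
    have h1 : ((k.toNat : ℕ) : ℂ) = (k : ℂ) := by exact_mod_cast Int.toNat_of_nonneg h
    rw [h1, mul_assoc]
  · rw [map_mul, mul_pow, ← Complex.exp_conj, ← Complex.exp_nat_mul]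
    have h1 : (((-k).toNat : ℕ) : ℂ) = -(k : ℂ) := by
      exact_mod_cast Int.toNat_of_nonneg (by omega : 0 ≤ -k)
    rw [h1]
    simp [mul_assoc]

theorem contDiff_harmonicPoly (k : ℤ) : ContDiff ℝ ∞ (harmonicPoly k) := by
  unfold harmonicPoly
  split_ifs
  · exact contDiff_id.pow _
  · exact ((Complex.conjCLE : ℂ →L[ℝ] ℂ).contDiff).pow _

/-- In polar terms the logarithmic gradient is |k| ∇log r + ik ∇θ, where ∇log r = (x - c)/ρ and ∇θ
is the rotated field divided by ρ. -/
theorem exists_hasFDerivAt_harmonicPoly (k : ℤ) {c x : Plane} (hx : x ≠ c) :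
    ∃ L : Plane →L[ℝ] ℂ, HasFDerivAt (fun y => harmonicPoly k (cx c y)) L x ∧
      ∀ j, L (EuclideanSpace.single j 1) = harmonicPoly k (cx c x) *
        ((|(k : ℝ)| * (x j - c j) : ℝ) + Complex.I * (k * perp c j x : ℝ)) / rho c x := by
  obtain ⟨M, hM, hMj⟩ := exists_hasFDerivAt_cx c x
  have hz := cx_ne_zero hx
  have hz' : starRingEnd ℂ (cx c x) ≠ 0 := (map_ne_zero _).2 hz
  have hρ : (rho c x : ℂ) = cx c x * starRingEnd ℂ (cx c x) := by
    rw [Complex.mul_conj, normSq_cx]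
  unfold harmonicPoly
  split_ifs with h
  · refine ⟨_, hM.pow k.toNat, fun j => ?_⟩
    have h1 : ((k.toNat : ℕ) : ℂ) = (k : ℂ) := by exact_mod_cast Int.toNat_of_nonneg h
    have h2 : |(k : ℝ)| = k := abs_of_nonneg (by exact_mod_cast h)
    rcases Nat.eq_zero_or_pos k.toNat with h0 | h0
    · have h3 : k = 0 := by omega
      simp [h3]
    · have h4 : (cx c x) ^ k.toNat = cx c x ^ (k.toNat - 1) * cx c x := by
        rw [← pow_succ]
        congr 1
        omega
      have h5 := hMj j
      rw [h2, h4, hρ]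
      simp only [_root_.smul_apply, smul_eq_mul, nsmul_eq_mul, h1]
      field_simp
      push_cast at h5 ⊢
      linear_combination (k : ℂ) * h5
  · have hM' := (Complex.conjCLE : ℂ →L[ℝ] ℂ).hasFDerivAt.comp x hM
    refine ⟨_, hM'.pow (-k).toNat, fun j => ?_⟩
    have h1 : (((-k).toNat : ℕ) : ℂ) = -(k : ℂ) := by
      exact_mod_cast Int.toNat_of_nonneg (by omega : 0 ≤ -k)
    have h2 : |(k : ℝ)| = -k := abs_of_neg (by exact_mod_cast not_le.1 h)
    have h4 : (starRingEnd ℂ (cx c x)) ^ (-k).toNat =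
        starRingEnd ℂ (cx c x) ^ ((-k).toNat - 1) * starRingEnd ℂ (cx c x) := by
      rw [← pow_succ]
      congr 1
      omega
    have h5 := congrArg (starRingEnd ℂ) (hMj j)
    rw [h2, h4, hρ]
    have h6 : (((Complex.conjCLE : ℂ →L[ℝ] ℂ) ∘SL M) (EuclideanSpace.single j 1)) =
      starRingEnd ℂ (M (EuclideanSpace.single j 1)) := rfl
    have h7 : ((Complex.conjCLE : ℂ →L[ℝ] ℂ) ∘ cx c) x = starRingEnd ℂ (cx c x) := rfl
    simp only [_root_.smul_apply, smul_eq_mul, nsmul_eq_mul, h1, h6, h7]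
    field_simp
    simp only [map_mul, map_add, Complex.conj_conj, Complex.conj_ofReal, Complex.conj_I] at h5
    push_cast at h5 ⊢
    linear_combination -(k : ℂ) * h5

/-- The order of the Bessel functions in the angular mode `k`. -/
def order (β : ℝ) (k : ℤ) : ℝ := |(k : ℝ) + β|

theorem order_nonneg (β : ℝ) (k : ℤ) : 0 ≤ order β k := abs_nonneg _

/-- The function `r ^ ν e ^ {ikθ}`. -/
def angular (β : ℝ) (k : ℤ) (z : ℂ) : ℂ :=
  harmonicPoly k z * ((Complex.normSq z ^ ((order β k - |(k : ℝ)|) / 2) : ℝ) : ℂ)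

theorem norm_angular (β : ℝ) (k : ℤ) {z : ℂ} (hz : z ≠ 0) :
    ‖angular β k z‖ = ‖z‖ ^ order β k := by
  have h0 : 0 < ‖z‖ := norm_pos_iff.2 hz
  rw [angular, norm_mul, norm_harmonicPoly, Complex.norm_real, Real.norm_of_nonneg (by
    exact Real.rpow_nonneg (Complex.normSq_nonneg _) _), Complex.normSq_eq_norm_sq,
    ← Real.rpow_natCast, ← Real.rpow_natCast, ← Real.rpow_mul h0.le, ← Real.rpow_add h0]
  congr 1
  have : ((k.natAbs : ℕ) : ℝ) = |(k : ℝ)| := by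
    rw [Nat.cast_natAbs, Int.cast_abs]
  rw [this]
  push_cast
  ring

theorem angular_rotate (β : ℝ) (k : ℤ) (α : ℝ) (z : ℂ) :
    angular β k (Complex.exp (α * Complex.I) * z) =
      Complex.exp (k * α * Complex.I) * angular β k z := by
  have h : Complex.normSq (Complex.exp (α * Complex.I) * z) = Complex.normSq z := by
    rw [Complex.normSq_eq_norm_sq, norm_mul, Complex.norm_exp_ofReal_mul_I, one_mul,
      Complex.normSq_eq_norm_sq]
  rw [angular, harmonicPoly_rotate, h, mul_assoc]
  rfl

/-- For β = 0 the exponent of |z|² vanishes and a polynomial remains, smooth through c as well. This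
is why the harmonic polynomial is kept apart from the fractional power. -/
theorem contDiffOn_angular (β : ℝ) (c : Plane) (k : ℤ) :
    ContDiffOn ℝ ∞ (fun x => angular β k (cx c x)) (regularSet β c) := by
  have h1 : ContDiff ℝ ∞ fun x => harmonicPoly k (cx c x) :=
    (contDiff_harmonicPoly k).comp (contDiff_cx c)
  by_cases hβ : β = 0
  · have h2 : (fun x => angular β k (cx c x)) = fun x => harmonicPoly k (cx c x) := by
      funext x
      simp [angular, order, hβ]
    rw [h2]
    exact h1.contDiffOn
  · refine h1.contDiffOn.mul (Complex.ofRealCLM.contDiff.comp_contDiffOn ?_)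
    simp only [normSq_cx]
    refine (contDiff_rho c).contDiffOn.rpow_const_of_ne fun x hx => ?_
    have hx' : x ≠ c := by simpa [regularSet, hβ] using hx
    exact (rho_pos hx').ne'

theorem exists_hasFDerivAt_angular (β : ℝ) (k : ℤ) {c x : Plane} (hx : x ≠ c) :
    ∃ L : Plane →L[ℝ] ℂ, HasFDerivAt (fun y => angular β k (cx c y)) L x ∧
      ∀ j, L (EuclideanSpace.single j 1) = angular β k (cx c x) *
        ((order β k * (x j - c j) : ℝ) + Complex.I * (k * perp c j x : ℝ)) / rho c x := by
  obtain ⟨M, hM, hMj⟩ := exists_hasFDerivAt_harmonicPoly k hx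
  obtain ⟨N, hN, hNj⟩ := exists_hasFDerivAt_rho c x
  have hρ := rho_pos hx
  set p := (order β k - |(k : ℝ)|) / 2 with hp
  have h1 : HasFDerivAt (fun y => ((Complex.normSq (cx c y) ^ p : ℝ) : ℂ))
      (Complex.ofRealCLM ∘SL ((p * rho c x ^ (p - 1)) • N)) x := by
    simp only [normSq_cx]
    exact Complex.ofRealCLM.hasFDerivAt.comp x (hN.rpow_const (Or.inl hρ.ne'))
  refine ⟨_, hM.mul h1, fun j => ?_⟩
  have h2 : rho c x ^ (p - 1) = rho c x ^ p / rho c x := Real.rpow_sub_one hρ.ne' p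
  have h3 : (rho c x : ℂ) ≠ 0 := by exact_mod_cast hρ.ne'
  simp only [_root_.add_apply, _root_.smul_apply, smul_eq_mul, hMj,
    ContinuousLinearMap.comp_apply, Complex.ofRealCLM_apply, hNj, angular, normSq_cx, h2, ← hp]
  push_cast
  have h4 : (p : ℂ) = ((order β k : ℂ) - (|(k : ℝ)| : ℝ)) / 2 := by rw [hp]; push_cast; ring
  rw [h4]
  field_simp
  ring

end Angular

/-! ### Gaussian integrals in the plane -/

section Integrals

theorem integral_rho_rpow_mul_exp (c : Plane) {q b : ℝ} (hq : -1 < q) (hb : 0 < b) :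
    ∫ x, rho c x ^ q * Real.exp (-(b * rho c x)) = Real.pi * b ^ (-(q + 1)) * Real.Gamma (q + 1) := by
  have h1 := Complex.integral_rpow_mul_exp_neg_mul_rpow (p := 2) (q := 2 * q) (b := b)
    (by norm_num) (by linarith) hb
  rw [← integral_comp_cx c] at h1
  have h2 : ∀ x, ‖cx c x‖ ^ (2 * q) * Real.exp (-b * ‖cx c x‖ ^ (2 : ℝ)) =
      rho c x ^ q * Real.exp (-(b * rho c x)) := by
    intro x
    rw [Real.rpow_mul (norm_nonneg _), Real.rpow_two, norm_cx_sq, neg_mul]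
  simp only [h2] at h1
  rw [h1]
  have h3 : -(2 * q + 2) / 2 = -(q + 1) := by ring
  have h4 : (2 * q + 2) / 2 = q + 1 := by ring
  rw [h3, h4]
  ring

theorem integrable_rho_rpow_mul_exp (c : Plane) {q b : ℝ} (hq : -1 < q) (hb : 0 < b) :
    Integrable fun x => rho c x ^ q * Real.exp (-(b * rho c x)) := by
  -- The formula for the integral has a positive value, whereas the integral of a nonintegrable
  -- function is zero by convention.
  by_contra h
  have h1 := integral_rho_rpow_mul_exp c hq hb
  rw [integral_undef h] at h1
  have : 0 < Real.pi * b ^ (-(q + 1)) * Real.Gamma (q + 1) := by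
    have h2 := Real.Gamma_pos_of_pos (by linarith : 0 < q + 1)
    have h3 := Real.pi_pos
    positivity
  linarith

theorem ae_ne (c : Plane) : ∀ᵐ x ∂(volume : Measure Plane), x ≠ c :=
  compl_mem_ae_iff.2 (measure_singleton c)

theorem aestronglyMeasurable_of_continuousOn_compl {E : Type*} [NormedAddCommGroup E] {c : Plane}
    {g : Plane → E} (hg : ContinuousOn g {c}ᶜ) :
    AEStronglyMeasurable g (volume : Measure Plane) := by
  have h1 := hg.aestronglyMeasurable_of_isSeparable (μ := volume)
    (measurableSet_singleton c).compl (IsSeparable.of_separableSpace _)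
  rwa [Measure.restrict_eq_self_of_ae_mem (s := {c}ᶜ) (ae_ne c)] at h1

theorem memLp_two_of_norm_sq_le {c : Plane} {g : Plane → ℂ} (hg : ContinuousOn g {c}ᶜ)
    {h : Plane → ℝ} (hh : Integrable h) (hle : ∀ x ≠ c, ‖g x‖ ^ 2 ≤ h x) :
    MemLp g 2 (volume : Measure Plane) := by
  have hm := aestronglyMeasurable_of_continuousOn_compl hg
  refine (memLp_two_iff_integrable_sq_norm hm).2 (hh.mono' (hm.norm.pow 2) ?_)
  filter_upwards [ae_ne c] with x hx
  rw [Real.norm_of_nonneg (by positivity)]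
  exact hle x hx

theorem norm_sq_eq_integral (u : L2) : ‖u‖ ^ 2 = ∫ x, ‖u x‖ ^ 2 := by
  have h1 := inner_eq_integral u u
  rw [inner_self_eq_norm_sq_to_K] at h1
  simp only [Complex.mul_conj'] at h1
  have h2 : ∫ x, ((‖u x‖ : ℂ)) ^ 2 = ((∫ x, ‖u x‖ ^ 2 : ℝ) : ℂ) := by
    rw [← integral_complex_ofReal]
    simp
  rw [h2] at h1
  refine Complex.ofReal_injective (Eq.trans ?_ h1)
  push_cast
  rfl

theorem tendsto_zero_of_norm_sq_le {u : ℕ → L2} {h : ℕ → ℝ} (hle : ∀ n, ‖u n‖ ^ 2 ≤ h n)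
    (hh : Tendsto h atTop (𝓝 0)) : Tendsto u atTop (𝓝 0) := by
  rw [tendsto_zero_iff_norm_tendsto_zero]
  have h1 : Tendsto (fun n => ‖u n‖ ^ 2) atTop (𝓝 0) :=
    squeeze_zero (fun n => by positivity) hle hh
  have h2 := h1.sqrt
  simpa [Real.sqrt_sq] using h2

/-- Strong convergence of uniformly bounded multiplication operators. -/
theorem tendsto_mulOp {m : ℕ → Plane → ℂ} (hm : ∀ n, IsMultiplier (m n))
    (hb : ∀ n x, ‖m n x‖ ≤ 1) (hlim : ∀ᵐ x, Tendsto (fun n => m n x) atTop (𝓝 1)) (u : L2) :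
    Tendsto (fun n => mulOp (m n) u) atTop (𝓝 u) := by
  rw [← tendsto_sub_nhds_zero_iff]
  refine tendsto_zero_of_norm_sq_le (h := fun n => ∫ x, ‖m n x - 1‖ ^ 2 * ‖u x‖ ^ 2)
    (fun n => ?_) ?_
  · rw [norm_sq_eq_integral]
    refine le_of_eq (integral_congr_ae ?_)
    filter_upwards [coeFn_mulOp (hm n) u, Lp.coeFn_sub (mulOp (m n) u) u] with x h1 h2
    rw [h2, Pi.sub_apply, h1, ← mul_pow, ← norm_mul]
    congr 2
    ring
  · have h0 : (0 : ℝ) = ∫ _ : Plane, (0 : ℝ) := by simp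
    rw [h0]
    refine tendsto_integral_of_dominated_convergence (fun x => 4 * ‖u x‖ ^ 2) (fun n => ?_) ?_
      (fun n => Eventually.of_forall fun x => ?_) ?_
    · exact (((hm n).measurable.sub_const 1).norm.pow_const 2).aestronglyMeasurable.mul
        ((Lp.aestronglyMeasurable u).norm.pow 2)
    · exact ((memLp_two_iff_integrable_sq_norm (Lp.aestronglyMeasurable u)).1 (Lp.memLp u)).const_mul 4
    · rw [Real.norm_of_nonneg (by positivity)]
      gcongr
      have h1 : ‖m n x - 1‖ ≤ 2 := by
        refine (norm_sub_le _ _).trans ?_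
        have := hb n x
        rw [norm_one]
        linarith
      nlinarith [norm_nonneg (m n x - 1)]
    · filter_upwards [hlim] with x hx
      have h1 : Tendsto (fun n => m n x - 1) atTop (𝓝 0) := by
        simpa using hx.sub_const 1
      simpa using (h1.norm.pow 2).mul_const (‖u x‖ ^ 2)

end Integrals

/-! ### Logarithmic cutoffs -/

section LogCutoff

/-- The smooth step used for logarithmic cutoffs. -/
def stepBump : ContDiffBump (0 : ℝ) := ⟨1, 2, by norm_num, by norm_num⟩

theorem exists_norm_deriv_stepBump_le : ∃ B, 0 ≤ B ∧ ∀ t, |deriv stepBump t| ≤ B := by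
  obtain ⟨B, hB⟩ := (stepBump.contDiff.continuous_deriv (n := 1) le_rfl
    ).bounded_above_of_compact_support (stepBump.hasCompactSupport.deriv)
  exact ⟨B, (norm_nonneg _).trans (hB 0), hB⟩

theorem stepBump_eq_zero {t : ℝ} (h : 2 ≤ |t|) : stepBump t = 0 :=
  stepBump.zero_of_le_dist (by simpa [stepBump] using h)

theorem stepBump_eq_one {t : ℝ} (h : |t| ≤ 1) : stepBump t = 1 :=
  stepBump.one_of_mem_closedBall (by simpa [stepBump] using h)

theorem deriv_stepBump_eq_zero {t : ℝ} (h : 2 < |t|) : deriv stepBump t = 0 := by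
  have : (stepBump : ℝ → ℝ) =ᶠ[𝓝 t] fun _ => 0 := by
    filter_upwards [(isOpen_lt continuous_const continuous_abs).mem_nhds h] with s hs
    exact stepBump_eq_zero (le_of_lt hs)
  rw [this.deriv_eq]
  simp

open Classical in
/-- The logarithmic cutoff, as a function. -/
def logCutoffFun (c : Plane) (n : ℕ) (x : Plane) : ℂ :=
  if x = c then 0 else (stepBump (Real.log (rho c x) / (n + 1)) : ℂ)

theorem logCutoffFun_of_ne {c x : Plane} (n : ℕ) (h : x ≠ c) :
    logCutoffFun c n x = (stepBump (Real.log (rho c x) / (n + 1)) : ℂ) := if_neg h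

theorem logCutoffFun_eventually_zero (c : Plane) (n : ℕ) :
    logCutoffFun c n =ᶠ[𝓝 c] fun _ => 0 := by
  have h1 : ∀ᶠ x in 𝓝 c, rho c x < Real.exp (-(2 * (n + 1))) := by
    refine (contDiff_rho c).continuous.continuousAt.eventually_lt_const ?_
    rw [rho_eq_zero_iff.2 rfl]
    positivity
  filter_upwards [h1] with x hx
  by_cases h : x = c
  · exact if_pos h
  · rw [logCutoffFun_of_ne n h, stepBump_eq_zero, Complex.ofReal_zero]
    have h2 : Real.log (rho c x) < -(2 * (n + 1)) := (Real.log_lt_iff_lt_exp (rho_pos h)).2 hx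
    have h3 : (0 : ℝ) < n + 1 := by positivity
    rw [le_abs']
    left
    rw [div_le_iff₀ h3]
    linarith

theorem logCutoffFun_eventuallyEq {c x : Plane} (n : ℕ) (h : x ≠ c) :
    logCutoffFun c n =ᶠ[𝓝 x] fun y => (stepBump (Real.log (rho c y) / (n + 1)) : ℂ) := by
  filter_upwards [isOpen_ne.mem_nhds h] with y hy using logCutoffFun_of_ne n hy

/-- The logarithmic cutoffs are test functions away from `c` which converge to `1`. -/
def logCutoff (β : ℝ) (c : Plane) (n : ℕ) : 𝓓(regularSet β c, ℂ) where
  toFun := logCutoffFun c n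
  contDiff' := by
    refine contDiff_iff_contDiffAt.2 fun x => ?_
    by_cases hx : x = c
    · rw [hx]
      exact contDiffAt_const.congr_of_eventuallyEq (logCutoffFun_eventually_zero c n)
    · refine ContDiffAt.congr_of_eventuallyEq ?_ (logCutoffFun_eventuallyEq n hx)
      have h1 : ContDiffAt ℝ ∞ (fun y => Real.log (rho c y) / (n + 1)) x :=
        ((contDiff_rho c).contDiffAt.log (rho_pos hx).ne').div_const _
      exact Complex.ofRealCLM.contDiff.contDiffAt.comp x (stepBump.contDiff.contDiffAt.comp x h1)
  hasCompactSupport' := by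
    refine HasCompactSupport.intro (isCompact_closedBall c (Real.exp (n + 1))) fun x hx => ?_
    by_cases h : x = c
    · exact if_pos h
    · rw [logCutoffFun_of_ne n h, stepBump_eq_zero, Complex.ofReal_zero]
      have h3 : (0 : ℝ) < n + 1 := by positivity
      have h1 : Real.exp (n + 1) < ‖x - c‖ := by
        simpa [dist_eq_norm] using hx
      have h2 : ‖x - c‖ ^ 2 = rho c x := by
        rw [← norm_cx_sq, cx_eq, LinearIsometryEquiv.norm_map]
      have h4 : Real.exp (2 * (n + 1)) < rho c x := by
        rw [← h2, two_mul, Real.exp_add, ← pow_two]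
        gcongr
      have h5 : 2 * (n + 1) < Real.log (rho c x) := (Real.lt_log_iff_exp_lt (rho_pos h)).2 h4
      rw [le_abs']
      right
      rw [le_div_iff₀ h3]
      linarith
  tsupport_subset' := by
    refine subset_trans (fun x hx => ?_) (compl_subset_regularSet β c)
    intro h
    rw [Set.mem_singleton_iff] at h
    rw [h] at hx
    exact notMem_tsupport_iff_eventuallyEq.2 (logCutoffFun_eventually_zero c n) hx

theorem norm_logCutoffFun_le (c : Plane) (n : ℕ) (x : Plane) : ‖logCutoffFun c n x‖ ≤ 1 := by
  unfold logCutoffFun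
  split_ifs
  · simp
  · rw [Complex.norm_real, Real.norm_of_nonneg stepBump.nonneg]
    exact stepBump.le_one

theorem tendsto_logCutoffFun {c x : Plane} (h : x ≠ c) :
    Tendsto (fun n => logCutoffFun c n x) atTop (𝓝 1) := by
  refine tendsto_const_nhds.congr' ?_
  obtain ⟨N, hN⟩ := exists_nat_ge |Real.log (rho c x)|
  filter_upwards [eventually_ge_atTop N] with n hn
  rw [logCutoffFun_of_ne n h, stepBump_eq_one, Complex.ofReal_one]
  have h3 : (0 : ℝ) < n + 1 := by positivity
  rw [abs_div, abs_of_pos h3, div_le_one h3]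
  have : (N : ℝ) ≤ n := by exact_mod_cast hn
  linarith

/-- The gradient is supported where |log ρ| ≤ 2(n+1), and its square is O((n+1)⁻² ρ⁻¹). There e²
ρ^{1/(n+1)} ≥ 1, so ρ⁻¹ may be traded for ρ^{1/(n+1) - 1}, which is integrable at c and has an
explicit Gaussian integral. -/
theorem exists_norm_fderiv_logCutoff_sq_le (c : Plane) : ∃ B, 0 ≤ B ∧ ∀ (n : ℕ) (x : Plane),
    x ≠ c → ∀ j : Fin 2, ‖fderiv ℝ (logCutoffFun c n) x (EuclideanSpace.single j 1)‖ ^ 2 ≤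
      B / (n + 1) ^ 2 * rho c x ^ ((1 : ℝ) / (n + 1) - 1) := by
  obtain ⟨B, hB, hb⟩ := exists_norm_deriv_stepBump_le
  refine ⟨4 * B ^ 2 * Real.exp 2, by positivity, fun n x hx j => ?_⟩
  have hρ := rho_pos hx
  have hn : (0 : ℝ) < n + 1 := by positivity
  obtain ⟨N, hN, hNj⟩ := exists_hasFDerivAt_rho c x
  set t := Real.log (rho c x) / (n + 1) with ht
  have h1 : HasFDerivAt (fun y => Real.log (rho c y) / (n + 1)) ((n + 1 : ℝ)⁻¹ • (rho c x)⁻¹ • N) x := by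
    simpa only [div_eq_inv_mul] using (hN.log hρ.ne').const_mul ((n + 1 : ℝ)⁻¹)
  have h2 : HasDerivAt stepBump (deriv stepBump t) t :=
    (stepBump.contDiff.differentiable (by simp : (∞ : WithTop ℕ∞) ≠ 0) t).hasDerivAt
  have h3 := Complex.ofRealCLM.hasFDerivAt.comp x (h2.comp_hasFDerivAt x h1)
  have h4 : fderiv ℝ (logCutoffFun c n) x = _ :=
    (logCutoffFun_eventuallyEq n hx).fderiv_eq.trans h3.fderiv
  have h5 : fderiv ℝ (logCutoffFun c n) x (EuclideanSpace.single j 1) =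
      ((deriv stepBump t * ((n + 1 : ℝ)⁻¹ * ((rho c x)⁻¹ * (2 * (x j - c j)))) : ℝ) : ℂ) := by
    rw [h4]
    simp [hNj]
  rw [h5, Complex.norm_real, Real.norm_eq_abs, sq_abs]
  have h6 : (x j - c j) ^ 2 ≤ rho c x := by
    unfold rho
    fin_cases j <;> simp <;> positivity
  have h7 : rho c x ^ ((1 : ℝ) / (n + 1) - 1) = Real.exp t * (rho c x)⁻¹ := by
    rw [Real.rpow_sub_one hρ.ne', Real.rpow_def_of_pos hρ, ht, div_eq_mul_inv]
    congr 2
    ring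
  rw [h7]
  by_cases h8 : 2 < |t|
  · rw [deriv_stepBump_eq_zero h8]
    simp only [zero_mul, ne_eq, OfNat.ofNat_ne_zero, not_false_eq_true, zero_pow]
    positivity
  · have h9 : -2 ≤ t := (abs_le.1 (not_lt.1 h8)).1
    have h10 : 1 ≤ Real.exp 2 * Real.exp t := by
      rw [← Real.exp_add]
      exact Real.one_le_exp (by linarith)
    have h11 : deriv stepBump t ^ 2 ≤ B ^ 2 := by
      rw [← sq_abs]
      have := hb t
      gcongr
    calc _ = deriv stepBump t ^ 2 * (4 * ((n + 1 : ℝ)⁻¹) ^ 2 * (rho c x)⁻¹ *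
          ((rho c x)⁻¹ * (x j - c j) ^ 2)) := by ring
      _ ≤ B ^ 2 * (4 * ((n + 1 : ℝ)⁻¹) ^ 2 * (rho c x)⁻¹ * ((rho c x)⁻¹ * rho c x)) := by
        gcongr
      _ = B ^ 2 * (4 * ((n + 1 : ℝ)⁻¹) ^ 2 * (rho c x)⁻¹) * 1 := by
        rw [inv_mul_cancel₀ hρ.ne']
        ring
      _ ≤ B ^ 2 * (4 * ((n + 1 : ℝ)⁻¹) ^ 2 * (rho c x)⁻¹) * (Real.exp 2 * Real.exp t) := by
        gcongr
      _ = _ := by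
        field_simp

end LogCutoff

/-! ### Smooth elements of the domain of the Hamiltonian -/

section SmoothDomain

theorem exists_test_eq_one {Ω : Opens Plane} (φ : 𝓓(Ω, ℂ)) :
    ∃ χ : 𝓓(Ω, ℂ), ∀ x ∈ tsupport φ, χ =ᶠ[𝓝 x] fun _ => 1 := by
  have hφ : IsCompact (tsupport φ) := φ.hasCompactSupport
  obtain ⟨K, hK, h1, h2⟩ := exists_compact_between hφ Ω.isOpen φ.tsupport_subset
  obtain ⟨L, hL, h3, h4⟩ := exists_compact_between hφ isOpen_interior h1
  obtain ⟨g, g1, g2, g3, g4⟩ := exists_contMDiff_support_eq_eq_one_iff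
    (modelWithCornersSelf ℝ Plane) (n := ⊤) (isOpen_interior (s := K)) hL.isClosed h4
  have h5 : tsupport (fun x => (g x : ℂ)) ⊆ K := by
    refine closure_minimal (fun x hx => interior_subset ?_) hK.isClosed
    rw [← g3]
    intro h0
    exact hx (by simp [h0])
  refine ⟨⟨fun x => (g x : ℂ), Complex.ofRealCLM.contDiff.comp g1.contDiff,
    HasCompactSupport.of_support_subset_isCompact hK (subset_closure.trans h5), h5.trans h2⟩, ?_⟩
  intro x hx
  filter_upwards [isOpen_interior.mem_nhds (h3 hx)] with y hy
  change ((g y : ℝ) : ℂ) = 1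
  rw [(g4 y).1 (interior_subset hy), Complex.ofReal_one]

theorem covDeriv_congr {A : Plane → Plane} {j : Fin 2} {φ ψ : Plane → ℂ} {x : Plane}
    (h : φ =ᶠ[𝓝 x] ψ) : covDeriv A j φ x = covDeriv A j ψ x := by
  rw [covDeriv, covDeriv, h.fderiv_eq, h.eq_of_nhds]

theorem magneticLaplacian_congr {A : Plane → Plane} {φ ψ : Plane → ℂ} {x : Plane}
    (h : φ =ᶠ[𝓝 x] ψ) : magneticLaplacian A φ x = magneticLaplacian A ψ x := by
  refine Finset.sum_congr rfl fun j _ => covDeriv_congr ?_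
  filter_upwards [h.eventuallyEq_nhds] with y hy using covDeriv_congr hy

theorem covDeriv_mul {A : Plane → Plane} {j : Fin 2} {φ ψ : Plane → ℂ} {x : Plane}
    (hφ : DifferentiableAt ℝ φ x) (hψ : DifferentiableAt ℝ ψ x) :
    covDeriv A j (fun y => φ y * ψ y) x = φ x * covDeriv A j ψ x +
      1 / Complex.I * fderiv ℝ φ x (EuclideanSpace.single j 1) * ψ x := by
  rw [covDeriv, covDeriv, fderiv_fun_mul hφ hψ]
  simp only [_root_.add_apply, _root_.smul_apply, smul_eq_mul]
  ring

variable {β : ℝ} {c : Plane} {f : Plane → ℝ} {hf : ContDiff ℝ ∞ f}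

theorem phase_mul_phase_neg (t : ℂ) :
    Complex.exp (Complex.I * t) * Complex.exp (-(Complex.I * t)) = 1 := by
  rw [← Complex.exp_add]
  simp

theorem norm_phase_neg (t : ℝ) : ‖Complex.exp (-(Complex.I * t))‖ = 1 := by
  have : -(Complex.I * t) = ((-t : ℝ) : ℂ) * Complex.I := by push_cast; ring
  rw [this, Complex.norm_exp_ofReal_mul_I]

theorem coe_freeTest_mulTest {v : Plane → ℂ}
    (hg : ContDiffOn ℝ ∞ (fun x => Complex.exp (-(Complex.I * f x)) * v x) (regularSet β c))
    {χ : 𝓓(regularSet β c, ℂ)} {x : Plane} (hχ : χ =ᶠ[𝓝 x] fun _ => 1) :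
    freeTest β c f hf (mulTest _ hg χ) x =
      Complex.exp (-(Complex.I * f x)) * magneticLaplacian (potential β c) v x := by
  rw [coe_freeTest, freeExpr]
  congr 1
  refine magneticLaplacian_congr ?_
  filter_upwards [hχ] with y hy
  change _ * (_ * χ y) = _
  rw [hy, mul_one, ← mul_assoc, phase_mul_phase_neg, one_mul]

theorem isMultiplier_logCutoff (c : Plane) (n : ℕ) : IsMultiplier (logCutoffFun c n) :=
  ⟨(logCutoff 0 c n).continuous.measurable, 1, norm_logCutoffFun_le c n⟩

/-- A point has zero capacity in the plane. With ε = 1/(n+1), Γ(q + ε) ≤ Γ(q + ε + 1)/ε grows at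
most like n + 1, the worst case being q = 0, against the factor (n+1)⁻². -/
theorem tendsto_logCutoff_bound {B K q b : ℝ} (hq : 0 ≤ q) (hb : 0 < b) :
    Tendsto (fun n : ℕ => B * K / (n + 1 : ℝ) ^ 2 * (Real.pi *
      b ^ (-((q + (1 / (n + 1 : ℝ) - 1)) + 1)) *
        Real.Gamma ((q + (1 / (n + 1 : ℝ) - 1)) + 1))) atTop (𝓝 0) := by
  have h0 : Tendsto (fun n : ℕ => (1 : ℝ) / (n + 1 : ℝ)) atTop (𝓝 0) :=
    tendsto_one_div_add_atTop_nhds_zero_nat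
  have hG : ∀ n : ℕ, Real.Gamma ((q + (1 / (n + 1 : ℝ) - 1)) + 1) =
      Real.Gamma (q + 1 / (n + 1 : ℝ) + 1) / (q + 1 / (n + 1 : ℝ)) := by
    intro n
    have : 0 < q + 1 / (n + 1 : ℝ) := by positivity
    rw [Real.Gamma_add_one this.ne']
    field_simp
    congr 1
    field_simp
    ring
  have h1 : Tendsto (fun n : ℕ => |B * K| * (1 / (n + 1 : ℝ)) * (Real.pi *
      b ^ (-(q + 1 / (n + 1 : ℝ))) * Real.Gamma (q + 1 / (n + 1 : ℝ) + 1))) atTop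
      (𝓝 (|B * K| * 0 * (Real.pi * b ^ (-(q + 0)) * Real.Gamma (q + 0 + 1)))) := by
    have h2 : ContinuousAt Real.Gamma (q + 0 + 1) :=
      (Real.differentiableAt_Gamma fun m => by
        have : (0 : ℝ) ≤ m := by positivity
        linarith).continuousAt
    refine (h0.const_mul _).mul ((tendsto_const_nhds.mul ?_).mul ?_)
    · exact ((Real.continuous_const_rpow hb.ne').tendsto _).comp (h0.const_add q).neg
    · exact h2.tendsto.comp ((h0.const_add q).add_const 1)
  rw [mul_zero, zero_mul] at h1
  refine squeeze_zero_norm (fun n => ?_) h1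
  have hn : (0 : ℝ) < 1 / (n + 1 : ℝ) := by positivity
  have hs : 0 < q + 1 / (n + 1 : ℝ) := by positivity
  have hΓ : 0 < Real.Gamma (q + 1 / (n + 1 : ℝ) + 1) := Real.Gamma_pos_of_pos (by positivity)
  have hX : 0 ≤ Real.pi * b ^ (-(q + 1 / (n + 1 : ℝ))) *
      (Real.Gamma (q + 1 / (n + 1 : ℝ) + 1) / (q + 1 / (n + 1 : ℝ))) :=
    mul_nonneg (mul_nonneg Real.pi_pos.le (Real.rpow_nonneg hb.le _)) (div_nonneg hΓ.le hs.le)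
  have e1 : (q + (1 / (n + 1 : ℝ) - 1)) + 1 = q + 1 / (n + 1 : ℝ) := by ring
  rw [hG n, e1, Real.norm_eq_abs, abs_mul, abs_div,
    abs_of_pos (by positivity : (0 : ℝ) < (n + 1) ^ 2), abs_of_nonneg hX]
  have e2 : Real.Gamma (q + 1 / (n + 1 : ℝ) + 1) / (q + 1 / (n + 1 : ℝ)) ≤
      Real.Gamma (q + 1 / (n + 1 : ℝ) + 1) / (1 / (n + 1 : ℝ)) := by
    gcongr
    linarith
  calc _ ≤ |B * K| / (n + 1 : ℝ) ^ 2 * (Real.pi * b ^ (-(q + 1 / (n + 1 : ℝ))) *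
        (Real.Gamma (q + 1 / (n + 1 : ℝ) + 1) / (1 / (n + 1 : ℝ)))) := by gcongr
    _ = _ := by
      rw [one_div, div_inv_eq_mul]
      have : (n + 1 : ℝ) ≠ 0 := by positivity
      field_simp

variable {v : Plane → ℂ} {u w : L2} {d : Fin 2 → L2}

/-- A function which is smooth off `c` and bounded there, with Gaussian decay, lies in the form
domain if its covariant gradient is square integrable. -/
theorem formPair_of_ae_eq
    (hv : ContDiffOn ℝ ∞ v (regularSet β c)) {K q b : ℝ} (hq : 0 ≤ q)
    (hb : 0 < b) (hbd : ∀ x ≠ c, ‖v x‖ ^ 2 ≤ K * (rho c x ^ q * Real.exp (-(b * rho c x))))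
    (hu : u =ᵐ[volume] fun x => Complex.exp (-(Complex.I * f x)) * v x)
    (hd : ∀ j, d j =ᵐ[volume] fun x =>
      Complex.exp (-(Complex.I * f x)) * covDeriv (potential β c) j v x) :
    FormPair β c f hf u d := by
  have hg : ContDiffOn ℝ ∞ (fun x => Complex.exp (-(Complex.I * f x)) * v x) (regularSet β c) :=
    (phase_neg_contDiff hf).contDiffOn.mul hv
  have hlim : ∀ᵐ x, Tendsto (fun n => logCutoffFun c n x) atTop (𝓝 1) := by
    filter_upwards [ae_ne c] with x hx using tendsto_logCutoffFun hx
  have hη := tendsto_mulOp (isMultiplier_logCutoff c) (norm_logCutoffFun_le c) hlim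
  refine ⟨fun n => mulTest _ hg (logCutoff β c n), (hη u).congr fun n => ?_, fun j => ?_⟩
  · refine Lp.ext ?_
    filter_upwards [coeFn_mulOp (isMultiplier_logCutoff c n) u, hu,
      (memLp_test (mulTest _ hg (logCutoff β c n))).coeFn_toLp] with x h1 h2 h3
    rw [h1, h2, mul_comm]
    exact h3.symm
  -- What remains after subtracting the cut-off gradient is v times the gradient of the logarithmic
  -- cutoff, which tends to zero in L².
  · have key : Tendsto (fun n => testToL2 _ (gaugeDeriv β c f hf j
        (mulTest _ hg (logCutoff β c n))) - mulOp (logCutoffFun c n) (d j)) atTop (𝓝 0) := by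
      obtain ⟨B, hB, hBn⟩ := exists_norm_fderiv_logCutoff_sq_le c
      refine tendsto_zero_of_norm_sq_le (fun n => ?_)
        (tendsto_logCutoff_bound (B := B) (K := K) hq hb)
      have hn : (0 : ℝ) < 1 / (n + 1 : ℝ) := by positivity
      have hq1 : -1 < q + (1 / (n + 1 : ℝ) - 1) := by linarith
      rw [norm_sq_eq_integral, ← integral_rho_rpow_mul_exp c hq1 hb, ← integral_const_mul]
      refine integral_mono_of_nonneg (Eventually.of_forall fun x => by positivity)
        ((integrable_rho_rpow_mul_exp c hq1 hb).const_mul _) ?_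
      filter_upwards [Lp.coeFn_sub (testToL2 _ (gaugeDeriv β c f hf j
        (mulTest _ hg (logCutoff β c n)))) (mulOp (logCutoffFun c n) (d j)),
        coeFn_mulOp (isMultiplier_logCutoff c n) (d j), hd j,
        (memLp_test (gaugeDeriv β c f hf j (mulTest _ hg (logCutoff β c n)))).coeFn_toLp,
        ae_ne c] with x h1 h2 h3 h4 hx
      have h5 : (testToL2 _ (gaugeDeriv β c f hf j (mulTest _ hg (logCutoff β c n))) :
          Plane → ℂ) x = gaugeDeriv β c f hf j (mulTest _ hg (logCutoff β c n)) x := h4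
      have h6 : (fun y => Complex.exp (Complex.I * f y) * mulTest _ hg (logCutoff β c n) y) =
          fun y => logCutoffFun c n y * v y := by
        funext y
        change _ * (_ * logCutoffFun c n y) = _
        rw [mul_comm (logCutoffFun c n y), ← mul_assoc, ← mul_assoc, phase_mul_phase_neg, one_mul]
      have hvx : DifferentiableAt ℝ v x :=
        (hv.contDiffAt ((regularSet β c).isOpen.mem_nhds
          (compl_subset_regularSet β c hx))).differentiableAt (by simp)
      have hηx : DifferentiableAt ℝ (logCutoffFun c n) x :=
        (logCutoff β c n).contDiff.differentiable (by simp) x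
      rw [h1, Pi.sub_apply, h5, h2, h3, gaugeDeriv_apply, h6, covDeriv_mul hηx hvx]
      have h7 : Complex.exp (-(Complex.I * f x)) * (logCutoffFun c n x *
          covDeriv (potential β c) j v x + 1 / Complex.I *
            fderiv ℝ (logCutoffFun c n) x (EuclideanSpace.single j 1) * v x) -
          logCutoffFun c n x * (Complex.exp (-(Complex.I * f x)) *
            covDeriv (potential β c) j v x) = Complex.exp (-(Complex.I * f x)) *
          (1 / Complex.I * fderiv ℝ (logCutoffFun c n) x (EuclideanSpace.single j 1) * v x) := by
        ring
      rw [h7, norm_mul, norm_phase_neg, one_mul, norm_mul, norm_mul, norm_div, norm_one,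
        Complex.norm_I, div_one, one_mul, mul_pow]
      have hρ := rho_pos hx
      have e1 := hBn n x hx j
      have e2 := hbd x hx
      rw [Real.rpow_add hρ]
      calc _ ≤ (B / (n + 1) ^ 2 * rho c x ^ ((1 : ℝ) / (n + 1) - 1)) *
            (K * (rho c x ^ q * Real.exp (-(b * rho c x)))) := by gcongr
        _ = _ := by ring
    have := key.add (hη (d j))
    simpa using this

/-- A function which is smooth off `c` and bounded there, with Gaussian decay, lies in the domain
of the Hamiltonian if its covariant derivatives are square integrable. -/
theorem mem_domain_of_ae_eq
    (hv : ContDiffOn ℝ ∞ v (regularSet β c)) {K q b : ℝ} (hq : 0 ≤ q)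
    (hb : 0 < b) (hbd : ∀ x ≠ c, ‖v x‖ ^ 2 ≤ K * (rho c x ^ q * Real.exp (-(b * rho c x))))
    (hu : u =ᵐ[volume] fun x => Complex.exp (-(Complex.I * f x)) * v x)
    (hd : ∀ j, d j =ᵐ[volume] fun x =>
      Complex.exp (-(Complex.I * f x)) * covDeriv (potential β c) j v x)
    (hw : w =ᵐ[volume] fun x =>
      Complex.exp (-(Complex.I * f x)) * magneticLaplacian (potential β c) v x) :
    ∃ h : u ∈ (freeHamiltonian β c f hf).domain, freeHamiltonian β c f hf ⟨u, h⟩ = w := by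
  refine mem_domain_freeHamiltonian β c f hf (formPair_of_ae_eq hv hq hb hbd hu hd) fun φ => ?_
  have hg : ContDiffOn ℝ ∞ (fun x => Complex.exp (-(Complex.I * f x)) * v x) (regularSet β c) :=
    (phase_neg_contDiff hf).contDiffOn.mul hv
  -- With χ = 1 near the support of φ, the function χ e^{-if} v is a test function. Symmetry on test
  -- functions applies to it, and locality removes χ from both sides.
  obtain ⟨χ, hχ⟩ := exists_test_eq_one φ
  have h1 : ⟪testToL2 _ (freeTest β c f hf (mulTest _ hg χ)), testToL2 _ φ⟫_ℂ =
      ⟪testToL2 _ (mulTest _ hg χ), testToL2 _ (freeTest β c f hf φ)⟫_ℂ := by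
    simp only [freeTest_eq_sum, map_sum, sum_inner, inner_sum, inner_gaugeDeriv]
  have h2 : ⟪w, testToL2 _ φ⟫_ℂ =
      ⟪testToL2 _ (freeTest β c f hf (mulTest _ hg χ)), testToL2 _ φ⟫_ℂ := by
    rw [inner_testToL2, inner_eq_integral]
    refine integral_congr_ae ?_
    filter_upwards [hw, (memLp_test φ).coeFn_toLp] with x e1 e2
    have e2' : (testToL2 _ φ : Plane → ℂ) x = φ x := e2
    rw [e1, e2']
    by_cases hx : x ∈ tsupport φ
    · rw [coe_freeTest_mulTest hg (hχ x hx)]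
    · rw [image_eq_zero_of_notMem_tsupport hx, zero_mul, zero_mul]
  have h3 : ⟪u, testToL2 _ (freeTest β c f hf φ)⟫_ℂ =
      ⟪testToL2 _ (mulTest _ hg χ), testToL2 _ (freeTest β c f hf φ)⟫_ℂ := by
    rw [inner_testToL2, inner_eq_integral]
    refine integral_congr_ae ?_
    filter_upwards [hu, (memLp_test (freeTest β c f hf φ)).coeFn_toLp] with x e1 e2
    have e2' : (testToL2 _ (freeTest β c f hf φ) : Plane → ℂ) x = freeTest β c f hf φ x := e2
    rw [e1, e2']
    by_cases hx : x ∈ tsupport φ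
    · congr 2
      change _ = _ * χ x
      rw [(hχ x hx).eq_of_nhds, mul_one]
    · have h0 : freeTest β c f hf φ x = 0 := by
        have hz := notMem_tsupport_iff_eventuallyEq.1 hx
        rw [coe_freeTest, freeExpr, magneticLaplacian_congr (ψ := fun _ => 0)]
        · have h00 : ∀ j, covDeriv (potential β c) j (fun _ => (0 : ℂ)) = fun _ => 0 := by
            intro j
            funext y
            simp [covDeriv]
          simp [magneticLaplacian, h00]
        · filter_upwards [hz] with y hy
          simp [hy]
      rw [h0, zero_mul, zero_mul]
  rw [h2, h1, h3]

end SmoothDomain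

/-! ### Functions of a single angular momentum -/

section Radial

/-- The function `e^{-if} r^ν e^{ikθ} G(r²)`. -/
def radialFun (β : ℝ) (c : Plane) (f : Plane → ℝ) (k : ℤ) (G : ℝ → ℂ) (x : Plane) : ℂ :=
  Complex.exp (-(Complex.I * f x)) * (angular β k (cx c x) * G (rho c x))

open Classical in
/-- The element of `L²(ℝ²)` given by `radialFun`. -/
def radialVec (β : ℝ) (c : Plane) (f : Plane → ℝ) (k : ℤ) (G : ℝ → ℂ) : L2 :=
  if h : MemLp (radialFun β c f k G) 2 (volume : Measure Plane) then h.toLp _ else 0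

/-- Continuous functions of exponential decay. -/
structure ExpDecay (G : ℝ → ℂ) : Prop where
  continuous : Continuous G
  bound : ∃ C b, 0 < b ∧ ∀ t, 0 ≤ t → ‖G t‖ ≤ C * Real.exp (-(b * t))

variable {β : ℝ} {c : Plane} {f : Plane → ℝ} {k l : ℤ} {G H : ℝ → ℂ}

theorem norm_angular_sq {x : Plane} (hx : x ≠ c) :
    ‖angular β k (cx c x)‖ ^ 2 = rho c x ^ order β k := by
  rw [norm_angular β k (cx_ne_zero hx), ← norm_cx_sq c x, ← Real.rpow_natCast,
    ← Real.rpow_natCast, ← Real.rpow_mul (norm_nonneg _), ← Real.rpow_mul (norm_nonneg _),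
    mul_comm]

theorem norm_radialFun_sq {x : Plane} (hx : x ≠ c) :
    ‖radialFun β c f k G x‖ ^ 2 = rho c x ^ order β k * ‖G (rho c x)‖ ^ 2 := by
  rw [radialFun, norm_mul, norm_phase_neg, one_mul, norm_mul, mul_pow, norm_angular_sq hx]

theorem continuousOn_angular : ContinuousOn (fun x => angular β k (cx c x)) {c}ᶜ :=
  (contDiffOn_angular β c k).continuousOn.mono (compl_subset_regularSet β c)

theorem continuousOn_radialFun (hf : Continuous f) (hG : Continuous G) :
    ContinuousOn (radialFun β c f k G) {c}ᶜ :=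
  (by fun_prop : Continuous fun x => Complex.exp (-(Complex.I * f x))).continuousOn.mul
    (continuousOn_angular.mul (hG.comp (contDiff_rho c).continuous).continuousOn)

theorem memLp_radialFun (hf : Continuous f) (hG : ExpDecay G) :
    MemLp (radialFun β c f k G) 2 (volume : Measure Plane) := by
  obtain ⟨hc, C, b, hb, hC⟩ := hG
  refine memLp_two_of_norm_sq_le (continuousOn_radialFun hf hc)
    ((integrable_rho_rpow_mul_exp c (q := order β k) (b := 2 * b)
      (by linarith [order_nonneg β k]) (by positivity)).const_mul (C ^ 2)) fun x hx => ?_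
  have hρ := rho_pos hx
  rw [norm_radialFun_sq hx]
  have h1 : ‖G (rho c x)‖ ^ 2 ≤ (C * Real.exp (-(b * rho c x))) ^ 2 := by
    gcongr
    exact hC _ hρ.le
  rw [mul_pow, ← Real.exp_nat_mul] at h1
  have e1 : ((2 : ℕ) : ℝ) * -(b * rho c x) = -(2 * b * rho c x) := by push_cast; ring
  rw [e1] at h1
  calc _ ≤ rho c x ^ order β k * (C ^ 2 * Real.exp (-(2 * b * rho c x))) := by gcongr
    _ = _ := by ring

theorem coeFn_radialVec (hf : Continuous f) (hG : ExpDecay G) :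
    radialVec β c f k G =ᵐ[volume] radialFun β c f k G := by
  rw [radialVec, dif_pos (memLp_radialFun hf hG)]
  exact MemLp.coeFn_toLp _

/-- Rotation by π/m preserves the measure and changes the sign of F. -/
theorem integral_eq_zero_of_rotate {F : ℂ → ℂ} {m : ℤ} (hm : m ≠ 0)
    (hF : ∀ (α : ℝ) (z : ℂ), F (Complex.exp (α * Complex.I) * z) =
      Complex.exp (m * α * Complex.I) * F z) : ∫ z, F z = 0 := by
  set α : ℝ := Real.pi / m
  have hm' : (m : ℝ) ≠ 0 := by exact_mod_cast hm
  have h1 : ∀ z, F (rotation (Circle.exp α) z) = -F z := by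
    intro z
    rw [rotation_apply, Circle.coe_exp, hF]
    have : (m : ℂ) * (α : ℂ) = Real.pi := by
      have : (m : ℝ) * α = Real.pi := mul_div_cancel₀ _ hm'
      exact_mod_cast this
    rw [this, Complex.exp_pi_mul_I]
    ring
  have h2 := (rotation (Circle.exp α)).measurePreserving.integral_comp
    (rotation (Circle.exp α)).toHomeomorph.measurableEmbedding F
  simp only [h1, integral_neg] at h2
  have h3 : (2 : ℂ) * ∫ z, F z = 0 := by linear_combination -h2
  simpa using h3

theorem inner_radialVec (hf : Continuous f) (hG : ExpDecay G) (hH : ExpDecay H) :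
    ⟪radialVec β c f l G, radialVec β c f k H⟫_ℂ = if l = k then
      ∫ x, ((rho c x ^ order β k : ℝ) : ℂ) * (H (rho c x) * starRingEnd ℂ (G (rho c x)))
      else 0 := by
  have h0 : ⟪radialVec β c f l G, radialVec β c f k H⟫_ℂ = ∫ x, angular β k (cx c x) *
      starRingEnd ℂ (angular β l (cx c x)) *
        (H (rho c x) * starRingEnd ℂ (G (rho c x))) := by
    rw [inner_eq_integral]
    refine integral_congr_ae ?_
    filter_upwards [coeFn_radialVec hf hG, coeFn_radialVec hf hH] with x h1 h2
    rw [h1, h2, radialFun, radialFun, map_mul, map_mul]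
    have h3 : Complex.exp (-(Complex.I * f x)) *
        starRingEnd ℂ (Complex.exp (-(Complex.I * f x))) = 1 := by
      rw [Complex.mul_conj', norm_phase_neg]
      simp
    linear_combination (angular β k (cx c x) * H (rho c x) *
      (starRingEnd ℂ (angular β l (cx c x)) * starRingEnd ℂ (G (rho c x)))) * h3
  rw [h0]
  split_ifs with hkl
  · subst hkl
    refine integral_congr_ae ?_
    filter_upwards [ae_ne c] with x hx
    rw [Complex.mul_conj', ← Complex.ofReal_pow, norm_angular_sq hx]
  · have h1 := integral_comp_cx c (fun z => angular β k z * starRingEnd ℂ (angular β l z) *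
      (H (Complex.normSq z) * starRingEnd ℂ (G (Complex.normSq z))))
    simp only [normSq_cx] at h1
    rw [h1]
    refine integral_eq_zero_of_rotate (m := k - l) (by omega) fun α z => ?_
    have e1 : Complex.normSq (Complex.exp (α * Complex.I) * z) = Complex.normSq z := by
      rw [Complex.normSq_eq_norm_sq, norm_mul, Complex.norm_exp_ofReal_mul_I, one_mul,
        Complex.normSq_eq_norm_sq]
    have e2 : Complex.exp (((k - l : ℤ) : ℂ) * α * Complex.I) =
        Complex.exp (k * α * Complex.I) * starRingEnd ℂ (Complex.exp (l * α * Complex.I)) := by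
      rw [← Complex.exp_conj, ← Complex.exp_add]
      congr 1
      simp
      ring
    rw [e1, angular_rotate, angular_rotate, e2, map_mul]
    ring

theorem radialVec_add (hf : Continuous f) (hG : ExpDecay G) (hH : ExpDecay H)
    {J : ℝ → ℂ} (hJ : ExpDecay J) {a b : ℂ} (h : ∀ t, 0 < t → J t = a * G t + b * H t) :
    radialVec β c f k J = a • radialVec β c f k G + b • radialVec β c f k H := by
  refine Lp.ext ?_
  filter_upwards [coeFn_radialVec (β := β) (c := c) (k := k) hf hG,
    coeFn_radialVec (β := β) (c := c) (k := k) hf hH,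
    coeFn_radialVec (β := β) (c := c) (k := k) hf hJ, ae_ne c,
    Lp.coeFn_add (a • radialVec β c f k G) (b • radialVec β c f k H),
    Lp.coeFn_smul a (radialVec β c f k G), Lp.coeFn_smul b (radialVec β c f k H)]
    with x h1 h2 h3 hx h4 h5 h6
  rw [h4, Pi.add_apply, h5, h6, Pi.smul_apply, Pi.smul_apply, h1, h2, h3, radialFun, radialFun,
    radialFun, h _ (rho_pos hx), smul_eq_mul, smul_eq_mul]
  ring

theorem norm_radialVec_le (hf : Continuous f) (hG : ExpDecay G) (hH : ExpDecay H) {C : ℝ}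
    (h : ∀ t, 0 < t → ‖G t‖ ≤ C * ‖H t‖) :
    ‖radialVec β c f k G‖ ≤ C * ‖radialVec β c f k H‖ := by
  refine Lp.norm_le_mul_norm_of_ae_le_mul ?_
  filter_upwards [coeFn_radialVec (β := β) (c := c) (k := k) hf hG,
    coeFn_radialVec (β := β) (c := c) (k := k) hf hH, ae_ne c] with x h1 h2 hx
  rw [h1, h2, radialFun, radialFun, norm_mul, norm_mul, norm_mul, norm_mul, norm_phase_neg,
    one_mul, one_mul]
  calc _ ≤ ‖angular β k (cx c x)‖ * (C * ‖H (rho c x)‖) := by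
        gcongr
        exact h _ (rho_pos hx)
    _ = _ := by ring

/-- The function `t ^ p e^{-st}`. -/
def gauss (p : ℕ) (s : ℝ) (t : ℝ) : ℂ := ((t ^ p * Real.exp (-(s * t)) : ℝ) : ℂ)

theorem expDecay_gauss (p : ℕ) {s : ℝ} (hs : 0 < s) : ExpDecay (gauss p s) := by
  -- Half of the exponential pays for the power: t^p ≤ p! (2/s)^p e^{st/2}.
  refine ⟨by unfold gauss; fun_prop, p.factorial / (s / 2) ^ p, s / 2, by positivity,
    fun t ht => ?_⟩
  rw [gauss, Complex.norm_real, Real.norm_of_nonneg (by positivity)]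
  have h1 := Real.pow_div_factorial_le_exp (s / 2 * t) (by positivity) p
  rw [div_le_iff₀ (by positivity), mul_pow] at h1
  have h2 : Real.exp (-(s * t)) = Real.exp (-(s / 2 * t)) * Real.exp (-(s / 2 * t)) := by
    rw [← Real.exp_add]
    congr 1
    ring
  have h3 : Real.exp (s / 2 * t) * Real.exp (-(s / 2 * t)) = 1 := by
    rw [← Real.exp_add]
    simp
  rw [h2, div_mul_eq_mul_div (p.factorial : ℝ), le_div_iff₀ (by positivity)]
  calc t ^ p * (Real.exp (-(s / 2 * t)) * Real.exp (-(s / 2 * t))) * (s / 2) ^ p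
      = ((s / 2) ^ p * t ^ p) * (Real.exp (-(s / 2 * t)) * Real.exp (-(s / 2 * t))) := by ring
    _ ≤ (Real.exp (s / 2 * t) * p.factorial) *
        (Real.exp (-(s / 2 * t)) * Real.exp (-(s / 2 * t))) := by gcongr
    _ = (Real.exp (s / 2 * t) * Real.exp (-(s / 2 * t))) * (p.factorial *
        Real.exp (-(s / 2 * t))) := by ring
    _ = _ := by rw [h3, one_mul]

theorem inner_gauss (hf : Continuous f) {s t : ℝ} (hs : 0 < s) (ht : 0 < t) :
    ⟪radialVec β c f l (gauss 0 s), radialVec β c f k (gauss 0 t)⟫_ℂ = if l = k then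
      ((Real.pi * (s + t) ^ (-(order β k + 1)) * Real.Gamma (order β k + 1) : ℝ) : ℂ) else 0 := by
  rw [inner_radialVec hf (expDecay_gauss 0 hs) (expDecay_gauss 0 ht)]
  split_ifs with h
  · rw [← integral_rho_rpow_mul_exp c (by linarith [order_nonneg β k]) (by positivity),
      ← integral_complex_ofReal]
    congr 1
    funext x
    have e : Real.exp (-((s + t) * rho c x)) =
        Real.exp (-(t * rho c x)) * Real.exp (-(s * rho c x)) := by
      rw [← Real.exp_add]
      congr 1
      ring
    simp only [gauss, pow_zero, one_mul, Complex.conj_ofReal]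
    rw [e]
    push_cast
    ring
  · rfl

/-- Differentiability is in L² norm. For |s' - s| ≤ s/2 the bound |e^x - 1 - x| ≤ x² e^{|x|}
dominates the remainder by (s' - s)² t² e^{-st/2}, a fixed square integrable profile. -/
theorem hasDerivAt_radialVec_gauss (hf : Continuous f) {s : ℝ} (hs : 0 < s) :
    HasDerivAt (fun s => radialVec β c f k (gauss 0 s)) (-radialVec β c f k (gauss 1 s)) s := by
  rw [hasDerivAt_iff_isLittleO]
  have key : ∀ᶠ s' in 𝓝 s, ‖radialVec β c f k (gauss 0 s') - radialVec β c f k (gauss 0 s) -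
      (s' - s) • -radialVec β c f k (gauss 1 s)‖ ≤
        ‖radialVec β c f k (gauss 2 (s / 2))‖ * ‖(s' - s) ^ 2‖ := by
    filter_upwards [Metric.ball_mem_nhds s (half_pos hs)] with s' hs'
    rw [Metric.mem_ball, Real.dist_eq, abs_lt] at hs'
    have hs'0 : 0 < s' := by linarith
    rw [mul_comm]
    refine Lp.norm_le_mul_norm_of_ae_le_mul ?_
    filter_upwards [coeFn_radialVec (β := β) (c := c) (k := k) hf (expDecay_gauss 0 hs'0),
      coeFn_radialVec (β := β) (c := c) (k := k) hf (expDecay_gauss 0 hs),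
      coeFn_radialVec (β := β) (c := c) (k := k) hf (expDecay_gauss 1 hs),
      coeFn_radialVec (β := β) (c := c) (k := k) hf (expDecay_gauss 2 (half_pos hs)),
      Lp.coeFn_sub (radialVec β c f k (gauss 0 s') - radialVec β c f k (gauss 0 s))
        ((s' - s) • -radialVec β c f k (gauss 1 s)),
      Lp.coeFn_sub (radialVec β c f k (gauss 0 s')) (radialVec β c f k (gauss 0 s)),
      Lp.coeFn_smul (s' - s) (-radialVec β c f k (gauss 1 s)),
      Lp.coeFn_neg (radialVec β c f k (gauss 1 s))]
      with x h1 h2 h3 h4 h5 h6 h7 h8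
    rw [h5, Pi.sub_apply, h6, Pi.sub_apply, h7, Pi.smul_apply, h8, Pi.neg_apply, h1, h2, h3, h4,
      Complex.real_smul]
    set r := rho c x with hr
    have hr0 : 0 ≤ r := rho_nonneg c x
    have e1 : radialFun β c f k (gauss 0 s') x - radialFun β c f k (gauss 0 s) x -
        ((s' - s : ℝ) : ℂ) * -radialFun β c f k (gauss 1 s) x =
        Complex.exp (-(Complex.I * f x)) * (angular β k (cx c x) *
          ((Real.exp (-(s * r)) * (Real.exp ((s - s') * r) - 1 - (s - s') * r) : ℝ) : ℂ)) := by
      have e2 : Real.exp (-(s' * r)) = Real.exp (-(s * r)) * Real.exp ((s - s') * r) := by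
        rw [← Real.exp_add]
        congr 1
        ring
      simp only [radialFun, gauss, ← hr, e2]
      push_cast
      ring
    rw [e1, radialFun, gauss, ← hr, norm_mul, norm_mul, norm_mul, norm_mul, norm_phase_neg, one_mul,
      one_mul, Complex.norm_real, Complex.norm_real, norm_mul,
      Real.norm_of_nonneg (Real.exp_pos _).le,
      Real.norm_of_nonneg (by positivity : 0 ≤ r ^ 2 * Real.exp (-(s / 2 * r))),
      Real.norm_of_nonneg (sq_nonneg (s' - s))]
    have e3 : ‖Real.exp ((s - s') * r) - 1 - (s - s') * r‖ ≤
        ((s' - s) * r) ^ 2 * Real.exp (s / 2 * r) := by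
      have h0 := Complex.norm_exp_sub_sum_le_norm_mul_exp (((s - s') * r : ℝ) : ℂ) 2
      rw [Finset.sum_range_succ, Finset.sum_range_one] at h0
      have h9 : Complex.exp (((s - s') * r : ℝ) : ℂ) -
          ((((s - s') * r : ℝ) : ℂ) ^ 0 / (Nat.factorial 0) +
            (((s - s') * r : ℝ) : ℂ) ^ 1 / (Nat.factorial 1)) =
          ((Real.exp ((s - s') * r) - 1 - (s - s') * r : ℝ) : ℂ) := by
        push_cast [Nat.factorial]
        ring
      rw [h9, Complex.norm_real, Complex.norm_real] at h0
      refine h0.trans ?_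
      rw [Real.norm_eq_abs, sq_abs, abs_mul, abs_of_nonneg hr0]
      have h10 : |s - s'| ≤ s / 2 := by rw [abs_le]; constructor <;> linarith
      calc _ = ((s' - s) * r) ^ 2 * Real.exp (|s - s'| * r) := by ring
        _ ≤ _ := by gcongr
    have e4 : Real.exp (-(s * r)) * Real.exp (s / 2 * r) = Real.exp (-(s / 2 * r)) := by
      rw [← Real.exp_add]
      congr 1
      ring
    calc _ ≤ ‖angular β k (cx c x)‖ * (Real.exp (-(s * r)) *
          (((s' - s) * r) ^ 2 * Real.exp (s / 2 * r))) := by gcongr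
      _ = ‖angular β k (cx c x)‖ * ((s' - s) ^ 2 * r ^ 2 *
          (Real.exp (-(s * r)) * Real.exp (s / 2 * r))) := by ring
      _ = _ := by rw [e4]; ring
  refine (Asymptotics.IsBigO.of_bound _ key).trans_isLittleO ?_
  have := Asymptotics.isLittleO_pow_sub_sub s (by norm_num : 1 < 2)
  simpa only [Real.norm_eq_abs, sq_abs] using this

end Radial

/-! ### The Hamiltonian on Gaussian functions -/

section GaussMode

/-- The function `r^ν e^{ikθ} e^{-s r²}`. -/
def gaussMode (β : ℝ) (c : Plane) (k : ℤ) (s : ℝ) (x : Plane) : ℂ :=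
  angular β k (cx c x) * gauss 0 s (rho c x)

/-- The logarithmic covariant gradient of `gaussMode`. -/
def gaussSlope (β : ℝ) (c : Plane) (k : ℤ) (s : ℝ) (j : Fin 2) (x : Plane) : ℂ :=
  (-Complex.I * order β k * ((x j - c j : ℝ) : ℂ) + (k + β) * (perp c j x : ℂ)) / (rho c x : ℂ) +
    2 * Complex.I * s * ((x j - c j : ℝ) : ℂ)

variable {β : ℝ} {c : Plane} {k : ℤ} {s : ℝ} {x : Plane}

theorem contDiffOn_gaussMode : ContDiffOn ℝ ∞ (gaussMode β c k s) (regularSet β c) := by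
  refine (contDiffOn_angular β c k).mul (ContDiff.contDiffOn ?_)
  unfold gauss
  simp only [pow_zero, one_mul]
  exact Complex.ofRealCLM.contDiff.comp (contDiff_const.mul (contDiff_rho c)).neg.exp

theorem potential_apply (j : Fin 2) : potential β c x j = -β * perp c j x / rho c x := by
  fin_cases j <;> simp [potential, perp, rho] <;> ring

theorem exists_hasFDerivAt_gaussMode (hx : x ≠ c) :
    ∃ L : Plane →L[ℝ] ℂ, HasFDerivAt (gaussMode β c k s) L x ∧
      ∀ j, L (EuclideanSpace.single j 1) = gaussMode β c k s x *
        ((((order β k * (x j - c j) : ℝ) : ℂ) + Complex.I * (k * perp c j x : ℝ)) / rho c x -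
          ((2 * s * (x j - c j) : ℝ) : ℂ)) := by
  obtain ⟨M, hM, hMj⟩ := exists_hasFDerivAt_angular β k hx
  obtain ⟨N, hN, hNj⟩ := exists_hasFDerivAt_rho c x
  have h1 := Complex.ofRealCLM.hasFDerivAt.comp x
    (HasFDerivAt.exp (f := fun y => -(s * rho c y)) (hN.const_mul s).neg)
  have h2 : (fun y => gauss 0 s (rho c y)) = Complex.ofRealCLM ∘ fun y =>
      Real.exp (-(s * rho c y)) := by
    funext y
    simp [gauss]
  refine ⟨_, hM.mul (h2 ▸ h1), fun j => ?_⟩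
  simp only [_root_.add_apply, _root_.smul_apply, hMj, ContinuousLinearMap.comp_apply, hNj,
    smul_eq_mul, gaussMode, _root_.neg_apply, gauss, pow_zero, one_mul, Complex.ofRealCLM_apply]
  push_cast
  ring

theorem covDeriv_gaussMode (hx : x ≠ c) (j : Fin 2) :
    covDeriv (potential β c) j (gaussMode β c k s) x =
      gaussMode β c k s x * gaussSlope β c k s j x := by
  obtain ⟨L, hL, hLj⟩ := exists_hasFDerivAt_gaussMode (β := β) (k := k) (s := s) hx
  rw [covDeriv, hL.fderiv, hLj, potential_apply, gaussSlope, one_div, Complex.inv_I]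
  have h : (rho c x : ℂ) ≠ 0 := by exact_mod_cast (rho_pos hx).ne'
  push_cast
  field_simp
  linear_combination (-(gaussMode β c k s x) * k * (perp c j x)) * Complex.I_sq

theorem exists_hasFDerivAt_gaussSlope (hx : x ≠ c) (j : Fin 2) :
    ∃ L : Plane →L[ℝ] ℂ, HasFDerivAt (gaussSlope β c k s j) L x ∧
      L (EuclideanSpace.single j 1) = -Complex.I * order β k / rho c x -
        (-Complex.I * order β k * ((x j - c j : ℝ) : ℂ) + (k + β) * (perp c j x : ℂ)) *
          ((2 * (x j - c j) : ℝ) : ℂ) / rho c x ^ 2 + 2 * Complex.I * s := by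
  have h : rho c x ≠ 0 := (rho_pos hx).ne'
  have hy := Complex.ofRealCLM.hasFDerivAt.comp x (hasFDerivAt_coord c x j)
  have ht : ∃ T : Plane →L[ℝ] ℝ, HasFDerivAt (perp c j) T x ∧
      T (EuclideanSpace.single j 1) = 0 := by
    fin_cases j
    · exact ⟨_, (hasFDerivAt_coord c x 1).neg, by simp⟩
    · exact ⟨_, hasFDerivAt_coord c x 0, by simp⟩
  obtain ⟨T, hT, hTj⟩ := ht
  obtain ⟨N, hN, hNj⟩ := exists_hasFDerivAt_rho c x
  have ht' := Complex.ofRealCLM.hasFDerivAt.comp x hT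
  have hi := Complex.ofRealCLM.hasFDerivAt.comp x ((hasDerivAt_inv h).comp_hasFDerivAt x hN)
  have key := (((hy.const_mul (-Complex.I * order β k)).add (ht'.const_mul (k + β : ℂ))).mul
    hi).add (hy.const_mul (2 * Complex.I * s))
  refine ⟨_, key.congr_of_eventuallyEq (Eventually.of_forall fun y => ?_), ?_⟩
  · simp [gaussSlope, div_eq_mul_inv]
  · simp only [_root_.add_apply, _root_.smul_apply, ContinuousLinearMap.comp_apply, hNj, hTj,
      smul_eq_mul, Complex.ofRealCLM_apply, Function.comp_apply, PiLp.proj_apply, Pi.add_apply]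
    simp
    field_simp
    ring

/-- With logarithmic covariant gradient w_j, the square of the j-th covariant derivative multiplies
the Gaussian by w_j² + (1/i)∂_j w_j. In the sum over j the singular terms -ν²/ρ and (k+β)²/ρ cancel,
which is what fixes ν = |k + β|. -/
theorem magneticLaplacian_gaussMode (hx : x ≠ c) :
    magneticLaplacian (potential β c) (gaussMode β c k s) x =
      gaussMode β c k s x *
        (((4 * s * (order β k + 1) : ℝ) : ℂ) - ((4 * s ^ 2 * rho c x : ℝ) : ℂ)) := by
  have h : (rho c x : ℂ) ≠ 0 := by exact_mod_cast (rho_pos hx).ne'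
  have h1 : ∀ j, covDeriv (potential β c) j (covDeriv (potential β c) j (gaussMode β c k s)) x =
      gaussMode β c k s x * (gaussSlope β c k s j x ^ 2 + 1 / Complex.I *
        fderiv ℝ (gaussSlope β c k s j) x (EuclideanSpace.single j 1)) := by
    intro j
    obtain ⟨L, hL, -⟩ := exists_hasFDerivAt_gaussMode (β := β) (k := k) (s := s) hx
    obtain ⟨N, hN, -⟩ := exists_hasFDerivAt_gaussSlope (β := β) (k := k) (s := s) hx j
    have h2 : covDeriv (potential β c) j (gaussMode β c k s) =ᶠ[𝓝 x]
        fun y => gaussSlope β c k s j y * gaussMode β c k s y := by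
      filter_upwards [isOpen_ne.mem_nhds hx] with y hy
      rw [covDeriv_gaussMode hy, mul_comm]
    rw [covDeriv_congr h2, covDeriv_mul hN.differentiableAt hL.differentiableAt,
      covDeriv_gaussMode hx]
    ring
  obtain ⟨L0, hL0, hL0'⟩ := exists_hasFDerivAt_gaussSlope (β := β) (k := k) (s := s) hx 0
  obtain ⟨L1, hL1, hL1'⟩ := exists_hasFDerivAt_gaussSlope (β := β) (k := k) (s := s) hx 1
  rw [magneticLaplacian, Fin.sum_univ_two, h1, h1, hL0.fderiv, hL1.fderiv, hL0', hL1', ← mul_add]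
  congr 1
  have hρ : (rho c x : ℂ) = ((x 0 - c 0 : ℝ) : ℂ) ^ 2 + ((x 1 - c 1 : ℝ) : ℂ) ^ 2 := by
    rw [rho]
    push_cast
    ring
  have hν : (order β k : ℂ) ^ 2 = (k + β) ^ 2 := by
    rw [← Complex.ofReal_pow, order, sq_abs]
    push_cast
    ring
  have hp0 : (perp c 0 x : ℂ) = -((x 1 - c 1 : ℝ) : ℂ) := by simp [perp]
  have hp1 : (perp c 1 x : ℂ) = ((x 0 - c 0 : ℝ) : ℂ) := by simp [perp]
  rw [gaussSlope, gaussSlope, one_div, Complex.inv_I, hp0, hp1]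
  have hm : (rho c x : ℂ) * (rho c x : ℂ)⁻¹ = 1 := mul_inv_cancel₀ h
  simp only [div_eq_mul_inv, ← inv_pow]
  push_cast [hρ] at hm hν ⊢
  set P : ℂ := ((x 0 : ℂ) - c 0) ^ 2 + ((x 1 : ℂ) - c 1) ^ 2
  linear_combination (P⁻¹ ^ 2 * P * order β k ^ 2 - 4 * s * order β k * P⁻¹ * P + 4 * s ^ 2 * P -
    4 * s) * Complex.I_sq - P⁻¹ ^ 2 * P * hν + (4 * s * order β k - 2 * Complex.I ^ 2 *
    order β k * P⁻¹) * hm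

theorem memLp_gaussMode_mul_gaussSlope (hs : 0 < s) (j : Fin 2) :
    MemLp (fun x => gaussMode β c k s x * gaussSlope β c k s j x) 2 (volume : Measure Plane) := by
  set ν := order β k with hν
  have hν0 : 0 ≤ ν := order_nonneg β k
  have hi0 : Integrable fun x => 8 * ν ^ 2 *
      (rho c x ^ (ν - 1) * Real.exp (-(2 * s * rho c x))) := by
    -- For ν = 0 the power ρ^{-1} is not integrable, but its coefficient ν² vanishes.
    rcases hν0.eq_or_lt with h0 | h0
    · simp [← h0]
    · exact (integrable_rho_rpow_mul_exp c (by linarith) (by positivity)).const_mul _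
  have hi1 : Integrable fun x => 8 * s ^ 2 *
      (rho c x ^ (ν + 1) * Real.exp (-(2 * s * rho c x))) :=
    (integrable_rho_rpow_mul_exp c (by linarith) (by positivity)).const_mul _
  refine memLp_two_of_norm_sq_le (c := c) ?_ (hi0.add hi1) fun x hx => ?_
  · refine (contDiffOn_gaussMode.continuousOn.mono (compl_subset_regularSet β c)).mul ?_
    intro x hx
    obtain ⟨L, hL, -⟩ := exists_hasFDerivAt_gaussSlope (β := β) (k := k) (s := s) hx j
    exact hL.continuousAt.continuousWithinAt
  · have hρ := rho_pos hx
    have hy : ∀ i : Fin 2, (x i - c i) ^ 2 ≤ rho c x := by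
      intro i
      unfold rho
      fin_cases i <;> simp <;> nlinarith [sq_nonneg (x 0 - c 0), sq_nonneg (x 1 - c 1)]
    have ht : perp c j x ^ 2 ≤ rho c x := by
      unfold rho perp
      fin_cases j <;> simp <;> nlinarith [sq_nonneg (x 0 - c 0), sq_nonneg (x 1 - c 1)]
    have h1 : ‖gaussMode β c k s x‖ ^ 2 = rho c x ^ ν * Real.exp (-(2 * s * rho c x)) := by
      rw [gaussMode, norm_mul, mul_pow, norm_angular_sq hx, gauss, Complex.norm_real,
        Real.norm_of_nonneg (by positivity), pow_zero, one_mul, ← Real.exp_nat_mul]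
      congr 2
      push_cast
      ring
    have h2 : ‖gaussSlope β c k s j x‖ ^ 2 ≤ 8 * ν ^ 2 / rho c x + 8 * s ^ 2 * rho c x := by
      have e1 : gaussSlope β c k s j x = (((k + β) * perp c j x / rho c x : ℝ) : ℂ) +
          ((-(ν * (x j - c j)) / rho c x + 2 * s * (x j - c j) : ℝ) : ℂ) * Complex.I := by
        rw [gaussSlope]
        push_cast
        ring
      have e2 : ((k : ℝ) + β) ^ 2 = ν ^ 2 := by rw [hν, order, sq_abs]
      rw [e1, ← Complex.normSq_eq_norm_sq, Complex.normSq_add_mul_I]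
      have e3 : ((k + β) * perp c j x / rho c x) ^ 2 ≤ ν ^ 2 / rho c x := by
        rw [div_pow, mul_pow, e2, div_le_div_iff₀ (by positivity) hρ]
        calc _ ≤ ν ^ 2 * rho c x * rho c x := by gcongr
          _ = _ := by ring
      have e4 : (ν * (x j - c j) / rho c x) ^ 2 ≤ ν ^ 2 / rho c x := by
        rw [div_pow, mul_pow, div_le_div_iff₀ (by positivity) hρ]
        calc _ ≤ ν ^ 2 * rho c x * rho c x := by gcongr; exact hy j
          _ = _ := by ring
      have e5 : (2 * s * (x j - c j)) ^ 2 ≤ 4 * s ^ 2 * rho c x := by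
        rw [mul_pow, mul_pow]
        calc _ ≤ 2 ^ 2 * s ^ 2 * rho c x := by gcongr; exact hy j
          _ = _ := by ring
      have e6 : 0 ≤ ν ^ 2 / rho c x := by positivity
      have e7 : -(ν * (x j - c j)) / rho c x = -(ν * (x j - c j) / rho c x) := by ring
      have e8 : 8 * ν ^ 2 / rho c x = 8 * (ν ^ 2 / rho c x) := by ring
      rw [e7, e8]
      nlinarith [sq_nonneg (ν * (x j - c j) / rho c x + 2 * s * (x j - c j))]
    rw [norm_mul, mul_pow, h1, Pi.add_apply, Real.rpow_sub hρ, Real.rpow_add hρ, Real.rpow_one]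
    calc _ ≤ rho c x ^ ν * Real.exp (-(2 * s * rho c x)) *
          (8 * ν ^ 2 / rho c x + 8 * s ^ 2 * rho c x) := by gcongr
      _ = _ := by ring

/-- The Gaussian functions of fixed angular momentum lie in the domain of the Hamiltonian. -/
theorem freeHamiltonian_gauss {f : Plane → ℝ} (hf : ContDiff ℝ ∞ f) (hs : 0 < s) :
    ∃ h : radialVec β c f k (gauss 0 s) ∈ (freeHamiltonian β c f hf).domain,
      freeHamiltonian β c f hf ⟨radialVec β c f k (gauss 0 s), h⟩ =
        ((4 * s * (order β k + 1) : ℝ) : ℂ) • radialVec β c f k (gauss 0 s) -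
          ((4 * s ^ 2 : ℝ) : ℂ) • radialVec β c f k (gauss 1 s) := by
  have hfc := hf.continuous
  have hmem : ∀ j, MemLp (fun x => Complex.exp (-(Complex.I * f x)) *
      (gaussMode β c k s x * gaussSlope β c k s j x)) 2 (volume : Measure Plane) := by
    intro j
    have h0 := memLp_gaussMode_mul_gaussSlope (β := β) (c := c) (k := k) hs j
    refine h0.of_le ((by fun_prop : Continuous fun x =>
      Complex.exp (-(Complex.I * f x))).aestronglyMeasurable.mul h0.aestronglyMeasurable) ?_
    exact Eventually.of_forall fun x => by rw [norm_mul, norm_phase_neg, one_mul]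
  refine mem_domain_of_ae_eq (v := gaussMode β c k s) (d := fun j => (hmem j).toLp _)
    (K := 1) (q := order β k) (b := 2 * s) contDiffOn_gaussMode (order_nonneg β k)
    (by positivity) (fun x hx => ?_) (coeFn_radialVec hfc (expDecay_gauss 0 hs)) (fun j => ?_) ?_
  · rw [gaussMode, norm_mul, mul_pow, norm_angular_sq hx, gauss, Complex.norm_real,
      Real.norm_of_nonneg (by positivity), pow_zero, one_mul, one_mul, ← Real.exp_nat_mul]
    refine le_of_eq ?_
    congr 2
    push_cast
    ring
  · filter_upwards [(hmem j).coeFn_toLp, ae_ne c] with x h1 hx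
    rw [h1, covDeriv_gaussMode hx]
  · filter_upwards [coeFn_radialVec (β := β) (c := c) (k := k) hfc (expDecay_gauss 0 hs),
      coeFn_radialVec (β := β) (c := c) (k := k) hfc (expDecay_gauss 1 hs), ae_ne c,
      Lp.coeFn_sub (((4 * s * (order β k + 1) : ℝ) : ℂ) • radialVec β c f k (gauss 0 s))
        (((4 * s ^ 2 : ℝ) : ℂ) • radialVec β c f k (gauss 1 s)),
      Lp.coeFn_smul ((4 * s * (order β k + 1) : ℝ) : ℂ) (radialVec β c f k (gauss 0 s)),
      Lp.coeFn_smul ((4 * s ^ 2 : ℝ) : ℂ) (radialVec β c f k (gauss 1 s))]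
      with x h1 h2 hx h3 h4 h5
    rw [h3, Pi.sub_apply, h4, h5, Pi.smul_apply, Pi.smul_apply, h1, h2, radialFun, radialFun,
      magneticLaplacian_gaussMode hx, gaussMode, gauss, gauss, smul_eq_mul, smul_eq_mul]
    push_cast
    ring

end GaussMode

/-! ### An incomplete Gamma function on the logarithmic cover -/

section IncompleteGamma

variable {ν : ℝ}

/-- M(η) is the integral of t^{-ν-1} e^t dt from t = e^η to -∞, lifted to the logarithm of t. Around
the origin t^{-ν} picks up e^{-2πiν}, so the twisted difference has zero derivative and is a
constant. Its bound has to be uniform in ν, as it is used for all angular momenta. -/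
theorem exists_incompleteGamma (hν : 0 ≤ ν) : ∃ M : ℂ → ℂ,
    (∀ η, HasDerivAt M (-(Complex.exp (-(ν * η)) * Complex.exp (Complex.exp η))) η) ∧
    Tendsto (fun x : ℝ => M (x + Real.pi * Complex.I)) atTop (𝓝 0) ∧
    ∃ κ : ℂ, ‖κ‖ ≤ 20 ∧
      ∀ η, Complex.exp (2 * Real.pi * Complex.I * ν) * M (η + 2 * Real.pi * Complex.I) - M η = κ := by
  have hd : Differentiable ℂ fun η : ℂ => -(Complex.exp (-(ν * η)) * Complex.exp (Complex.exp η)) := by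
    fun_prop
  obtain ⟨M₀, hM₀⟩ := hd.isExactOn_univ
  have hM₀' : ∀ η, HasDerivAt M₀ _ η := fun η => hM₀ η (Set.mem_univ _)
  have hline : ∀ x : ℝ, HasDerivAt (fun x : ℝ => M₀ (x + Real.pi * Complex.I))
      (-(Complex.exp (-(ν * (x + Real.pi * Complex.I))) *
        Complex.exp (Complex.exp (x + Real.pi * Complex.I)))) x := by
    intro x
    have h1 : HasDerivAt (fun w : ℂ => w + Real.pi * Complex.I) 1 (x : ℂ) :=
      (hasDerivAt_id _).add_const _
    -- On the line Im η = π, t = -e^x is negative, so e^t decays and the primitive has a limit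
    -- there; subtracting that limit normalizes M.
    have h2 := (HasDerivAt.comp (x : ℂ) (hM₀' (x + Real.pi * Complex.I)) h1).comp_ofReal
    simpa using h2
  have hbound : ∀ x : ℝ, 0 ≤ x → ‖-(Complex.exp (-(ν * (x + Real.pi * Complex.I))) *
      Complex.exp (Complex.exp (x + Real.pi * Complex.I)))‖ ≤ Real.exp (-x) := by
    intro x hx
    rw [norm_neg, norm_mul, Complex.norm_exp, Complex.norm_exp, Complex.exp_add,
      Complex.exp_pi_mul_I, mul_neg_one, Complex.neg_re (Complex.exp _), Complex.exp_ofReal_re]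
    have h1 : (-((ν : ℂ) * (x + Real.pi * Complex.I))).re = -(ν * x) := by simp
    rw [h1]
    have h2 : Real.exp (-(ν * x)) ≤ 1 := Real.exp_le_one_iff.2 (by nlinarith)
    have h3 : Real.exp (-Real.exp x) ≤ Real.exp (-x) :=
      Real.exp_le_exp.2 (by linarith [Real.add_one_le_exp x])
    calc _ ≤ 1 * Real.exp (-x) := by gcongr
      _ = _ := one_mul _
  have hint : IntegrableOn (fun x : ℝ => -(Complex.exp (-(ν * (x + Real.pi * Complex.I))) *
      Complex.exp (Complex.exp (x + Real.pi * Complex.I)))) (Set.Ioi 0) := by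
    refine Integrable.mono' (integrableOn_exp_neg_Ioi 0)
      (by fun_prop : Continuous _).aestronglyMeasurable ?_
    filter_upwards [self_mem_ae_restrict measurableSet_Ioi] with x hx using hbound x (le_of_lt hx)
  have hlim := tendsto_limUnder_of_hasDerivAt_of_integrableOn_Ioi (fun x _ => hline x) hint
  set ℓ := limUnder atTop fun x : ℝ => M₀ (x + Real.pi * Complex.I)
  have hM : ∀ η, HasDerivAt (fun η => M₀ η - ℓ)
      (-(Complex.exp (-(ν * η)) * Complex.exp (Complex.exp η))) η := fun η => (hM₀' η).sub_const ℓ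
  set M : ℂ → ℂ := fun η => M₀ η - ℓ
  have hM0 : Tendsto (fun x : ℝ => M (x + Real.pi * Complex.I)) atTop (𝓝 0) := by
    have := hlim.sub_const ℓ
    rwa [sub_self] at this
  have h1 : ‖M (Real.pi * Complex.I)‖ ≤ 1 := by
    have h2 : ∀ X : ℝ, 0 ≤ X → ‖M (X + Real.pi * Complex.I) - M (Real.pi * Complex.I)‖ ≤ 1 := by
      intro X hX
      have h3 := image_norm_le_of_norm_deriv_right_le_deriv_boundary (a := 0) (b := X)
        (f := fun x : ℝ => M (x + Real.pi * Complex.I) - M (Real.pi * Complex.I))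
        (B := fun x => 1 - Real.exp (-x)) (B' := fun x => Real.exp (-x))
        (fun x _ => ((((hline x).sub_const ℓ).sub_const
          (M (Real.pi * Complex.I))).continuousAt).continuousWithinAt)
        (fun x _ => (((hline x).sub_const ℓ).sub_const (M (Real.pi * Complex.I))).hasDerivWithinAt)
        (by simp) (fun x => by simpa using ((hasDerivAt_neg x).exp.const_sub 1))
        (fun x hx => hbound x hx.1) (Set.right_mem_Icc.2 hX)
      exact h3.trans (by linarith [Real.exp_pos (-X)])
    have h4 := (hM0.sub_const (M (Real.pi * Complex.I))).norm
    rw [zero_sub, norm_neg] at h4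
    refine le_of_tendsto h4 ?_
    filter_upwards [eventually_ge_atTop 0] with X hX using h2 X hX
  -- The path runs once around the unit circle in t, where |t^{-ν}| = 1 and |e^t| ≤ e.
  have h2 : ‖M (-(Real.pi * Complex.I)) - M (Real.pi * Complex.I)‖ ≤ 2 * Real.pi * Real.exp 1 := by
    have h3 : ∀ t : ℝ, HasDerivAt (fun t : ℝ => M (t * Complex.I))
        (-(Complex.exp (-(ν * (t * Complex.I))) * Complex.exp (Complex.exp (t * Complex.I))) *
          Complex.I) t := by
      intro t
      have h1 : HasDerivAt (fun w : ℂ => w * Complex.I) Complex.I (t : ℂ) := by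
        simpa using (hasDerivAt_id (t : ℂ)).mul_const Complex.I
      exact (HasDerivAt.comp (t : ℂ) (hM (t * Complex.I)) h1).comp_ofReal
    have h4 := Convex.norm_image_sub_le_of_norm_hasDerivWithin_le
      (fun t (_ : t ∈ Set.univ) => (h3 t).hasDerivWithinAt) (C := Real.exp 1) (fun t _ => ?_)
      convex_univ (Set.mem_univ Real.pi) (Set.mem_univ (-Real.pi))
    · have e1 : ((-Real.pi : ℝ) : ℂ) * Complex.I = -(Real.pi * Complex.I) := by push_cast; ring
      rw [e1] at h4
      refine h4.trans (le_of_eq ?_)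
      have e2 : -Real.pi - Real.pi = -(2 * Real.pi) := by ring
      rw [e2, norm_neg, Real.norm_of_nonneg (by positivity)]
      ring
    · rw [norm_mul, norm_neg, norm_mul, Complex.norm_I, mul_one]
      have e1 : -((ν : ℂ) * (t * Complex.I)) = ((-(ν * t) : ℝ) : ℂ) * Complex.I := by
        push_cast; ring
      rw [e1, Complex.norm_exp_ofReal_mul_I, one_mul, Complex.norm_exp, Complex.exp_ofReal_mul_I_re]
      exact Real.exp_le_exp.2 (Real.cos_le_one t)
  -- The constant is evaluated at η = -πi, where it is at most 2 + 2πe < 20.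
  refine ⟨M, hM, hM0, Complex.exp (2 * Real.pi * Complex.I * ν) * M (Real.pi * Complex.I) -
    M (-(Real.pi * Complex.I)), ?_, fun η => ?_⟩
  · have e1 : ‖Complex.exp (2 * Real.pi * Complex.I * ν)‖ = 1 := by
      have : 2 * Real.pi * Complex.I * ν = ((2 * Real.pi * ν : ℝ) : ℂ) * Complex.I := by
        push_cast; ring
      rw [this, Complex.norm_exp_ofReal_mul_I]
    have e2 : ‖M (-(Real.pi * Complex.I))‖ ≤ 1 + 2 * Real.pi * Real.exp 1 := by
      have := norm_add_le (M (Real.pi * Complex.I))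
        (M (-(Real.pi * Complex.I)) - M (Real.pi * Complex.I))
      rw [add_sub_cancel] at this
      linarith
    have e3 := norm_sub_le (Complex.exp (2 * Real.pi * Complex.I * ν) * M (Real.pi * Complex.I))
      (M (-(Real.pi * Complex.I)))
    rw [norm_mul, e1, one_mul] at e3
    have e4 := Real.pi_lt_d2
    have e5 := Real.exp_one_lt_d9
    have e6 : Real.pi * Real.exp 1 ≤ 3.15 * 2.7182818286 := by gcongr
    norm_num at e6
    linarith
  · have h3 : ∀ η, HasDerivAt (fun η => Complex.exp (2 * Real.pi * Complex.I * ν) *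
        M (η + 2 * Real.pi * Complex.I) - M η) 0 η := by
      intro η
      have h4 := (((hM (η + 2 * Real.pi * Complex.I)).comp_add_const η
        (2 * Real.pi * Complex.I)).const_mul (Complex.exp (2 * Real.pi * Complex.I * ν))).sub (hM η)
      refine h4.congr_deriv ?_
      have e1 : Complex.exp (η + 2 * Real.pi * Complex.I) = Complex.exp η :=
        Complex.exp_periodic η
      have e2 : Complex.exp (2 * Real.pi * Complex.I * ν) *
          Complex.exp (-(ν * (η + 2 * Real.pi * Complex.I))) = Complex.exp (-(ν * η)) := by
        rw [← Complex.exp_add]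
        congr 1
        ring
      rw [e1]
      linear_combination (-Complex.exp (Complex.exp η)) * e2
    have h5 := is_const_of_deriv_eq_zero (fun η => (h3 η).differentiableAt)
      (fun η => (h3 η).deriv) η (-(Real.pi * Complex.I))
    refine h5.trans ?_
    congr 3
    ring

/-- The radial resolvent kernel between Gaussians, as an entire function on the logarithmic
cover. -/
theorem exists_modeKernel (hν : 0 ≤ ν) : ∃ F : ℝ → ℂ → ℂ, (∀ σ, Differentiable ℂ (F σ)) ∧
    (∀ (ζ : ℂ) (σ : ℝ), 0 < σ → HasDerivAt
      (fun σ : ℝ => Complex.exp (Complex.exp (2 * ζ) * σ) * F σ ζ)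
      (-(Complex.exp (Complex.exp (2 * ζ) * σ) * ((σ ^ (-(ν + 1)) : ℝ) : ℂ))) σ) ∧
    (∀ x : ℝ, Tendsto (fun σ : ℝ =>
      Complex.exp (Complex.exp (2 * (x + Real.pi / 2 * Complex.I)) * σ) *
        F σ (x + Real.pi / 2 * Complex.I)) atTop (𝓝 0)) ∧
    ∃ κ : ℂ, ‖κ‖ ≤ 20 ∧ ∀ σ ζ, F σ (ζ + Real.pi * Complex.I) - F σ ζ =
      κ * Complex.exp (2 * ν * ζ) * Complex.exp (-(Complex.exp (2 * ζ) * σ)) := by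
  obtain ⟨M, hM, hM0, κ, hκ, hκM⟩ := exists_incompleteGamma hν
  have hMd : Differentiable ℂ M := fun η => (hM η).differentiableAt
  have hF : ∀ (σ : ℝ) (ζ : ℂ), Complex.exp (Complex.exp (2 * ζ) * σ) *
      (Complex.exp (-(Complex.exp (2 * ζ) * σ)) * Complex.exp (2 * ν * ζ) *
        M (2 * ζ + Real.log σ)) = Complex.exp (2 * ν * ζ) * M (2 * ζ + Real.log σ) := by
    intro σ ζ
    rw [mul_assoc, ← mul_assoc, ← Complex.exp_add]
    simp
  -- F = e^{-zσ} z^ν M(log(zσ)) with z = e^{2ζ} and log(zσ) = 2ζ + log σ, from the substitution t ↦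
  -- zt in the resolvent integral. A half turn of λ fixes z and moves the argument of M by 2πi.
  refine ⟨fun σ ζ => Complex.exp (-(Complex.exp (2 * ζ) * σ)) * Complex.exp (2 * ν * ζ) *
    M (2 * ζ + Real.log σ), fun σ => by fun_prop, fun ζ σ hσ => ?_, fun x => ?_, κ, hκ,
    fun σ ζ => ?_⟩
  · simp only [hF]
    have h1 : HasDerivAt (fun σ : ℝ => 2 * ζ + (Real.log σ : ℂ)) ((σ⁻¹ : ℝ) : ℂ) σ :=
      ((Real.hasDerivAt_log hσ.ne').ofReal_comp).const_add _
    have h2 := ((hM (2 * ζ + Real.log σ)).comp σ h1).const_mul (Complex.exp (2 * ν * ζ))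
    refine h2.congr_deriv ?_
    have e1 : Complex.exp (2 * ζ + Real.log σ) = Complex.exp (2 * ζ) * σ := by
      rw [Complex.exp_add, ← Complex.ofReal_exp, Real.exp_log hσ]
    have e2 : Complex.exp (2 * ν * ζ) * Complex.exp (-(ν * (2 * ζ + Real.log σ))) =
        ((σ ^ (-ν) : ℝ) : ℂ) := by
      rw [Real.rpow_def_of_pos hσ, Complex.ofReal_exp, ← Complex.exp_add]
      congr 1
      push_cast
      ring
    have e3 : σ ^ (-(ν + 1)) = σ ^ (-ν) * σ⁻¹ := by
      rw [neg_add, Real.rpow_add hσ, Real.rpow_neg_one]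
    rw [e1, e3]
    push_cast
    linear_combination (-(Complex.exp (Complex.exp (2 * ζ) * σ)) * (σ : ℂ)⁻¹) * e2
  · simp only [hF]
    have h1 : Tendsto (fun σ : ℝ => 2 * x + Real.log σ) atTop atTop :=
      tendsto_atTop_add_const_left _ _ Real.tendsto_log_atTop
    have h2 := (hM0.comp h1).const_mul (Complex.exp (2 * ν * (x + Real.pi / 2 * Complex.I)))
    rw [mul_zero] at h2
    refine h2.congr fun σ => ?_
    simp only [Function.comp_apply]
    congr 2
    push_cast
    ring
  · have e1 : Complex.exp (2 * (ζ + Real.pi * Complex.I)) = Complex.exp (2 * ζ) := by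
      rw [mul_add, ← mul_assoc]
      exact Complex.exp_periodic _
    have e2 : Complex.exp (2 * ν * (ζ + Real.pi * Complex.I)) = Complex.exp (2 * ν * ζ) *
        Complex.exp (2 * Real.pi * Complex.I * ν) := by
      rw [← Complex.exp_add]
      congr 1
      ring
    have e3 : 2 * (ζ + Real.pi * Complex.I) + Real.log σ =
        (2 * ζ + Real.log σ) + 2 * Real.pi * Complex.I := by ring
    simp only [e1, e2, e3]
    rw [← hκM (2 * ζ + Real.log σ)]
    ring

end IncompleteGamma

/-! ### The resolvent on Gaussians -/

section GaussResolvent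

theorem isOpen_physical : IsOpen LogCover.physical :=
  (isOpen_lt continuous_const Complex.continuous_im).inter
    (isOpen_lt Complex.continuous_im continuous_const)

theorem convex_physical : Convex ℝ LogCover.physical :=
  (convex_halfSpace_im_gt 0).inter (convex_halfSpace_im_lt Real.pi)

theorem sq_ne_of_im_pos {lam : ℂ} (h : 0 < lam.im) (r : ℝ) (hr : 0 ≤ r) : lam ^ 2 ≠ r := by
  intro h0
  have h1 : lam ^ 2 = ((Real.sqrt r : ℝ) : ℂ) ^ 2 := by
    rw [h0, ← Complex.ofReal_pow, Real.sq_sqrt hr]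
  rcases sq_eq_sq_iff_eq_or_eq_neg.1 h1 with h2 | h2 <;> simp [h2] at h

theorem exp_im_pos {ζ : ℂ} (h : ζ ∈ LogCover.physical) : 0 < (Complex.exp ζ).im := by
  rw [Complex.exp_im]
  exact mul_pos (Real.exp_pos _) (Real.sin_pos_of_pos_of_lt_pi h.1 h.2)

theorem exp_two_mul_ne {ζ : ℂ} (h : ζ ∈ LogCover.physical) (r : ℝ) (hr : 0 ≤ r) :
    Complex.exp (2 * ζ) ≠ r := by
  rw [two_mul, Complex.exp_add, ← sq]
  exact sq_ne_of_im_pos (exp_im_pos h) r hr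

/-- The normalized Gaussian of angular momentum `k`, which solves the heat equation. -/
def heatVec (β : ℝ) (c : Plane) (f : Plane → ℝ) (k : ℤ) (τ : ℝ) : L2 :=
  ((τ ^ (-(order β k + 1)) : ℝ) : ℂ) • radialVec β c f k (gauss 0 (1 / (4 * τ)))

/-- The constant `π 4^{ν+1} Γ(ν+1)`. -/
def modeConst (β : ℝ) (k : ℤ) : ℝ :=
  Real.pi * 4 ^ (order β k + 1) * Real.Gamma (order β k + 1)

variable {β : ℝ} {c : Plane} {f : Plane → ℝ} {k l : ℤ}

/-- As 1/(4a) + 1/(4b) = (a+b)/(4ab), the normalizing powers of a and b cancel. That only a + b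
survives is the semigroup property of the heat flow. -/
theorem inner_heatVec (hf : Continuous f) {a b : ℝ} (ha : 0 < a) (hb : 0 < b) :
    ⟪heatVec β c f l b, heatVec β c f k a⟫_ℂ = if l = k then
      ((modeConst β k * (a + b) ^ (-(order β k + 1)) : ℝ) : ℂ) else 0 := by
  rw [heatVec, heatVec, inner_smul_left, inner_smul_right, inner_gauss hf (by positivity)
    (by positivity), Complex.conj_ofReal]
  split_ifs with h
  · subst h
    rw [← Complex.ofReal_mul, ← Complex.ofReal_mul]
    congr 1
    have e : 1 / (4 * b) + 1 / (4 * a) = (a + b) / (4 * (a * b)) := by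
      field_simp
    rw [e, Real.div_rpow (by positivity) (by positivity), Real.mul_rpow (by norm_num)
      (by positivity), Real.mul_rpow ha.le hb.le, modeConst, Real.rpow_neg (by norm_num : (0:ℝ) ≤ 4)]
    have e1 : 0 < a ^ (-(order β l + 1)) := Real.rpow_pos_of_pos ha _
    have e2 : 0 < b ^ (-(order β l + 1)) := Real.rpow_pos_of_pos hb _
    field_simp
  · simp

/-- With s = 1/(4τ) the prefactor contributes -(ν+1)/τ and the Gaussian ρ/(4τ²), together the
negative of 4s(ν+1) - 4s²ρ. -/
theorem hasDerivAt_heatVec (hf : ContDiff ℝ ∞ f) {τ : ℝ} (hτ : 0 < τ) :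
    ∃ h : heatVec β c f k τ ∈ (freeHamiltonian β c f hf).domain,
      HasDerivAt (heatVec β c f k) (-(freeHamiltonian β c f hf ⟨heatVec β c f k τ, h⟩)) τ := by
  have hs : 0 < 1 / (4 * τ) := by positivity
  obtain ⟨h1, h2⟩ := freeHamiltonian_gauss (β := β) (c := c) (k := k) hf hs
  refine ⟨Submodule.smul_mem _ _ h1, ?_⟩
  have h3 : freeHamiltonian β c f hf ⟨heatVec β c f k τ, Submodule.smul_mem _ _ h1⟩ =
      ((τ ^ (-(order β k + 1)) : ℝ) : ℂ) •
        freeHamiltonian β c f hf ⟨radialVec β c f k (gauss 0 (1 / (4 * τ))), h1⟩ :=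
    (freeHamiltonian β c f hf).map_smul ((τ ^ (-(order β k + 1)) : ℝ) : ℂ)
      ⟨radialVec β c f k (gauss 0 (1 / (4 * τ))), h1⟩
  rw [h3, h2]
  have h4 : HasDerivAt (fun τ : ℝ => 1 / (4 * τ)) (-(1 / (4 * τ ^ 2))) τ := by
    have := ((hasDerivAt_id τ).const_mul 4).inv (by simpa using hτ.ne')
    refine (this.congr_deriv ?_).congr_of_eventuallyEq (Eventually.of_forall fun y => by simp)
    simp only [id]
    field_simp
  have h5 := (hasDerivAt_radialVec_gauss (β := β) (c := c) (k := k) hf.continuous hs).scomp τ h4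
  have h6 := ((Real.hasDerivAt_rpow_const (x := τ) (p := -(order β k + 1))
    (Or.inl hτ.ne')).ofReal_comp).smul h5
  refine h6.congr_deriv ?_
  have e1 : τ ^ (-(order β k + 1) - 1) = τ ^ (-(order β k + 1)) / τ := by
    rw [Real.rpow_sub hτ, Real.rpow_one]
  rw [e1]
  simp only [Function.comp_apply]
  set u := radialVec β c f k (gauss 0 (1 / (4 * τ)))
  set v := radialVec β c f k (gauss 1 (1 / (4 * τ)))
  have e2 : (-(1 / (4 * τ ^ 2))) • -v = ((1 / (4 * τ ^ 2) : ℝ) : ℂ) • v := by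
    rw [smul_neg, neg_smul, neg_neg]
    rfl
  rw [e2, smul_sub, neg_sub, sub_eq_add_neg, smul_smul, smul_smul, smul_smul, ← neg_smul]
  congr 2
  · push_cast
    have : (τ : ℂ) ≠ 0 := by exact_mod_cast hτ.ne'
    field_simp
  · push_cast
    have : (τ : ℂ) ≠ 0 := by exact_mod_cast hτ.ne'
    field_simp

/-- Since R (P₀ - z) is the identity on the domain, the heat equation turns the derivative into
e^{zτ} R (z - P₀) h_τ. -/
theorem hasDerivAt_resolvent_heatVec (hf : ContDiff ℝ ∞ f) {z : ℂ} {R : L2 →L[ℂ] L2}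
    (hR : IsResolvent (freeHamiltonian β c f hf) z R) {τ : ℝ} (hτ : 0 < τ) :
    HasDerivAt (fun τ : ℝ => Complex.exp (z * τ) • R (heatVec β c f k τ))
      (-(Complex.exp (z * τ) • heatVec β c f k τ)) τ := by
  obtain ⟨h, hd⟩ := hasDerivAt_heatVec (β := β) (c := c) (k := k) hf hτ
  have h1 : HasDerivAt (fun τ : ℝ => Complex.exp (z * τ)) (Complex.exp (z * τ) * z) τ := by
    have := ((hasDerivAt_id (τ : ℂ)).const_mul z).cexp.comp_ofReal
    simpa using this
  have h2 : HasDerivAt (fun τ : ℝ => R (heatVec β c f k τ))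
      (R (-(freeHamiltonian β c f hf ⟨heatVec β c f k τ, h⟩))) τ :=
    (R.restrictScalars ℝ).hasFDerivAt.comp_hasDerivAt τ hd
  refine (h1.smul h2).congr_deriv ?_
  have h3 := hR.2 ⟨heatVec β c f k τ, h⟩
  rw [map_sub, map_smul, sub_eq_iff_eq_add] at h3
  rw [map_neg, h3]
  module

theorem norm_heatVec_le (hf : Continuous f) {τ : ℝ} (hτ : 1 ≤ τ) :
    ‖heatVec β c f k τ‖ ^ 2 ≤ modeConst β k := by
  have h0 : 0 < τ := by linarith
  have h1 := inner_heatVec (β := β) (c := c) (l := k) (k := k) hf h0 h0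
  rw [if_pos rfl, inner_self_eq_norm_sq_to_K] at h1
  have h2 : ‖heatVec β c f k τ‖ ^ 2 = modeConst β k * (τ + τ) ^ (-(order β k + 1)) :=
    Complex.ofReal_injective (Eq.trans (by push_cast; rfl) h1)
  have hν := order_nonneg β k
  have h3 : 0 < modeConst β k := by
    have := Real.Gamma_pos_of_pos (by linarith : 0 < order β k + 1)
    unfold modeConst
    positivity
  have h4 : (τ + τ) ^ (-(order β k + 1)) ≤ 1 :=
    Real.rpow_le_one_of_one_le_of_nonpos (by linarith) (by linarith)
  rw [h2]
  nlinarith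

variable {hf : ContDiff ℝ ∞ f} {G : L2 →L[ℂ] L2} {F : ℝ → ℂ → ℂ}

theorem eq_zero_of_hasDerivAt_zero {D : ℝ → ℂ} (hD : ∀ τ, 0 < τ → HasDerivAt D 0 τ)
    (hlim : Tendsto D atTop (𝓝 0)) {a : ℝ} (ha : 0 < a) : D a = 0 := by
  have h1 : ∀ τ, 0 < τ → D τ = D a := by
    intro τ hτ
    have := (convex_Ioi (0 : ℝ)).norm_image_sub_le_of_norm_hasDerivWithin_le (C := 0)
      (fun t ht => (hD t ht).hasDerivWithinAt) (fun t _ => by simp) (Set.mem_Ioi.2 ha)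
      (Set.mem_Ioi.2 hτ)
    rw [zero_mul] at this
    exact sub_eq_zero.1 (norm_le_zero_iff.1 this)
  refine tendsto_nhds_unique (tendsto_const_nhds.congr' ?_) hlim
  filter_upwards [eventually_gt_atTop 0] with τ hτ using (h1 τ hτ).symm

/-- On this line z = -e^{2x} is negative, so e^{zτ} forces both candidates to vanish as τ → ∞. They
have the same τ-derivative, hence agree. -/
theorem inner_resolvent_heatVec_line (hf : ContDiff ℝ ∞ f)
    (hF : ∀ (ζ : ℂ) (σ : ℝ), 0 < σ → HasDerivAt
      (fun σ : ℝ => Complex.exp (Complex.exp (2 * ζ) * σ) * F σ ζ)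
      (-(Complex.exp (Complex.exp (2 * ζ) * σ) * ((σ ^ (-(order β k + 1)) : ℝ) : ℂ))) σ)
    (hF0 : ∀ x : ℝ, Tendsto (fun σ : ℝ =>
      Complex.exp (Complex.exp (2 * (x + Real.pi / 2 * Complex.I)) * σ) *
        F σ (x + Real.pi / 2 * Complex.I)) atTop (𝓝 0))
    (x : ℝ) {R : L2 →L[ℂ] L2}
    (hR : IsResolvent (freeHamiltonian β c f hf)
      (Complex.exp (2 * (x + Real.pi / 2 * Complex.I))) R)
    {a b : ℝ} (ha : 0 < a) (hb : 0 < b) :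
    ⟪heatVec β c f l b, R (heatVec β c f k a)⟫_ℂ = if l = k then
      modeConst β k * F (a + b) (x + Real.pi / 2 * Complex.I) else 0 := by
  set ζ : ℂ := x + Real.pi / 2 * Complex.I
  set z := Complex.exp (2 * ζ) with hz
  have hzre : z = ((-Real.exp (2 * x) : ℝ) : ℂ) := by
    have : 2 * ζ = ((2 * x : ℝ) : ℂ) + Real.pi * Complex.I := by
      push_cast
      ring
    rw [hz, this, Complex.exp_add, Complex.exp_pi_mul_I]
    push_cast
    ring
  set y := heatVec β c f l b
  have h1 : ∀ τ : ℝ, 0 < τ → HasDerivAt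
      (fun τ : ℝ => Complex.exp (z * τ) * ⟪y, R (heatVec β c f k τ)⟫_ℂ)
      (-(Complex.exp (z * τ) * ⟪y, heatVec β c f k τ⟫_ℂ)) τ := by
    intro τ hτ
    have := ((innerSL ℂ y).restrictScalars ℝ).hasFDerivAt.comp_hasDerivAt τ
      (hasDerivAt_resolvent_heatVec (k := k) hf hR hτ)
    refine (this.congr_deriv ?_).congr_of_eventuallyEq (Eventually.of_forall fun t => ?_)
    · simp [inner_smul_right]
    · simp [inner_smul_right]
  have h2 : Tendsto (fun τ : ℝ => Complex.exp (z * τ) * ⟪y, R (heatVec β c f k τ)⟫_ℂ) atTop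
      (𝓝 0) := by
    have h3 : Tendsto (fun τ : ℝ => Complex.exp (z * τ)) atTop (𝓝 0) := by
      have h4 : Tendsto (fun τ : ℝ => Real.exp (-Real.exp (2 * x) * τ)) atTop (𝓝 0) := by
        refine Real.tendsto_exp_atBot.comp ?_
        exact tendsto_id.const_mul_atTop_of_neg (neg_lt_zero.2 (Real.exp_pos _))
      rw [tendsto_zero_iff_norm_tendsto_zero]
      refine h4.congr fun τ => ?_
      rw [hzre, ← Complex.ofReal_mul, ← Complex.ofReal_exp, Complex.norm_real,
        Real.norm_of_nonneg (Real.exp_pos _).le]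
    refine h3.zero_mul_isBoundedUnder_le ?_
    refine isBoundedUnder_of_eventually_le (a := ‖y‖ * (‖R‖ * √(modeConst β k))) ?_
    filter_upwards [eventually_ge_atTop 1] with τ hτ
    have h5 := Real.le_sqrt_of_sq_le (norm_heatVec_le (β := β) (c := c) (k := k) hf.continuous hτ)
    calc _ ≤ ‖y‖ * ‖R (heatVec β c f k τ)‖ := norm_inner_le_norm _ _
      _ ≤ ‖y‖ * (‖R‖ * ‖heatVec β c f k τ‖) := by gcongr; exact R.le_opNorm _
      _ ≤ _ := by gcongr
  have hs : ∀ τ, 0 < τ → HasDerivAt (fun τ : ℝ => Complex.exp (z * (τ + b : ℝ)) * F (τ + b) ζ)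
      (-(Complex.exp (z * (τ + b : ℝ)) * (((τ + b) ^ (-(order β k + 1)) : ℝ) : ℂ))) τ :=
    fun τ hτ => (hF ζ (τ + b) (by positivity)).comp_add_const τ b
  have hs0 : Tendsto (fun τ : ℝ => Complex.exp (z * (τ + b : ℝ)) * F (τ + b) ζ) atTop (𝓝 0) :=
    (hF0 x).comp (tendsto_atTop_add_const_right _ b tendsto_id)
  have he : ∀ τ : ℝ, Complex.exp (-(z * b)) * Complex.exp (z * (τ + b : ℝ)) =
      Complex.exp (z * τ) := by
    intro τ
    rw [← Complex.exp_add]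
    congr 1
    push_cast
    ring
  by_cases hlk : l = k
  · rw [if_pos hlk]
    have key := eq_zero_of_hasDerivAt_zero (D := fun τ : ℝ =>
      Complex.exp (z * τ) * ⟪y, R (heatVec β c f k τ)⟫_ℂ -
        modeConst β k * Complex.exp (-(z * b)) * (Complex.exp (z * (τ + b : ℝ)) * F (τ + b) ζ))
      (fun τ hτ => by
        refine ((h1 τ hτ).sub ((hs τ hτ).const_mul _)).congr_deriv ?_
        rw [inner_heatVec hf.continuous hτ hb, if_pos hlk]
        push_cast
        rw [← he τ]
        push_cast
        ring) (by simpa using h2.sub (hs0.const_mul _)) ha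
    rw [mul_assoc, ← mul_assoc (Complex.exp (-(z * b))), he] at key
    have h3 : Complex.exp (z * a) * (⟪y, R (heatVec β c f k a)⟫_ℂ -
        modeConst β k * F (a + b) ζ) = 0 := by linear_combination key
    exact sub_eq_zero.1 ((mul_eq_zero.1 h3).resolve_left (Complex.exp_ne_zero _))
  · rw [if_neg hlk]
    have key := eq_zero_of_hasDerivAt_zero (fun τ hτ => by
      refine (h1 τ hτ).congr_deriv ?_
      rw [inner_heatVec hf.continuous hτ hb, if_neg hlk]
      simp) h2 ha
    exact (mul_eq_zero.1 key).resolve_left (Complex.exp_ne_zero _)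

/-- The matrix elements of the resolvent between Gaussians. -/
theorem inner_resolvent_heatVec (hG : IsPosResolvent (freeHamiltonian β c f hf) G)
    (hFd : ∀ σ, Differentiable ℂ (F σ))
    (hF : ∀ (ζ : ℂ) (σ : ℝ), 0 < σ → HasDerivAt
      (fun σ : ℝ => Complex.exp (Complex.exp (2 * ζ) * σ) * F σ ζ)
      (-(Complex.exp (Complex.exp (2 * ζ) * σ) * ((σ ^ (-(order β k + 1)) : ℝ) : ℂ))) σ)
    (hF0 : ∀ x : ℝ, Tendsto (fun σ : ℝ =>
      Complex.exp (Complex.exp (2 * (x + Real.pi / 2 * Complex.I)) * σ) *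
        F σ (x + Real.pi / 2 * Complex.I)) atTop (𝓝 0))
    {a b : ℝ} (ha : 0 < a) (hb : 0 < b) {ζ : ℂ} (hζ : ζ ∈ LogCover.physical) :
    ⟪heatVec β c f l b, resolventOf G (Complex.exp (2 * ζ)) (heatVec β c f k a)⟫_ℂ =
      if l = k then modeConst β k * F (a + b) ζ else 0 := by
  have hd : DifferentiableOn ℂ (fun ζ : ℂ => ⟪heatVec β c f l b,
      resolventOf G (Complex.exp (2 * ζ)) (heatVec β c f k a)⟫_ℂ) LogCover.physical := by
    intro w hw
    refine DifferentiableAt.differentiableWithinAt ?_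
    have h1 : DifferentiableAt ℂ (fun ζ : ℂ => resolventOf G (Complex.exp (2 * ζ))) w :=
      DifferentiableAt.comp (g := resolventOf G) w
        (hG.differentiableAt_resolventOf (exp_two_mul_ne hw)) (by fun_prop)
    exact (innerSL ℂ (heatVec β c f l b)).differentiableAt.comp w
      (h1.clm_apply (differentiableAt_const _))
  have hd2 : Differentiable ℂ (fun ζ : ℂ => if l = k then modeConst β k * F (a + b) ζ else 0) := by
    split_ifs
    · exact (hFd _).const_mul _
    · exact differentiable_const _
  have hi : (Real.pi / 2 * Complex.I : ℂ) ∈ LogCover.physical := by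
    constructor <;> simp <;> linarith [Real.pi_pos]
  -- Identity theorem: the points 1/(n+1) + πi/2 of the line accumulate at πi/2.
  refine (hd.analyticOnNhd isOpen_physical).eqOn_of_preconnected_of_frequently_eq
    (hd2.differentiableOn.analyticOnNhd isOpen_physical) convex_physical.isPreconnected hi ?_ hζ
  have ht : Tendsto (fun n : ℕ => ((1 / (n + 1 : ℝ) : ℝ) : ℂ) + Real.pi / 2 * Complex.I) atTop
      (𝓝[≠] (Real.pi / 2 * Complex.I)) := by
    refine tendsto_nhdsWithin_iff.2 ⟨?_, Eventually.of_forall fun n => ?_⟩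
    · have := ((Complex.continuous_ofReal.tendsto 0).comp
        (tendsto_one_div_add_atTop_nhds_zero_nat (𝕜 := ℝ))).add_const
          (Real.pi / 2 * Complex.I : ℂ)
      simpa using this
    · have h0 : (1 / (n + 1 : ℝ)) ≠ 0 := by positivity
      intro h1
      have h2 : ((1 / (n + 1 : ℝ) : ℝ) : ℂ) = 0 := by simpa using h1
      exact h0 (by exact_mod_cast h2)
  refine ht.frequently (Frequently.of_forall fun n => ?_)
  have hp : ((1 / (n + 1 : ℝ) : ℝ) : ℂ) + Real.pi / 2 * Complex.I ∈ LogCover.physical := by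
    constructor <;> simp <;> linarith [Real.pi_pos]
  exact inner_resolvent_heatVec_line hf hF hF0 _
    (hG.isResolvent_resolventOf (exp_two_mul_ne hp)) ha hb

end GaussResolvent

/-! ### Density of the span of the Gaussians -/

section GaussDensity

variable {β : ℝ} {c : Plane} {f : Plane → ℝ} {k : ℤ}

theorem expDecay_exp_mul {g : ℝ → ℝ} (hg : Continuous g) :
    ExpDecay fun t => ((Real.exp (-t) * g (Real.exp (-t)) : ℝ) : ℂ) := by
  refine ⟨by fun_prop, ?_⟩
  obtain ⟨C, hC⟩ := isCompact_Icc.exists_bound_of_continuousOn (s := Set.Icc (0 : ℝ) 1)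
    hg.continuousOn
  refine ⟨C, 1, one_pos, fun t ht => ?_⟩
  rw [Complex.norm_real, norm_mul, Real.norm_of_nonneg (Real.exp_pos _).le, one_mul, mul_comm]
  gcongr
  exact hC _ ⟨(Real.exp_pos _).le, Real.exp_le_one_iff.2 (by linarith)⟩

variable {S : Submodule ℂ L2}

/-- Integer exponents s = n + 1 give e^{-t} (e^{-t})^n, that is, e^{-t} times all polynomials in
e^{-t}. -/
theorem radialVec_polynomial_mem (hf : Continuous f)
    (h : ∀ s, 0 < s → radialVec β c f k (gauss 0 s) ∈ S) (p : Polynomial ℝ) :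
    radialVec β c f k (fun t => ((Real.exp (-t) * p.eval (Real.exp (-t)) : ℝ) : ℂ)) ∈ S := by
  induction p using Polynomial.induction_on' with
  | add p q hp hq =>
    rw [radialVec_add hf (expDecay_exp_mul p.continuous) (expDecay_exp_mul q.continuous)
      (expDecay_exp_mul (p + q).continuous) (a := 1) (b := 1) fun t _ => by
        rw [Polynomial.eval_add]; push_cast; ring]
    exact add_mem (S.smul_mem _ hp) (S.smul_mem _ hq)
  | monomial n a =>
    have h1 : 0 < (n + 1 : ℝ) := by positivity
    rw [radialVec_add hf (expDecay_gauss 0 h1) (expDecay_gauss 0 h1)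
      (expDecay_exp_mul (Polynomial.monomial n a).continuous) (a := a) (b := 0) fun t _ => by
        rw [Polynomial.eval_monomial, gauss, ← Real.exp_nat_mul]
        have e : Real.exp (-((n + 1) * t)) = Real.exp (-t) * Real.exp (n * -t) := by
          rw [← Real.exp_add]
          congr 1
          ring
        rw [e]
        push_cast
        ring]
    exact add_mem (S.smul_mem _ (h _ h1)) (S.smul_mem _ (h _ h1))

/-- Weierstrass approximation in y = e^{-t} ∈ [0,1]. The spare factor e^{-t} converts uniform
convergence into L² convergence. -/
theorem radialVec_exp_mul_mem (hf : Continuous f) (hS : IsClosed (S : Set L2))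
    (h : ∀ s, 0 < s → radialVec β c f k (gauss 0 s) ∈ S) {g : ℝ → ℝ} (hg : Continuous g) :
    radialVec β c f k (fun t => ((Real.exp (-t) * g (Real.exp (-t)) : ℝ) : ℂ)) ∈ S := by
  rw [← SetLike.mem_coe, ← hS.closure_eq, Metric.mem_closure_iff]
  intro ε hε
  set N := ‖radialVec β c f k (gauss 0 1)‖ with hN
  obtain ⟨p, hp⟩ := exists_polynomial_near_of_continuousOn 0 1 g hg.continuousOn (ε / (N + 1))
    (by positivity)
  refine ⟨_, radialVec_polynomial_mem hf h p, ?_⟩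
  have h2 : Continuous fun y => g y - p.eval y := hg.sub p.continuous
  have h1 := radialVec_add (β := β) (c := c) (k := k) hf (expDecay_exp_mul hg)
    (expDecay_exp_mul p.continuous) (expDecay_exp_mul h2) (a := 1) (b := -1)
    fun t _ => by push_cast; ring
  have h3 := norm_radialVec_le (β := β) (c := c) (k := k) hf (expDecay_exp_mul h2)
    (expDecay_gauss 0 one_pos) (C := ε / (N + 1)) fun t ht => by
      rw [gauss, Complex.norm_real, Complex.norm_real, pow_zero, one_mul, one_mul, norm_mul,
        mul_comm]
      gcongr
      exact (abs_sub_comm _ _).trans_le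
        (hp _ ⟨(Real.exp_pos _).le, Real.exp_le_one_iff.2 (by linarith)⟩).le
  rw [one_smul, neg_one_smul, ← sub_eq_add_neg] at h1
  rw [dist_eq_norm, ← h1]
  refine h3.trans_lt ?_
  rw [← hN, div_mul_eq_mul_div, div_lt_iff₀ (by positivity)]
  nlinarith

theorem expDecay_of_compact {G : ℝ → ℝ} (hG : Continuous G) {b : ℝ}
    (h2 : ∀ t, b ≤ t → G t = 0) : ExpDecay fun t => (G t : ℂ) := by
  refine ⟨by fun_prop, ?_⟩
  obtain ⟨C, hC⟩ := isCompact_Icc.exists_bound_of_continuousOn (s := Set.Icc (0 : ℝ) b)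
    hG.continuousOn
  refine ⟨|C| * Real.exp b, 1, one_pos, fun t ht => ?_⟩
  rw [Complex.norm_real]
  by_cases h : b ≤ t
  · rw [h2 t h, norm_zero]
    positivity
  · refine (hC t ⟨ht, by linarith⟩).trans ?_
    rw [mul_assoc, ← Real.exp_add]
    exact (le_abs_self C).trans (le_mul_of_one_le_right (abs_nonneg _)
      (Real.one_le_exp (by linarith)))

/-- Put g(y) = G(-log y)/y, so that e^{-t} g(e^{-t}) = G(t). As G vanishes for large t, g vanishes
near y = 0 and is continuous. -/
theorem radialVec_compact_mem (hf : Continuous f) (hS : IsClosed (S : Set L2))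
    (h : ∀ s, 0 < s → radialVec β c f k (gauss 0 s) ∈ S) {G : ℝ → ℝ} (hG : Continuous G)
    {b : ℝ} (h2 : ∀ t, b ≤ t → G t = 0) : radialVec β c f k (fun t => (G t : ℂ)) ∈ S := by
  have hg : Continuous fun y : ℝ => G (-Real.log y) / y := by
    refine continuous_iff_continuousAt.2 fun y => ?_
    by_cases hy : y = 0
    · rw [hy]
      have h3 : (fun y : ℝ => G (-Real.log y) / y) =ᶠ[𝓝 0] fun _ => 0 := by
        have h4 : ∀ᶠ y in 𝓝 (0 : ℝ), |y| < Real.exp (-b) := by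
          refine continuous_abs.continuousAt.eventually_lt_const ?_
          rw [abs_zero]
          positivity
        filter_upwards [h4] with y hy
        by_cases hy0 : y = 0
        · simp [hy0]
        · have h5 := Real.log_lt_log (abs_pos.2 hy0) hy
          rw [Real.log_exp, Real.log_abs] at h5
          rw [h2 _ (by linarith), zero_div]
      exact continuousAt_const.congr h3.symm
    · exact (hG.continuousAt.comp (Real.continuousAt_log hy).neg).div continuousAt_id hy
  have h3 := radialVec_exp_mul_mem hf hS h hg
  convert h3 using 3 with t
  rw [Real.log_exp, neg_neg, mul_div_cancel₀ _ (Real.exp_pos _).ne']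

theorem pow_mul_conj_pow (p q : ℕ) (z : ℂ) : z ^ p * starRingEnd ℂ z ^ q =
    harmonicPoly ((p : ℤ) - q) z * ((Complex.normSq z ^ min p q : ℝ) : ℂ) := by
  rw [Complex.ofReal_pow, ← Complex.mul_conj, harmonicPoly]
  split_ifs with h
  · obtain ⟨d, rfl⟩ := Nat.exists_eq_add_of_le (by omega : q ≤ p)
    have : (((q + d : ℕ) : ℤ) - q).toNat = d := by omega
    rw [this, min_eq_right (by omega), mul_pow]
    ring
  · obtain ⟨d, rfl⟩ := Nat.exists_eq_add_of_le (by omega : p ≤ q)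
    have : (-((p : ℤ) - ((p + d : ℕ) : ℤ))).toNat = d := by omega
    rw [this, min_eq_left (by omega), mul_pow]
    ring

theorem integral_monomial_eq_zero (hf : Continuous f) (hS : IsClosed (S : Set L2))
    (h : ∀ k s, 0 < s → radialVec β c f k (gauss 0 s) ∈ S) {u : L2} (hu : u ∈ Sᗮ) {η : ℝ → ℝ}
    (hη : Continuous η) {a b : ℝ} (ha : 0 < a) (h1 : ∀ t, t ≤ a → η t = 0)
    (h2 : ∀ t, b ≤ t → η t = 0) (p q : ℕ) :
    ∫ x, (Complex.exp (-(Complex.I * f x)) * starRingEnd ℂ (u x) * η (rho c x)) *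
      (cx c x ^ p * starRingEnd ℂ (cx c x) ^ q) = 0 := by
  set k : ℤ := (p : ℤ) - q
  set e : ℝ := (order β k - |(k : ℝ)|) / 2
  -- The profile undoes the fractional power in `angular` and supplies the radial part of the
  -- monomial. Replacing t by max(t, a) keeps it continuous, and is harmless because η vanishes for
  -- t ≤ a.
  have hG : Continuous fun t : ℝ => η t * (max t a ^ (-e) * t ^ min p q) := by
    refine hη.mul (Continuous.mul ?_ (by fun_prop))
    exact (continuous_id.max continuous_const).rpow_const fun t =>
      Or.inl (lt_of_lt_of_le ha (le_max_right _ _)).ne'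
  have h2' : ∀ t, b ≤ t → η t * (max t a ^ (-e) * t ^ min p q) = 0 := fun t ht => by
    rw [h2 t ht, zero_mul]
  have h3 := hu _ (radialVec_compact_mem hf hS (h k) hG h2')
  rw [← inner_conj_symm, map_eq_zero, inner_eq_integral] at h3
  rw [← h3]
  refine integral_congr_ae ?_
  filter_upwards [coeFn_radialVec (β := β) (c := c) (k := k) hf (expDecay_of_compact hG h2'),
    ae_ne c] with x h4 hx
  have hρ := rho_pos hx
  rw [h4, radialFun, angular, pow_mul_conj_pow, normSq_cx]
  by_cases hxa : rho c x ≤ a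
  · rw [h1 _ hxa]
    simp
  · rw [max_eq_left (not_le.1 hxa).le]
    have h5 : rho c x ^ e * rho c x ^ (-e) = 1 := by
      rw [← Real.rpow_add hρ]
      simp
    have h6 : ((rho c x ^ e : ℝ) : ℂ) * ((rho c x ^ (-e) : ℝ) : ℂ) = 1 := by
      rw [← Complex.ofReal_mul, h5, Complex.ofReal_one]
    simp only [Complex.ofReal_mul]
    linear_combination (-Complex.exp (-(Complex.I * f x)) * starRingEnd ℂ (u x) * η (rho c x) *
      harmonicPoly k (cx c x) * ((rho c x ^ min p q : ℝ) : ℂ)) * h6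

/-- An integrable function on a disc whose moments vanish is orthogonal to all continuous
functions. -/
theorem integral_mul_comp_cx_eq_zero {W : Plane → ℂ} (hW : Integrable W) {r : ℝ}
    (hr : ∀ x, W x ≠ 0 → cx c x ∈ Metric.closedBall (0 : ℂ) r)
    (h : ∀ p q : ℕ, ∫ x, W x * (cx c x ^ p * starRingEnd ℂ (cx c x) ^ q) = 0)
    {Φ : ℂ → ℂ} (hΦ : Continuous Φ) : ∫ x, W x * Φ (cx c x) = 0 := by
  have hcc : Continuous (cx c) := (contDiff_cx c).continuous
  set K : Set ℂ := Metric.closedBall (0 : ℂ) r with hK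
  have hKc : IsCompact K := isCompact_closedBall _ _
  have : CompactSpace K := isCompact_iff_compactSpace.1 hKc
  have hint : ∀ {g : ℂ → ℂ}, Continuous g → Integrable fun x => W x * g (cx c x) := by
    intro g hg
    obtain ⟨C, hC⟩ := hKc.exists_bound_of_continuousOn hg.continuousOn
    refine (hW.norm.const_mul C).mono' (hW.1.mul (hg.comp hcc).aestronglyMeasurable)
      (Eventually.of_forall fun x => ?_)
    rw [norm_mul]
    by_cases hx : W x = 0
    · simp [hx]
    · rw [mul_comm]
      gcongr
      exact hC _ (hr x hx)
  -- The star algebra generated by z is spanned by the monomials z^p z̄^q, and it is dense in the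
  -- continuous functions on the disc by Stone–Weierstrass.
  have hz : ∀ P ∈ StarAlgebra.adjoin ℂ {ContinuousMap.restrict K (ContinuousMap.id ℂ)},
      ∃ g : ℂ → ℂ, Continuous g ∧ (∀ z : K, P z = g z) ∧ ∫ x, W x * g (cx c x) = 0 := by
    intro P hP
    have hP' : P ∈ Subalgebra.toSubmodule (StarAlgebra.adjoin ℂ
        {ContinuousMap.restrict K (ContinuousMap.id ℂ)}).toSubalgebra := hP
    rw [StarAlgebra.adjoin_eq_span] at hP'
    clear hP
    induction hP' using Submodule.span_induction with
    | mem P hP =>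
      have : ∃ p q : ℕ, ∀ z : K, P z = (z : ℂ) ^ p * starRingEnd ℂ (z : ℂ) ^ q := by
        induction hP using Submonoid.closure_induction with
        | mem P hP =>
          rcases hP with hP | hP
          · rw [Set.mem_singleton_iff] at hP
            exact ⟨1, 0, fun z => by simp [hP]⟩
          · have hP2 : star P = ContinuousMap.restrict K (ContinuousMap.id ℂ) := by simpa using hP
            refine ⟨0, 1, fun z => ?_⟩
            have h3 : P = star (ContinuousMap.restrict K (ContinuousMap.id ℂ)) := by
              rw [← hP2, star_star]
            simp [h3]
        | one => exact ⟨0, 0, fun z => by simp⟩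
        | mul P Q _ _ hP hQ =>
          obtain ⟨p, q, h1⟩ := hP
          obtain ⟨p', q', h2⟩ := hQ
          refine ⟨p + p', q + q', fun z => ?_⟩
          rw [ContinuousMap.mul_apply, h1, h2]
          ring
      obtain ⟨p, q, hpq⟩ := this
      exact ⟨fun z => z ^ p * starRingEnd ℂ z ^ q, by fun_prop, hpq, h p q⟩
    | zero => exact ⟨fun _ => 0, continuous_const, fun z => rfl, by simp⟩
    | add P Q hP hQ h1 h2 =>
      obtain ⟨g, g1, g2, g3⟩ := h1
      obtain ⟨g', g1', g2', g3'⟩ := h2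
      refine ⟨fun z => g z + g' z, g1.add g1', fun z => by
        rw [ContinuousMap.add_apply, g2, g2'], ?_⟩
      simp only [mul_add]
      rw [integral_add (hint g1) (hint g1'), g3, g3', add_zero]
    | smul a P hP h1 =>
      obtain ⟨g, g1, g2, g3⟩ := h1
      refine ⟨fun z => a * g z, g1.const_mul a, fun z => by
        rw [ContinuousMap.smul_apply, g2, smul_eq_mul], ?_⟩
      simp only [mul_left_comm (W _) a]
      rw [integral_const_mul, g3, mul_zero]
  set N := ∫ x, ‖W x‖ with hN
  have hN0 : 0 ≤ N := integral_nonneg fun x => norm_nonneg _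
  refine norm_le_zero_iff.1 (le_of_forall_pos_le_add fun ε hε => ?_)
  rw [zero_add]
  have h4 : ContinuousMap.restrict K ⟨Φ, hΦ⟩ ∈
      StarAlgebra.elemental ℂ (ContinuousMap.restrict K (ContinuousMap.id ℂ)) := by
    rw [ContinuousMap.elemental_id_eq_top]
    trivial
  have h5 : ContinuousMap.restrict K ⟨Φ, hΦ⟩ ∈ closure ((StarAlgebra.adjoin ℂ
    {ContinuousMap.restrict K (ContinuousMap.id ℂ)} : StarSubalgebra ℂ C(K, ℂ)) :
      Set C(K, ℂ)) := h4
  obtain ⟨P, hP, hPd⟩ := Metric.mem_closure_iff.1 h5 (ε / (N + 1)) (by positivity)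
  obtain ⟨g, g1, g2, g3⟩ := hz P hP
  have h6 : ∫ x, W x * Φ (cx c x) = ∫ x, W x * (Φ (cx c x) - g (cx c x)) := by
    simp only [mul_sub]
    rw [integral_sub (hint hΦ) (hint g1), g3, sub_zero]
  rw [h6]
  calc _ ≤ ∫ x, ‖W x‖ * (ε / (N + 1)) := by
        refine norm_integral_le_of_norm_le (hW.norm.mul_const _) (Eventually.of_forall fun x => ?_)
        rw [norm_mul]
        by_cases hx : W x = 0
        · simp [hx]
        · gcongr
          have h7 := (ContinuousMap.dist_apply_le_dist (⟨cx c x, hr x hx⟩ : K)).trans hPd.le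
          rw [dist_eq_norm, g2] at h7
          exact h7
    _ = N * (ε / (N + 1)) := by rw [integral_mul_const]
    _ ≤ ε := by
        rw [mul_div_assoc', div_le_iff₀ (by positivity)]
        nlinarith

end GaussDensity

/-! ### Completeness of the Gaussian system. -/

section GaussDense

variable {β : ℝ} {c : Plane} {f : Plane → ℝ}

theorem continuous_indicator_bump {a b : ℝ} (ha : 0 < a) (hab : a < b) :
    ∃ η : ℝ → ℝ, Continuous η ∧ (∀ t, t ≤ a / 2 → η t = 0) ∧ (∀ t, b + a ≤ t → η t = 0) ∧
      ∀ t, a ≤ t → t ≤ b → η t = 1 := by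
  let B : ContDiffBump ((a + b) / 2) := ⟨(b - a) / 2, b / 2, by linarith, by linarith⟩
  refine ⟨B, B.continuous, fun t ht => ?_, fun t ht => ?_, fun t h1 h2 => ?_⟩
  · refine B.zero_of_le_dist ?_
    rw [Real.dist_eq, abs_sub_comm]
    exact le_trans (by change b / 2 ≤ _; linarith) (le_abs_self _)
  · refine B.zero_of_le_dist ?_
    rw [Real.dist_eq]
    exact le_trans (by change b / 2 ≤ _; linarith) (le_abs_self _)
  · refine B.one_of_mem_closedBall ?_
    rw [Metric.mem_closedBall, Real.dist_eq, abs_le]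
    change -((b - a) / 2) ≤ _ ∧ _ ≤ (b - a) / 2
    constructor <;> linarith

/-- The Gaussians of all angular momenta span a dense subspace of `L²(ℝ²)`. -/
theorem eq_top_of_gauss_mem (hf : Continuous f) {S : Submodule ℂ L2} (hS : IsClosed (S : Set L2))
    (h : ∀ k s, 0 < s → radialVec β c f k (gauss 0 s) ∈ S) : S = ⊤ := by
  rw [← hS.submodule_topologicalClosure_eq, Submodule.topologicalClosure_eq_top_iff,
    Submodule.eq_bot_iff]
  intro u hu
  set w : Plane → ℂ := fun x => Complex.exp (-(Complex.I * f x)) * starRingEnd ℂ (u x) with hw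
  have hwm : MemLp w 2 (volume : Measure Plane) := by
    refine (Lp.memLp u).of_le ((by fun_prop : Continuous fun x =>
      Complex.exp (-(Complex.I * f x))).aestronglyMeasurable.mul
      (Complex.continuous_conj.comp_aestronglyMeasurable (Lp.aestronglyMeasurable u))) ?_
    exact Eventually.of_forall fun x => by
      rw [hw, norm_mul, norm_phase_neg, one_mul, RCLike.norm_conj]
  have hwl : LocallyIntegrable w := hwm.locallyIntegrable (by norm_num)
  -- A smooth g supported off c lives in an annulus. A radial cutoff η equal to 1 there turns
  -- orthogonality to all angular momenta into vanishing moments of an integrable function on a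
  -- disc.
  have key : ∀ᵐ x, x ∈ ({c}ᶜ : Set Plane) → w x = 0 := by
    refine isOpen_compl_singleton.ae_eq_zero_of_integral_contDiff_smul_eq_zero
      (hwl.locallyIntegrableOn _) fun g hg hgc hgs => ?_
    obtain ⟨a, b, ha, hab, hgab⟩ : ∃ a b : ℝ, 0 < a ∧ a < b ∧
        ∀ x ∈ tsupport g, a ≤ rho c x ∧ rho c x ≤ b := by
      have hc : ContinuousOn (rho c) (tsupport g) := (contDiff_rho c).continuous.continuousOn
      rcases (tsupport g).eq_empty_or_nonempty with h0 | h0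
      · exact ⟨1, 2, by norm_num, by norm_num, by simp [h0]⟩
      · obtain ⟨y, hy, hy'⟩ := IsCompact.exists_isMinOn (hgc : IsCompact (tsupport g)) h0 hc
        obtain ⟨z, hz, hz'⟩ := IsCompact.exists_isMaxOn (hgc : IsCompact (tsupport g)) h0 hc
        have h1 : rho c y ≤ rho c z := hy' hz
        exact ⟨rho c y, rho c z + 1, rho_pos (hgs hy), by linarith, fun x hx =>
          ⟨hy' hx, (show rho c x ≤ rho c z from hz' hx).trans (by linarith)⟩⟩
    obtain ⟨η, η1, η2, η3, η4⟩ := continuous_indicator_bump ha hab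
    have hcomp : ∀ x, w x * η (rho c x) ≠ 0 →
        cx c x ∈ Metric.closedBall (0 : ℂ) (√(b + a)) := by
      intro x hx
      rw [mem_closedBall_zero_iff]
      refine Real.le_sqrt_of_sq_le ?_
      rw [norm_cx_sq]
      by_contra h0
      exact hx (by rw [η3 _ (not_le.1 h0).le]; simp)
    have hWi : Integrable fun x => w x * η (rho c x) := by
      have hcs : HasCompactSupport fun x => η (rho c x) := by
        refine HasCompactSupport.of_support_subset_isCompact
          (isCompact_closedBall c (√(b + a))) fun x hx => ?_
        rw [Metric.mem_closedBall, EuclideanSpace.dist_eq, Fin.sum_univ_two, Real.dist_eq,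
          Real.dist_eq, sq_abs, sq_abs]
        refine Real.sqrt_le_sqrt ?_
        by_contra h0
        exact hx (η3 _ (not_le.1 h0).le)
      have h1 := hwl.integrable_smul_left_of_hasCompactSupport
        (η1.comp (contDiff_rho c).continuous) hcs
      refine h1.congr (Eventually.of_forall fun x => ?_)
      simp [mul_comm]
    set e := Complex.orthonormalBasisOneI.repr
    have hΦ : Continuous fun z : ℂ => (g (e z + c) : ℂ) :=
      Complex.continuous_ofReal.comp (hg.continuous.comp (e.continuous.add continuous_const))
    have h1 := integral_mul_comp_cx_eq_zero (c := c) hWi hcomp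
      (integral_monomial_eq_zero hf hS h hu η1 (half_pos ha) η2 η3) hΦ
    rw [← h1]
    congr 1
    funext x
    have h2 : e (cx c x) + c = x := by
      rw [cx_eq, LinearIsometryEquiv.apply_symm_apply, sub_add_cancel]
    rw [h2, Complex.real_smul]
    by_cases hx : x ∈ tsupport g
    · rw [η4 _ (hgab x hx).1 (hgab x hx).2]
      push_cast
      ring
    · rw [image_eq_zero_of_notMem_tsupport hx]
      simp
  refine (Lp.eq_zero_iff_ae_eq_zero).2 ?_
  filter_upwards [key, ae_ne c] with x hx hxc
  have h1 := hx hxc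
  rw [hw, mul_eq_zero, map_eq_zero] at h1
  exact h1.resolve_left (Complex.exp_ne_zero _)

end GaussDense

/-! ### Regular radial solutions -/

section Bessel

/-- The coefficients of the Bessel series. -/
def besselCoeff (ν : ℝ) (m : ℕ) : ℝ :=
  Real.Gamma (ν + 1) / (m.factorial * Real.Gamma (ν + m + 1))

/-- The series `∑ (-t/4)^m / (m! (ν+1)_m)`. -/
def besselSeries (ν : ℝ) (t : ℂ) : ℂ := ∑' m : ℕ, (besselCoeff ν m : ℂ) * (-t / 4) ^ m

variable {ν : ℝ}

theorem Gamma_pos_of_order (hν : 0 ≤ ν) (m : ℕ) : 0 < Real.Gamma (ν + m + 1) :=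
  Real.Gamma_pos_of_pos (by positivity)

theorem Gamma_le_Gamma_add (hν : 0 ≤ ν) (m : ℕ) : Real.Gamma (ν + 1) ≤ Real.Gamma (ν + m + 1) := by
  induction m with
  | zero => simp
  | succ m ih =>
    have h1 : 0 < ν + m + 1 := by positivity
    have h2 : ν + ((m + 1 : ℕ) : ℝ) + 1 = (ν + m + 1) + 1 := by push_cast; ring
    rw [h2, Real.Gamma_add_one h1.ne']
    have h3 := Gamma_pos_of_order hν m
    have h4 : (0 : ℝ) ≤ m := by positivity
    nlinarith

theorem besselCoeff_nonneg (hν : 0 ≤ ν) (m : ℕ) : 0 ≤ besselCoeff ν m := by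
  have h1 := Gamma_pos_of_order hν m
  have h2 := Real.Gamma_pos_of_pos (by linarith : 0 < ν + 1)
  unfold besselCoeff
  positivity

theorem besselCoeff_le (hν : 0 ≤ ν) (m : ℕ) : besselCoeff ν m ≤ 1 / m.factorial := by
  have h1 := Gamma_pos_of_order hν m
  have h3 := Gamma_le_Gamma_add hν m
  have h4 : (0 : ℝ) < m.factorial := by positivity
  rw [besselCoeff, div_le_div_iff₀ (by positivity) h4]
  nlinarith

theorem hasSum_pow_div_factorial (x : ℝ) :
    HasSum (fun m : ℕ => x ^ m / m.factorial) (Real.exp x) := by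
  rw [Real.exp_eq_exp_ℝ]
  exact NormedSpace.expSeries_div_hasSum_exp x

theorem norm_besselTerm_le (hν : 0 ≤ ν) (t : ℂ) (m : ℕ) :
    ‖(besselCoeff ν m : ℂ) * (-t / 4) ^ m‖ ≤ (‖t‖ / 4) ^ m / m.factorial := by
  rw [norm_mul, norm_pow, norm_div, norm_neg, Complex.norm_real,
    Real.norm_of_nonneg (besselCoeff_nonneg hν m)]
  have h1 : ‖(4 : ℂ)‖ = 4 := by norm_num
  rw [h1]
  calc _ ≤ 1 / (m.factorial : ℝ) * (‖t‖ / 4) ^ m := by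
        gcongr
        exact besselCoeff_le hν m
    _ = _ := by ring

/-- Comparison with the exponential series. The bound does not depend on ν, as is needed for summing
over angular momenta. -/
theorem norm_besselSeries_le (hν : 0 ≤ ν) (t : ℂ) : ‖besselSeries ν t‖ ≤ Real.exp (‖t‖ / 4) :=
  tsum_of_norm_bounded (hasSum_pow_div_factorial _) (norm_besselTerm_le hν t)

theorem continuous_besselSeries (hν : 0 ≤ ν) : Continuous (besselSeries ν) := by
  refine continuous_iff_continuousAt.2 fun t => ?_
  have h1 : ContinuousOn (besselSeries ν) (Metric.closedBall (0 : ℂ) (‖t‖ + 1)) := by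
    refine continuousOn_tsum (u := fun m : ℕ => ((‖t‖ + 1) / 4) ^ m / m.factorial)
      (fun m => Continuous.continuousOn (by fun_prop)) (hasSum_pow_div_factorial _).summable fun m x hx => ?_
    refine (norm_besselTerm_le hν x m).trans ?_
    have := mem_closedBall_zero_iff.1 hx
    gcongr
  refine h1.continuousAt (mem_of_superset (Metric.ball_mem_nhds t one_pos) fun x hx => ?_)
  rw [mem_closedBall_zero_iff]
  have h2 := norm_add_le t (x - t)
  rw [add_sub_cancel] at h2
  have h3 : ‖x - t‖ < 1 := by rwa [← dist_eq_norm]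
  linarith

theorem conj_besselSeries (t : ℂ) :
    starRingEnd ℂ (besselSeries ν t) = besselSeries ν (starRingEnd ℂ t) := by
  rw [besselSeries, besselSeries, Complex.conj_tsum]
  congr 1
  funext m
  have h4 : starRingEnd ℂ 4 = 4 := map_ofNat _ 4
  rw [map_mul, map_pow, map_div₀, map_neg, Complex.conj_ofReal, h4]

/-- The product of a Gaussian weight and a Bessel series. -/
def besselGauss (ν δ : ℝ) (w : ℂ) (t : ℝ) : ℂ := (Real.exp (-(δ * t)) : ℂ) * besselSeries ν (w * t)

theorem norm_besselGauss_le (hν : 0 ≤ ν) (δ : ℝ) (w : ℂ) {t : ℝ} (ht : 0 ≤ t) :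
    ‖besselGauss ν δ w t‖ ≤ Real.exp (-((δ - ‖w‖ / 4) * t)) := by
  rw [besselGauss, norm_mul, Complex.norm_real, Real.norm_of_nonneg (Real.exp_pos _).le]
  have h1 := norm_besselSeries_le hν (w * t)
  rw [norm_mul, Complex.norm_real, Real.norm_of_nonneg ht] at h1
  calc _ ≤ Real.exp (-(δ * t)) * Real.exp (‖w‖ * t / 4) := by gcongr
    _ = _ := by
      rw [← Real.exp_add]
      congr 1
      ring

theorem expDecay_besselGauss (hν : 0 ≤ ν) {δ : ℝ} {w : ℂ} (hw : ‖w‖ < 4 * δ) :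
    ExpDecay (besselGauss ν δ w) := by
  refine ⟨?_, 1, δ - ‖w‖ / 4, by linarith, fun t ht => ?_⟩
  · unfold besselGauss
    exact (by fun_prop : Continuous fun t : ℝ => (Real.exp (-(δ * t)) : ℂ)).mul
      ((continuous_besselSeries hν).comp (by fun_prop))
  · rw [one_mul]
    exact norm_besselGauss_le hν δ w ht

variable {β : ℝ} {c : Plane} {f : Plane → ℝ} {k l : ℤ} {δ : ℝ} {w : ℂ}

/-- The normalized Gaussian divided by the weight `e^{-δ r²}`. -/
def weightedVec (β : ℝ) (c : Plane) (f : Plane → ℝ) (δ : ℝ) (k : ℤ) (a : ℝ) : L2 :=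
  ((a ^ (-(order β k + 1)) : ℝ) : ℂ) • radialVec β c f k (gauss 0 (1 / (4 * a) - δ))

/-- The weighted regular radial solution of `(P₀ - w̄) u = 0`. -/
def regularVec (β : ℝ) (c : Plane) (f : Plane → ℝ) (δ : ℝ) (k : ℤ) (w : ℂ) : L2 :=
  radialVec β c f k (besselGauss (order β k) δ (starRingEnd ℂ w))

theorem norm_regularVec_sq_le (hf : Continuous f) (hδ : 0 < δ) (hw : ‖w‖ ≤ δ) :
    ‖regularVec β c f δ k w‖ ^ 2 ≤
      Real.pi * (3 / 2 * δ) ^ (-(order β k + 1)) * Real.Gamma (order β k + 1) := by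
  have hν := order_nonneg β k
  have hw' : ‖starRingEnd ℂ w‖ ≤ δ := by rwa [RCLike.norm_conj]
  have hE := expDecay_besselGauss (δ := δ) hν (w := starRingEnd ℂ w) (by linarith)
  rw [norm_sq_eq_integral, ← integral_rho_rpow_mul_exp c (by linarith) (by positivity)]
  refine integral_mono_of_nonneg (Eventually.of_forall fun x => by positivity)
    (integrable_rho_rpow_mul_exp c (by linarith) (by positivity)) ?_
  filter_upwards [coeFn_radialVec (β := β) (c := c) (k := k) hf hE, ae_ne c] with x h1 hx
  have h2 : (regularVec β c f δ k w : Plane → ℂ) x = _ := h1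
  have hρ := rho_pos hx
  rw [h2, norm_radialFun_sq hx]
  have h3 := norm_besselGauss_le hν δ (starRingEnd ℂ w) hρ.le
  have h4 : ‖besselGauss (order β k) δ (starRingEnd ℂ w) (rho c x)‖ ^ 2 ≤
      Real.exp (-((δ - ‖starRingEnd ℂ w‖ / 4) * rho c x)) ^ 2 := by gcongr
  rw [← Real.exp_nat_mul] at h4
  -- From ‖w‖ ≤ δ one gets 2(δ - ‖w‖/4) ≥ 3δ/2.
  have h5 : Real.exp ((2 : ℕ) * -((δ - ‖starRingEnd ℂ w‖ / 4) * rho c x)) ≤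
      Real.exp (-(3 / 2 * δ * rho c x)) := by
    refine Real.exp_le_exp.2 ?_
    push_cast
    nlinarith
  exact mul_le_mul_of_nonneg_left (h4.trans h5) (by positivity)

theorem besselCoeff_mul_integral (hν : 0 ≤ ν) {a : ℝ} (ha : 0 < a) (m : ℕ) :
    besselCoeff ν m * (Real.pi * (1 / (4 * a)) ^ (-(ν + m + 1)) * Real.Gamma (ν + m + 1)) =
      Real.pi * Real.Gamma (ν + 1) * (4 * a) ^ (ν + 1) * ((4 * a) ^ m / m.factorial) := by
  have h1 := Gamma_pos_of_order hν m
  have h2 : (1 / (4 * a)) ^ (-(ν + m + 1)) = (4 * a) ^ (ν + 1) * (4 * a) ^ m := by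
    rw [one_div, Real.inv_rpow (by positivity), ← Real.rpow_neg (by positivity), neg_neg,
      ← Real.rpow_natCast, ← Real.rpow_add (by positivity)]
    congr 1
    ring
  rw [h2, besselCoeff]
  have h3 : (m.factorial : ℝ) ≠ 0 := by positivity
  field_simp

/-- Termwise integration: the Gamma function in each coefficient cancels the one from the Gaussian
moment, and the exponential series of -wa remains. This is the classical Gaussian integral of a
Bessel function. -/
theorem integral_gauss_mul_besselSeries (hν : 0 ≤ ν) {a : ℝ} (ha : 0 < a) (w : ℂ) :
    ∫ x, ((rho c x ^ ν * Real.exp (-(1 / (4 * a) * rho c x)) : ℝ) : ℂ) *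
        besselSeries ν (w * rho c x) =
      ((Real.pi * Real.Gamma (ν + 1) * (4 * a) ^ (ν + 1) : ℝ) : ℂ) * Complex.exp (-(w * a)) := by
  set b := 1 / (4 * a) with hb
  have hb0 : 0 < b := by positivity
  set K := Real.pi * Real.Gamma (ν + 1) * (4 * a) ^ (ν + 1)
  let F : ℕ → Plane → ℂ := fun m x => (besselCoeff ν m * (-w / 4) ^ m) *
    ((rho c x ^ (ν + m) * Real.exp (-(b * rho c x)) : ℝ) : ℂ)
  have hq : ∀ m : ℕ, -1 < ν + m := fun m => by
    have : (0 : ℝ) ≤ m := by positivity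
    linarith
  have hi : ∀ m, Integrable (F m) := fun m =>
    ((integrable_rho_rpow_mul_exp c (hq m) hb0).ofReal (𝕜 := ℂ)).const_mul _
  have hn : ∀ m, ∫ x, ‖F m x‖ = K * ((‖w‖ * a) ^ m / m.factorial) := by
    intro m
    have h1 : ∀ x, ‖F m x‖ = (‖w‖ / 4) ^ m * (besselCoeff ν m *
        (rho c x ^ (ν + m) * Real.exp (-(b * rho c x)))) := by
      intro x
      have h4 : ‖(4 : ℂ)‖ = 4 := by norm_num
      have h5 : 0 ≤ rho c x ^ (ν + m) * Real.exp (-(b * rho c x)) :=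
        mul_nonneg (Real.rpow_nonneg (rho_nonneg c x) _) (Real.exp_pos _).le
      simp only [F]
      rw [norm_mul, norm_mul, norm_pow, norm_div, norm_neg, Complex.norm_real, Complex.norm_real,
        Real.norm_of_nonneg (besselCoeff_nonneg hν m), Real.norm_of_nonneg h5, h4]
      ring
    simp only [h1]
    rw [integral_const_mul, integral_const_mul, integral_rho_rpow_mul_exp c (hq m) hb0,
      besselCoeff_mul_integral hν ha, mul_left_comm, ← mul_div_assoc, ← mul_pow]
    congr 3
    ring
  have hs := hasSum_integral_of_summable_integral_norm hi (by
    simp only [hn]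
    exact (hasSum_pow_div_factorial _).summable.mul_left K)
  have h1 : ∫ x, ((rho c x ^ ν * Real.exp (-(b * rho c x)) : ℝ) : ℂ) *
      besselSeries ν (w * rho c x) = ∫ x, ∑' m, F m x := by
    refine integral_congr_ae ?_
    filter_upwards [ae_ne c] with x hx
    have hρ := rho_pos hx
    rw [besselSeries, ← tsum_mul_left]
    congr 1
    funext m
    simp only [F]
    rw [Real.rpow_add hρ, Real.rpow_natCast]
    push_cast
    ring
  rw [h1]
  refine hs.unique ?_
  have h2 : HasSum (fun m : ℕ => (K : ℂ) * ((-(w * a)) ^ m / m.factorial))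
      (K * Complex.exp (-(w * a))) := by
    rw [Complex.exp_eq_exp_ℂ]
    exact (NormedSpace.expSeries_div_hasSum_exp (-(w * a : ℂ))).mul_left _
  suffices h0 : ∀ m, ∫ x, F m x = (K : ℂ) * ((-(w * a)) ^ m / m.factorial) by
    rwa [funext h0]
  intro m
  rw [integral_const_mul, integral_complex_ofReal, integral_rho_rpow_mul_exp c (hq m) hb0]
  have h3 := congrArg (fun r : ℝ => (r : ℂ)) (besselCoeff_mul_integral hν ha m)
  rw [Complex.ofReal_mul, Complex.ofReal_mul K] at h3
  have h4 : (-(w * a)) ^ m = (-w / 4) ^ m * ((4 * a : ℝ) : ℂ) ^ m := by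
    rw [← mul_pow]
    congr 1
    push_cast
    ring
  rw [h4]
  push_cast at h3 ⊢
  linear_combination ((-w / 4) ^ m) * h3

/-- The weight put on the Bessel function cancels the one divided out of the Gaussian. The conjugate
in `regularVec` makes the result holomorphic in w. -/
theorem inner_regularVec_weightedVec (hf : Continuous f) (hδ : 0 < δ) (hw : ‖w‖ ≤ δ) {a : ℝ}
    (ha : 0 < a) (haδ : 4 * a * δ < 1) :
    ⟪regularVec β c f δ l w, weightedVec β c f δ k a⟫_ℂ =
      if l = k then modeConst β k * Complex.exp (-(w * a)) else 0 := by
  have hν := order_nonneg β k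
  have hw' : ‖starRingEnd ℂ w‖ ≤ δ := by rwa [RCLike.norm_conj]
  have hE := expDecay_besselGauss (δ := δ) (order_nonneg β l) (w := starRingEnd ℂ w) (by linarith)
  have hs : 0 < 1 / (4 * a) - δ := by
    rw [sub_pos, lt_div_iff₀ (by positivity)]
    linarith
  rw [weightedVec, regularVec, inner_smul_right, inner_radialVec hf hE (expDecay_gauss 0 hs)]
  split_ifs with h
  · subst h
    have h1 : ∀ x, ((rho c x ^ order β l : ℝ) : ℂ) * (gauss 0 (1 / (4 * a) - δ) (rho c x) *
        starRingEnd ℂ (besselGauss (order β l) δ (starRingEnd ℂ w) (rho c x))) =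
        ((rho c x ^ order β l * Real.exp (-(1 / (4 * a) * rho c x)) : ℝ) : ℂ) *
          besselSeries (order β l) (w * rho c x) := by
      intro x
      have h2 : Real.exp (-(1 / (4 * a) * rho c x)) =
          Real.exp (-((1 / (4 * a) - δ) * rho c x)) * Real.exp (-(δ * rho c x)) := by
        rw [← Real.exp_add]
        congr 1
        ring
      rw [gauss, besselGauss, map_mul, conj_besselSeries, map_mul, Complex.conj_conj,
        Complex.conj_ofReal, Complex.conj_ofReal, pow_zero, one_mul, h2]
      push_cast
      ring
    simp only [h1]
    rw [integral_gauss_mul_besselSeries hν ha, ← mul_assoc, ← Complex.ofReal_mul]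
    congr 2
    rw [modeConst, Real.mul_rpow (by norm_num) ha.le, Real.rpow_neg ha.le]
    have : 0 < a ^ (order β l + 1) := Real.rpow_pos_of_pos ha _
    field_simp
  · simp

end Bessel

/-! ### Sesquilinear forms given by a matrix -/

section MatrixForm

variable {ι : Type*}

/-- The sesquilinear form with matrix `K` on finitely supported functions. -/
def matrixForm (K : ι → ι → ℂ) : (ι →₀ ℂ) →ₗ⋆[ℂ] (ι →₀ ℂ) →ₗ[ℂ] ℂ :=
  LinearMap.mk₂'ₛₗ (starRingEnd ℂ) (RingHom.id ℂ)
    (fun y x => y.sum fun i a => starRingEnd ℂ a * Finsupp.linearCombination ℂ (K i) x)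
    (fun y y' x => Finsupp.sum_add_index' (by simp) (by intros; rw [map_add, add_mul]))
    (fun a y x => by
      rw [Finsupp.sum_smul_index' (by simp), smul_eq_mul, Finsupp.sum, Finsupp.sum, Finset.mul_sum]
      exact Finset.sum_congr rfl fun i _ => by rw [smul_eq_mul, map_mul, mul_assoc])
    (fun y x x' => by simp only [map_add, mul_add, Finsupp.sum_add])
    (fun a y x => by
      simp only [map_smul, smul_eq_mul, RingHom.id_apply, Finsupp.sum, Finset.mul_sum]
      exact Finset.sum_congr rfl fun i _ => mul_left_comm _ _ _)

theorem matrixForm_apply (K : ι → ι → ℂ) (y x : ι →₀ ℂ) : matrixForm K y x =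
    ∑ i ∈ y.support, starRingEnd ℂ (y i) * ∑ j ∈ x.support, x j * K i j := by
  rw [matrixForm, LinearMap.mk₂'ₛₗ_apply, Finsupp.sum]
  refine Finset.sum_congr rfl fun i _ => ?_
  rw [Finsupp.linearCombination_apply, Finsupp.sum]
  simp only [smul_eq_mul]

theorem inner_linearCombination (e : ι → L2) (T : L2 →L[ℂ] L2) (y x : ι →₀ ℂ) :
    ⟪Finsupp.linearCombination ℂ e y, T (Finsupp.linearCombination ℂ e x)⟫_ℂ =
      matrixForm (fun i j => ⟪e i, T (e j)⟫_ℂ) y x := by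
  rw [matrixForm_apply, Finsupp.linearCombination_apply, Finsupp.linearCombination_apply,
    Finsupp.sum, Finsupp.sum, sum_inner]
  refine Finset.sum_congr rfl fun i _ => ?_
  rw [inner_smul_left, map_sum, inner_sum]
  congr 1
  exact Finset.sum_congr rfl fun j _ => by rw [map_smul, inner_smul_right]

end MatrixForm

/-! ### Continuation of the weighted resolvent -/

section WeightedContinuation

/-- The weight `e^{-δ r²}`. -/
def weight (c : Plane) (δ : ℝ) (x : Plane) : ℂ := (Real.exp (-(δ * rho c x)) : ℂ)

variable {β : ℝ} {c : Plane} {f : Plane → ℝ} {k l : ℤ} {δ : ℝ}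

theorem norm_weight_le (hδ : 0 ≤ δ) (x : Plane) : ‖weight c δ x‖ ≤ 1 := by
  rw [weight, Complex.norm_real, Real.norm_of_nonneg (Real.exp_pos _).le, Real.exp_le_one_iff]
  have := rho_nonneg c x
  nlinarith

theorem isMultiplier_weight (hδ : 0 ≤ δ) : IsMultiplier (weight c δ) := by
  refine ⟨Continuous.measurable ?_, 1, norm_weight_le hδ⟩
  have := (contDiff_rho c).continuous
  unfold weight
  fun_prop

theorem conj_weight (x : Plane) : starRingEnd ℂ (weight c δ x) = weight c δ x :=
  Complex.conj_ofReal _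

theorem mulOp_weight_weightedVec (hf : Continuous f) (hδ : 0 ≤ δ) {a : ℝ} (ha : 0 < a)
    (haδ : 4 * a * δ < 1) : mulOp (weight c δ) (weightedVec β c f δ k a) = heatVec β c f k a := by
  have hs : 0 < 1 / (4 * a) - δ := by
    rw [sub_pos, lt_div_iff₀ (by positivity)]
    linarith
  rw [weightedVec, heatVec, map_smul]
  congr 1
  refine Lp.ext ?_
  filter_upwards [coeFn_mulOp (isMultiplier_weight (c := c) hδ)
    (radialVec β c f k (gauss 0 (1 / (4 * a) - δ))),
    coeFn_radialVec (β := β) (c := c) (k := k) hf (expDecay_gauss 0 hs),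
    coeFn_radialVec (β := β) (c := c) (k := k) hf
      (expDecay_gauss 0 (by positivity : 0 < 1 / (4 * a)))] with x h1 h2 h3
  have h4 : Real.exp (-(1 / (4 * a) * rho c x)) =
      Real.exp (-(δ * rho c x)) * Real.exp (-((1 / (4 * a) - δ) * rho c x)) := by
    rw [← Real.exp_add]
    congr 1
    ring
  rw [h1, h2, h3, weight, radialFun, radialFun, gauss, gauss, pow_zero, one_mul, one_mul, h4]
  push_cast
  ring

/-- The indices of the Gaussians which remain square integrable after division by the weight. -/
abbrev GaussIndex (δ : ℝ) : Type := {p : ℤ × ℝ // 0 < p.2 ∧ 4 * p.2 * δ < 1}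

theorem denseRange_weightedVec (hf : Continuous f) (hδ : 0 < δ) : DenseRange
    (Finsupp.linearCombination ℂ fun i : GaussIndex δ => weightedVec β c f δ i.1.1 i.1.2) := by
  set E := Finsupp.linearCombination ℂ fun i : GaussIndex δ => weightedVec β c f δ i.1.1 i.1.2
  have h1 : (LinearMap.range E).topologicalClosure = ⊤ := by
    refine eq_top_of_gauss_mem (β := β) (c := c) hf
      (Submodule.isClosed_topologicalClosure _) fun k s hs => ?_
    -- Chosen so that 1/(4a) - δ = s; every s > 0 is reached by an admissible index.
    set a := 1 / (4 * (s + δ)) with ha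
    have ha0 : 0 < a := by positivity
    have haδ : 4 * a * δ < 1 := by
      have : 4 * a * δ = δ / (s + δ) := by rw [ha]; field_simp
      rw [this, div_lt_one (by positivity)]
      linarith
    have has : 1 / (4 * a) - δ = s := by
      rw [ha]
      field_simp
      ring
    refine Submodule.le_topologicalClosure _ ⟨Finsupp.single ⟨(k, a), ha0, haδ⟩
      ((a ^ (order β k + 1) : ℝ) : ℂ), ?_⟩
    simp only [E]
    rw [Finsupp.linearCombination_single, weightedVec, smul_smul, has, ← Complex.ofReal_mul,
      ← Real.rpow_add ha0]
    simp
  intro u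
  have h2 : u ∈ (LinearMap.range E).topologicalClosure := by
    rw [h1]
    trivial
  exact h2

theorem modeConst_pos (β : ℝ) (k : ℤ) : 0 < modeConst β k := by
  have hν := order_nonneg β k
  have := Real.Gamma_pos_of_pos (by linarith : 0 < order β k + 1)
  unfold modeConst
  positivity

/-- |k + β| ≥ |k| - |β| reduces this to a geometric series. -/
theorem summable_jump (β : ℝ) : Summable fun k : ℤ => (6 : ℝ) ^ (-order β k) := by
  have h1 : Summable fun n : ℕ => (6 : ℝ) ^ |β| * (1 / 6) ^ n :=
    (summable_geometric_of_lt_one (by norm_num) (by norm_num)).mul_left _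
  have h2 : ∀ (k : ℤ) (n : ℕ), |(k : ℝ)| = n → (6 : ℝ) ^ (-order β k) ≤
      6 ^ |β| * (1 / 6) ^ n := by
    intro k n hk
    rw [one_div, inv_pow, ← Real.rpow_natCast, ← Real.rpow_neg (by norm_num),
      ← Real.rpow_add (by norm_num)]
    refine Real.rpow_le_rpow_of_exponent_le (by norm_num) ?_
    have h3 := abs_sub_abs_le_abs_sub (k : ℝ) (-β)
    rw [sub_neg_eq_add, abs_neg, hk] at h3
    rw [order]
    linarith
  refine Summable.of_nat_of_neg ?_ ?_
  · exact Summable.of_nonneg_of_le (fun n => by positivity) (fun n => h2 n n (by simp)) h1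
  · exact Summable.of_nonneg_of_le (fun n => by positivity) (fun n => h2 (-n) n (by simp)) h1

/-- The operator by which the weighted resolvent jumps after half a turn, restricted to finitely
many angular momenta. -/
def jumpOp (β : ℝ) (c : Plane) (f : Plane → ℝ) (δ : ℝ) (κ : ℤ → ℂ) (ζ : ℂ) (T : Finset ℤ) :
    L2 →L[ℂ] L2 :=
  ∑ k ∈ T, (κ k * Complex.exp (2 * order β k * ζ) / modeConst β k) •
    (innerSL ℂ (regularVec β c f δ k (Complex.exp (2 * ζ)))).smulRight
      (regularVec β c f δ k (starRingEnd ℂ (Complex.exp (2 * ζ))))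

/-- In mode k the factors are |z|^ν ≤ δ^ν and ‖regular vector‖²/C_k ≤ (6δ)^{-(ν+1)}, so the powers
of δ combine to δ⁻¹ and 6^{-ν} makes the sum converge. The bound is independent of the finite set T.
-/
theorem norm_jumpOp_le (hf : Continuous f) (hδ : 0 < δ) {κ : ℤ → ℂ} (hκ : ∀ k, ‖κ k‖ ≤ 20)
    {ζ : ℂ} (hζ : ‖Complex.exp (2 * ζ)‖ ≤ δ) (T : Finset ℤ) :
    ‖jumpOp β c f δ κ ζ T‖ ≤ 20 / δ * ∑' k : ℤ, (6 : ℝ) ^ (-order β k) := by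
  refine (norm_sum_le _ _).trans ?_
  rw [← tsum_mul_left]
  refine le_trans (Finset.sum_le_sum fun k _ => ?_)
    (((summable_jump β).mul_left (20 / δ)).sum_le_tsum T fun k _ => by positivity)
  set ν := order β k with hν
  have hν0 : 0 ≤ ν := order_nonneg β k
  have hC := modeConst_pos β k
  set D := Real.pi * (3 / 2 * δ) ^ (-(ν + 1)) * Real.Gamma (ν + 1) with hD
  have hΓ := Real.Gamma_pos_of_pos (by linarith : 0 < ν + 1)
  have hD0 : 0 ≤ D := by positivity
  have h1 : ∀ w : ℂ, ‖w‖ ≤ δ → ‖regularVec β c f δ k w‖ ≤ √D := fun w hw =>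
    Real.le_sqrt_of_sq_le (norm_regularVec_sq_le hf hδ hw)
  rw [norm_smul, ContinuousLinearMap.norm_smulRight_apply, innerSL_apply_norm, norm_div, norm_mul,
    Complex.norm_real, Real.norm_of_nonneg hC.le]
  have h2 : ‖Complex.exp (2 * ν * ζ)‖ ≤ δ ^ ν := by
    have : Complex.exp (2 * ν * ζ) = Complex.exp (ν * (2 * ζ)) := by congr 1; ring
    rw [this, Complex.norm_exp]
    have e1 : ((ν : ℂ) * (2 * ζ)).re = (2 * ζ).re * ν := by simp [mul_comm]
    rw [e1, Real.exp_mul, ← Complex.norm_exp]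
    exact Real.rpow_le_rpow (norm_nonneg _) hζ hν0
  have h3 : D / modeConst β k = (6 * δ) ^ (-(ν + 1)) := by
    rw [hD, modeConst, ← hν]
    have : (6 * δ) = 4 * (3 / 2 * δ) := by ring
    rw [this, Real.mul_rpow (x := 4) (y := 3 / 2 * δ) (by norm_num) (by positivity),
      Real.rpow_neg (by norm_num : (0 : ℝ) ≤ 4)]
    field_simp
  calc _ ≤ 20 * δ ^ ν / modeConst β k * (√D * √D) := by
        gcongr
        · exact hκ k
        · exact h1 _ hζ
        · exact h1 _ (by rwa [RCLike.norm_conj])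
    _ = 20 * δ ^ ν * (D / modeConst β k) := by
        rw [Real.mul_self_sqrt hD0]
        ring
    _ = 20 * (δ ^ ν * δ ^ (-(ν + 1))) * (6 ^ (-ν) * 6 ^ (-1 : ℝ)) := by
        rw [h3, Real.mul_rpow (by norm_num) hδ.le, ← Real.rpow_add (by norm_num : (0:ℝ) < 6)]
        have : -ν + -1 = -(ν + 1) := by ring
        rw [this]
        ring
    _ = 20 / δ * (6 ^ (-ν) * 6 ^ (-1 : ℝ)) := by
        rw [← Real.rpow_add hδ]
        have : ν + -(ν + 1) = -1 := by ring
        rw [this, Real.rpow_neg_one]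
        ring
    _ ≤ 20 / δ * 6 ^ (-ν) := by
        gcongr
        rw [Real.rpow_neg_one]
        have : (0 : ℝ) < 6 ^ (-ν) := by positivity
        linarith

/-- The jump depends on a and b through e^{-z(a+b)} = e^{-za} e^{-zb}; factoring it is what makes
each mode a rank-one operator. -/
theorem inner_jumpOp (hf : Continuous f) (hδ : 0 < δ) (κ : ℤ → ℂ)
    {ζ : ℂ} (hζ : ‖Complex.exp (2 * ζ)‖ ≤ δ) {T : Finset ℤ} (hk : k ∈ T) {a b : ℝ} (ha : 0 < a)
    (haδ : 4 * a * δ < 1) (hb : 0 < b) (hbδ : 4 * b * δ < 1) :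
    ⟪weightedVec β c f δ l b, jumpOp β c f δ κ ζ T (weightedVec β c f δ k a)⟫_ℂ =
      if l = k then modeConst β k * (κ k * Complex.exp (2 * order β k * ζ) *
        Complex.exp (-(Complex.exp (2 * ζ) * (a + b : ℝ)))) else 0 := by
  have hC : (modeConst β k : ℂ) ≠ 0 := by exact_mod_cast (modeConst_pos β k).ne'
  have h1 : ∀ m, ⟪weightedVec β c f δ l b,
      regularVec β c f δ m (starRingEnd ℂ (Complex.exp (2 * ζ)))⟫_ℂ =
      if m = l then modeConst β l * Complex.exp (-(Complex.exp (2 * ζ) * b)) else 0 := by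
    intro m
    rw [← inner_conj_symm, inner_regularVec_weightedVec hf hδ (by rwa [RCLike.norm_conj]) hb hbδ]
    split_ifs
    · rw [map_mul, Complex.conj_ofReal, ← Complex.exp_conj]
      simp
    · simp
  rw [jumpOp, _root_.sum_apply, inner_sum, Finset.sum_eq_single k]
  · rw [_root_.smul_apply, inner_smul_right, ContinuousLinearMap.smulRight_apply, inner_smul_right,
      innerSL_apply_apply, inner_regularVec_weightedVec hf hδ hζ ha haδ, h1, if_pos rfl]
    simp only [eq_comm (a := l)]
    split_ifs with h
    · subst h
      have h2 : Complex.exp (-(Complex.exp (2 * ζ) * (a + b : ℝ))) =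
          Complex.exp (-(Complex.exp (2 * ζ) * a)) * Complex.exp (-(Complex.exp (2 * ζ) * b)) := by
        rw [← Complex.exp_add]
        congr 1
        push_cast
        ring
      rw [h2]
      field_simp
    · simp
  · intro m _ hm
    rw [_root_.smul_apply, inner_smul_right, ContinuousLinearMap.smulRight_apply, inner_smul_right,
      innerSL_apply_apply, inner_regularVec_weightedVec hf hδ hζ ha haδ, if_neg hm]
    simp
  · intro h
    exact absurd hk h

end WeightedContinuation

/-! ### Weighted resolvents on left half planes of the logarithmic cover. -/

section WeightedContinuation

variable {β : ℝ} {c : Plane} {f : Plane → ℝ} {hf : ContDiff ℝ ∞ f} {G : L2 →L[ℂ] L2}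

theorem differentiableOn_resolventOf (hG : IsPosResolvent (freeHamiltonian β c f hf) G) :
    DifferentiableOn ℂ (fun ζ : ℂ => resolventOf G (Complex.exp (2 * ζ))) LogCover.physical :=
  fun w hw => (DifferentiableAt.comp (g := resolventOf G) w
    (hG.differentiableAt_resolventOf (exp_two_mul_ne hw)) (by fun_prop)).differentiableWithinAt

/-- |Im z| = e^{2 Re ζ} |sin(2 Im ζ)|, and Jordan's inequality gives sin 2t ≥ 4t/π ≥ t. Here t is
the distance to either edge of the strip. -/
theorem norm_resolventOf_mul_le (hG : IsPosResolvent (freeHamiltonian β c f hf) G) {a : ℝ} {ζ : ℂ}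
    (hζ : ζ ∈ LogCover.physical) (ha : |ζ.re - a| ≤ 1 / 2) {t : ℝ} (ht0 : 0 < t) (ht1 : t ≤ 1 / 2)
    (hs : |Real.sin (2 * ζ.im)| = Real.sin (2 * t)) :
    ‖resolventOf G (Complex.exp (2 * ζ))‖ * t ≤ Real.exp (1 - 2 * a) := by
  have h1 : t ≤ Real.sin (2 * t) := by
    have h2 := Real.mul_le_sin (x := 2 * t) (by linarith) (by linarith [Real.pi_gt_three])
    have h3 : t ≤ 2 / Real.pi * (2 * t) := by
      rw [div_mul_eq_mul_div, le_div_iff₀ Real.pi_pos]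
      nlinarith [Real.pi_le_four]
    linarith
  have him : (Complex.exp (2 * ζ)).im = Real.exp (2 * ζ.re) * Real.sin (2 * ζ.im) := by
    rw [Complex.exp_im]
    simp
  have habs : |(Complex.exp (2 * ζ)).im| = Real.exp (2 * ζ.re) * Real.sin (2 * t) := by
    rw [him, abs_mul, hs, abs_of_pos (Real.exp_pos _)]
  have hne : (Complex.exp (2 * ζ)).im ≠ 0 := by
    rw [← abs_pos, habs]
    have := Real.exp_pos (2 * ζ.re)
    have h4 : 0 < Real.sin (2 * t) := by linarith
    positivity
  have h2 := hG.norm_resolvent_le (hG.isResolvent_resolventOf (exp_two_mul_ne hζ)) hne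
  rw [habs, mul_inv, ← Real.exp_neg] at h2
  have h3 : Real.exp (-(2 * ζ.re)) ≤ Real.exp (1 - 2 * a) :=
    Real.exp_le_exp.2 (by linarith [(abs_le.1 ha).1])
  have h4 : 0 < Real.sin (2 * t) := by linarith
  calc _ ≤ Real.exp (-(2 * ζ.re)) * (Real.sin (2 * t))⁻¹ * t := by gcongr
    _ = Real.exp (-(2 * ζ.re)) * (t / Real.sin (2 * t)) := by ring
    _ ≤ Real.exp (1 - 2 * a) * 1 := by
      gcongr
      exact (div_le_one h4).2 h1
    _ = _ := mul_one _

/-- The weighted resolvent extends from the physical half plane to any left half plane of the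
logarithmic cover. -/
theorem exists_weighted_continuation (hG : IsPosResolvent (freeHamiltonian β c f hf) G) (L : ℝ) :
    ∃ A : ℂ → L2 →L[ℂ] L2, DifferentiableOn ℂ A {ζ | ζ.re < L} ∧
      ∀ ζ ∈ LogCover.physical, ζ.re < L → A ζ = mulOp (weight c (Real.exp (2 * L))) ∘L
        resolventOf G (Complex.exp (2 * ζ)) ∘L mulOp (weight c (Real.exp (2 * L))) := by
  set δ := Real.exp (2 * L)
  have hδ : 0 < δ := Real.exp_pos _
  have hfc := hf.continuous
  choose F hFd hF hF0 κ hκ hFJ using fun k => exists_modeKernel (order_nonneg β k)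
  have hw := isMultiplier_weight (c := c) hδ.le
  set M := mulOp (weight c δ)
  have hM : ‖M‖ ≤ 1 := norm_mulOp_le hw (norm_weight_le hδ.le)
  have hBd : DifferentiableOn ℂ (fun ζ : ℂ => M ∘L resolventOf G (Complex.exp (2 * ζ)) ∘L M)
      LogCover.physical := by
    have h1 := differentiableOn_resolventOf hG
    exact (differentiableOn_const M).clm_comp (h1.clm_comp (differentiableOn_const M))
  have hBle : ∀ z, ‖M ∘L resolventOf G z ∘L M‖ ≤ ‖resolventOf G z‖ := by
    intro z
    calc _ ≤ ‖M‖ * (‖resolventOf G z‖ * ‖M‖) :=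
          (ContinuousLinearMap.opNorm_comp_le _ _).trans
            (mul_le_mul_of_nonneg_left (ContinuousLinearMap.opNorm_comp_le _ _) (norm_nonneg _))
      _ ≤ 1 * (‖resolventOf G z‖ * 1) := by gcongr
      _ = _ := by ring
  -- The continued matrix elements: diagonal in the angular momentum and entire in ζ.
  let K : ℂ → GaussIndex δ → GaussIndex δ → ℂ := fun ζ i j =>
    if i.1.1 = j.1.1 then modeConst β j.1.1 * F j.1.1 (j.1.2 + i.1.2) ζ else 0
  refine exists_continuation (B := fun ζ : ℂ => M ∘L resolventOf G (Complex.exp (2 * ζ)) ∘L M)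
    (denseRange_weightedVec (β := β) (c := c) hfc hδ) (φ := fun ζ => matrixForm (K ζ))
    (C := 20 / δ * ∑' k : ℤ, (6 : ℝ) ^ (-order β k)) (fun y x => ?_) (fun ζ hζ y x => ?_)
    hBd.continuousOn (fun a => ⟨Real.exp (1 - 2 * a), fun ζ hζ ha => ⟨fun h => ?_, fun h => ?_⟩⟩)
    fun ζ hζ y x => ?_
  · simp only [matrixForm_apply]
    refine Differentiable.fun_sum fun i _ => (Differentiable.fun_sum fun j _ => ?_).const_mul _
    refine Differentiable.const_mul ?_ _
    simp only [K]
    split_ifs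
    · exact (hFd _ _).const_mul _
    · exact differentiable_const _
  · rw [inner_linearCombination]
    refine congrArg (fun K => matrixForm K y x) (funext fun i => funext fun j => ?_)
    rw [ContinuousLinearMap.comp_apply, ContinuousLinearMap.comp_apply]
    have h1 : ⟪weightedVec β c f δ i.1.1 i.1.2, M (resolventOf G (Complex.exp (2 * ζ))
        (M (weightedVec β c f δ j.1.1 j.1.2)))⟫_ℂ = ⟪M (weightedVec β c f δ i.1.1 i.1.2),
        resolventOf G (Complex.exp (2 * ζ)) (M (weightedVec β c f δ j.1.1 j.1.2))⟫_ℂ := by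
      rw [inner_mulOp_left hw]
      simp only [conj_weight]
      rfl
    rw [h1, mulOp_weight_weightedVec hfc hδ.le i.2.1 i.2.2,
      mulOp_weight_weightedVec hfc hδ.le j.2.1 j.2.2,
      inner_resolvent_heatVec hG (hFd _) (hF _) (hF0 _) j.2.1 i.2.1 hζ]
  · refine (mul_le_mul_of_nonneg_right (hBle _) hζ.1.le).trans
      (norm_resolventOf_mul_le hG hζ ha hζ.1 h (abs_of_nonneg ?_))
    exact Real.sin_nonneg_of_nonneg_of_le_pi (by linarith [hζ.1])
      (by linarith [Real.pi_gt_three])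
  · refine (mul_le_mul_of_nonneg_right (hBle _) (by linarith [hζ.2])).trans
      (norm_resolventOf_mul_le hG hζ ha (by linarith [hζ.2]) (by linarith) ?_)
    have h1 : Real.sin (2 * (Real.pi - ζ.im)) = -Real.sin (2 * ζ.im) := by
      rw [mul_sub, Real.sin_two_pi_sub]
    rw [← abs_neg, ← h1]
    exact abs_of_nonneg (Real.sin_nonneg_of_nonneg_of_le_pi (by linarith [hζ.2])
      (by linarith [Real.pi_gt_three]))
  -- This is where Re ζ < L and δ = e^{2L} are matched.
  · have hz : ‖Complex.exp (2 * ζ)‖ ≤ δ := by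
      rw [Complex.norm_exp]
      refine Real.exp_le_exp.2 ?_
      simp only [Complex.mul_re, Complex.re_ofNat, Complex.im_ofNat, zero_mul, sub_zero]
      linarith [hζ]
    -- The angular momenta occurring in x. Finitely many suffice for each pair of vectors, and the
    -- bound does not see which.
    set T : Finset ℤ := x.support.image fun j => j.1.1
    have h1 : matrixForm (K (ζ + Real.pi * Complex.I)) y x - matrixForm (K ζ) y x =
        ⟪Finsupp.linearCombination ℂ (fun i : GaussIndex δ => weightedVec β c f δ i.1.1 i.1.2) y,
          jumpOp β c f δ κ ζ T (Finsupp.linearCombination ℂ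
            (fun i : GaussIndex δ => weightedVec β c f δ i.1.1 i.1.2) x)⟫_ℂ := by
      rw [inner_linearCombination, matrixForm_apply, matrixForm_apply, matrixForm_apply,
        ← Finset.sum_sub_distrib]
      refine Finset.sum_congr rfl fun i _ => ?_
      rw [← mul_sub, ← Finset.sum_sub_distrib]
      congr 1
      refine Finset.sum_congr rfl fun j hj => ?_
      rw [← mul_sub, inner_jumpOp hfc hδ κ hz (Finset.mem_image_of_mem _ hj) j.2.1 j.2.2 i.2.1
        i.2.2]
      congr 1
      simp only [K]
      split_ifs
      · rw [← mul_sub, hFJ]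
      · simp
    rw [h1]
    refine (norm_inner_le_norm _ _).trans ?_
    have h2 := (jumpOp β c f δ κ ζ T).le_of_opNorm_le (norm_jumpOp_le hfc hδ hκ hz T)
      (Finsupp.linearCombination ℂ (fun i : GaussIndex δ => weightedVec β c f δ i.1.1 i.1.2) x)
    calc _ ≤ _ := mul_le_mul_of_nonneg_left h2 (norm_nonneg _)
      _ = _ := by ring

end WeightedContinuation

/-! ### Continuation of the localized resolvent -/

section Identity

variable {E : Type*} [NormedAddCommGroup E] [NormedSpace ℂ E] [CompleteSpace E]

theorem eqOn_of_eqOn_physical {A B : ℂ → E} {L : ℝ} (hA : DifferentiableOn ℂ A {ζ | ζ.re < L})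
    (hB : DifferentiableOn ℂ B {ζ | ζ.re < L})
    (h : ∀ ζ ∈ LogCover.physical, ζ.re < L → A ζ = B ζ) {ζ : ℂ} (hζ : ζ.re < L) : A ζ = B ζ := by
  have ho : IsOpen {ζ : ℂ | ζ.re < L} := isOpen_lt Complex.continuous_re continuous_const
  have h0 : (⟨ζ.re, Real.pi / 2⟩ : ℂ) ∈ LogCover.physical :=
    ⟨by simpa using Real.pi_pos, by simpa using Real.pi_pos⟩
  refine (hA.analyticOnNhd ho).eqOn_of_preconnected_of_eventuallyEq (hB.analyticOnNhd ho)
    (convex_halfSpace_re_lt L).isPreconnected (z₀ := ⟨ζ.re, Real.pi / 2⟩) hζ ?_ hζ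
  filter_upwards [isOpen_physical.mem_nhds h0, ho.mem_nhds hζ] with w h1 h2 using h w h1 h2

theorem eq_of_eqOn_physical {A B : ℂ → E} (hA : Differentiable ℂ A) (hB : Differentiable ℂ B)
    (h : ∀ ζ ∈ LogCover.physical, A ζ = B ζ) (ζ : ℂ) : A ζ = B ζ :=
  eqOn_of_eqOn_physical (L := ζ.re + 1) hA.differentiableOn hB.differentiableOn
    (fun w hw _ => h w hw) (by linarith)

/-- Continuations to two half planes agree on the smaller one, both being determined by the physical
strip. Near ζ the one with L = Re ζ + 1 may therefore be used throughout. -/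
theorem exists_entire_of_halfPlanes {B₀ : ℂ → E} (h : ∀ L : ℝ, ∃ B : ℂ → E,
    DifferentiableOn ℂ B {ζ | ζ.re < L} ∧ ∀ ζ ∈ LogCover.physical, ζ.re < L → B ζ = B₀ ζ) :
    ∃ B : ℂ → E, Differentiable ℂ B ∧ ∀ ζ ∈ LogCover.physical, B ζ = B₀ ζ := by
  choose B hB hB' using h
  refine ⟨fun ζ => B (ζ.re + 1) ζ, fun ζ => ?_, fun ζ hζ => hB' _ ζ hζ (by linarith)⟩
  have ho : ∀ L : ℝ, IsOpen {ζ : ℂ | ζ.re < L} := fun L =>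
    isOpen_lt Complex.continuous_re continuous_const
  have h1 : DifferentiableAt ℂ (B (ζ.re + 1)) ζ :=
    (hB _).differentiableAt ((ho _).mem_nhds (show ζ.re < ζ.re + 1 by linarith))
  refine h1.congr_of_eventuallyEq ?_
  filter_upwards [(ho (ζ.re + 1)).mem_nhds (show ζ.re < ζ.re + 1 by linarith)] with w hw
  have hw' : w.re < min (w.re + 1) (ζ.re + 1) := lt_min (by linarith) hw
  refine eqOn_of_eqOn_physical ((hB _).mono fun x hx => ?_) ((hB _).mono fun x hx => ?_)
    (fun x hx hxL => ?_) hw'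
  · exact (show x.re < _ from hx).trans_le (min_le_left _ _)
  · exact (show x.re < _ from hx).trans_le (min_le_right _ _)
  · rw [hB' _ x hx (hxL.trans_le (min_le_left _ _)), hB' _ x hx (hxL.trans_le (min_le_right _ _))]

end Identity

/-! ### Localization to balls and gluing. -/

section Localized

variable {β : ℝ} {c : Plane} {f : Plane → ℝ} {hf : ContDiff ℝ ∞ f} {G : L2 →L[ℂ] L2}

/-- The inverse of the weight `e^{-δ r²}` on the ball of radius `r`. -/
def invWeight (c : Plane) (δ r : ℝ) (x : Plane) : ℂ :=
  ballIndicator r x * (Real.exp (δ * rho c x) : ℂ)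

theorem isMultiplier_invWeight (c : Plane) (δ r : ℝ) : IsMultiplier (invWeight c δ r) := by
  have hc : Continuous fun x => (Real.exp (δ * rho c x) : ℂ) := by
    have := (contDiff_rho c).continuous
    fun_prop
  refine ⟨(isMultiplier_ballIndicator r).measurable.mul hc.measurable, ?_⟩
  obtain ⟨C, hC⟩ := (isCompact_closedBall (0 : Plane) r).exists_bound_of_continuousOn
    hc.continuousOn
  refine ⟨max C 0, fun x => ?_⟩
  by_cases hx : x ∈ Metric.closedBall (0 : Plane) r
  · rw [invWeight, ballIndicator, Set.indicator_of_mem hx, Pi.one_apply, one_mul]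
    exact (hC x hx).trans (le_max_left _ _)
  · rw [invWeight, ballIndicator, Set.indicator_of_notMem hx, zero_mul, norm_zero]
    exact le_max_right _ _

theorem invWeight_mul_weight (c : Plane) (δ r : ℝ) (x : Plane) :
    invWeight c δ r x * weight c δ x = ballIndicator r x := by
  rw [invWeight, weight, mul_assoc, ← Complex.ofReal_mul, ← Real.exp_add, add_neg_cancel,
    Real.exp_zero, Complex.ofReal_one, mul_one]

/-- On a ball the Gaussian weight is bounded below and can be divided out. The outcome on the
physical sheet no longer involves δ, so the half planes can be exhausted. -/
theorem exists_localized_continuation (hG : IsPosResolvent (freeHamiltonian β c f hf) G)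
    (r s : ℝ) : ∃ T : ℂ → L2 →L[ℂ] L2, Differentiable ℂ T ∧ ∀ ζ ∈ LogCover.physical,
      T ζ = mulOp (ballIndicator r) ∘L resolventOf G (Complex.exp (2 * ζ)) ∘L
        mulOp (ballIndicator s) := by
  refine exists_entire_of_halfPlanes fun L => ?_
  obtain ⟨A, hA, hA'⟩ := exists_weighted_continuation hG L
  set δ := Real.exp (2 * L)
  have hδ : 0 ≤ δ := (Real.exp_pos _).le
  refine ⟨fun ζ => mulOp (invWeight c δ r) ∘L A ζ ∘L mulOp (invWeight c δ s),
    (differentiableOn_const _).clm_comp (hA.clm_comp (differentiableOn_const _)),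
    fun ζ hζ hL => ?_⟩
  have hw := isMultiplier_weight (c := c) hδ
  have h1 : ∀ r u, mulOp (invWeight c δ r) (mulOp (weight c δ) u) = mulOp (ballIndicator r) u := by
    intro r u
    rw [mulOp_mulOp (isMultiplier_invWeight c δ r) hw]
    simp only [invWeight_mul_weight]
  have h2 : ∀ r u, mulOp (weight c δ) (mulOp (invWeight c δ r) u) = mulOp (ballIndicator r) u := by
    intro r u
    rw [mulOp_mulOp hw (isMultiplier_invWeight c δ r)]
    simp only [mul_comm (weight c δ _), invWeight_mul_weight]
  ext1 u
  simp only [hA' ζ hζ hL, ContinuousLinearMap.comp_apply, h1, h2]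

theorem ballIndicator_of_mem {r : ℝ} {x : Plane} (hx : x ∈ Metric.closedBall (0 : Plane) r) :
    ballIndicator r x = 1 := Set.indicator_of_mem hx _

theorem ballIndicator_of_notMem {r : ℝ} {x : Plane} (hx : x ∉ Metric.closedBall (0 : Plane) r) :
    ballIndicator r x = 0 := Set.indicator_of_notMem hx _

theorem mulOp_ballIndicator_of_mem {r : ℝ} {g : L2}
    (hg : g ∈ L2On (Metric.closedBall (0 : Plane) r)) : mulOp (ballIndicator r) g = g := by
  refine Lp.ext ?_
  filter_upwards [coeFn_mulOp (isMultiplier_ballIndicator r) g, hg] with x h1 h2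
  by_cases hx : x ∈ Metric.closedBall (0 : Plane) r
  · rw [h1, ballIndicator_of_mem hx, one_mul]
  · rw [h1, h2 hx, mul_zero]

/-- A family of operators `T r s ζ`, entire in `ζ`, which for `ζ` in the physical half plane are
the localizations of the resolvent at `e^ζ` to the balls of radii `r` and `s`. -/
structure IsLocalizedContinuation (G : L2 →L[ℂ] L2) (T : ℝ → ℝ → ℂ → L2 →L[ℂ] L2) : Prop where
  differentiable : ∀ r s, Differentiable ℂ (T r s)
  eq_resolvent : ∀ r s, ∀ ζ ∈ LogCover.physical, T r s ζ = mulOp (ballIndicator r) ∘L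
    resolventOf G (Complex.exp (2 * ζ)) ∘L mulOp (ballIndicator s)

theorem exists_isLocalizedContinuation (hG : IsPosResolvent (freeHamiltonian β c f hf) G) :
    ∃ T, IsLocalizedContinuation G T := by
  choose T h1 h2 using exists_localized_continuation hG
  exact ⟨T, h1, h2⟩

variable {T : ℝ → ℝ → ℂ → L2 →L[ℂ] L2}

/-- Restrictions of one and the same resolvent are compatible on the physical strip, hence
everywhere by the identity theorem. -/
theorem IsLocalizedContinuation.mulOp_comp_comm (hT : IsLocalizedContinuation G T)
    (r s r' s' : ℝ) (ζ : ℂ) :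
    mulOp (ballIndicator r') ∘L T r s ζ ∘L mulOp (ballIndicator s') =
      mulOp (ballIndicator r) ∘L T r' s' ζ ∘L mulOp (ballIndicator s) := by
  have hd : ∀ r s r' s', Differentiable ℂ fun ζ =>
      mulOp (ballIndicator r') ∘L T r s ζ ∘L mulOp (ballIndicator s') := fun r s r' s' =>
    (differentiable_const _).clm_comp ((hT.differentiable r s).clm_comp (differentiable_const _))
  refine eq_of_eqOn_physical (hd r s r' s') (hd r' s' r s) (fun ζ hζ => ?_) ζ
  ext1 u
  have hb := isMultiplier_ballIndicator
  simp only [hT.eq_resolvent _ _ ζ hζ, ContinuousLinearMap.comp_apply, mulOp_mulOp (hb _) (hb _)]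
  simp only [mul_comm (ballIndicator r _), mul_comm (ballIndicator s _)]

theorem IsLocalizedContinuation.ae_eq (hT : IsLocalizedContinuation G T) {r s r' s' : ℝ} {g : L2}
    (hg : g ∈ L2On (Metric.closedBall (0 : Plane) s))
    (hg' : g ∈ L2On (Metric.closedBall (0 : Plane) s')) (ζ : ℂ) :
    ∀ᵐ x, ballIndicator r' x * T r s ζ g x = ballIndicator r x * T r' s' ζ g x := by
  have h := congrArg (fun A : L2 →L[ℂ] L2 => A g) (hT.mulOp_comp_comm r s r' s' ζ)
  simp only [ContinuousLinearMap.comp_apply, mulOp_ballIndicator_of_mem hg,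
    mulOp_ballIndicator_of_mem hg'] at h
  filter_upwards [coeFn_mulOp (isMultiplier_ballIndicator r') (T r s ζ g),
    coeFn_mulOp (isMultiplier_ballIndicator r) (T r' s' ζ g)] with x h1 h2
  rw [← h1, ← h2, h]

theorem IsLocalizedContinuation.mem_L2On (hT : IsLocalizedContinuation G T) (r s : ℝ) (ζ : ℂ)
    (g : L2) : T r s ζ g ∈ L2On (Metric.closedBall (0 : Plane) r) := by
  have hb := isMultiplier_ballIndicator
  have h : mulOp (ballIndicator r) ∘L T r s ζ = T r s ζ := by
    refine eq_of_eqOn_physical ((differentiable_const _).clm_comp (hT.differentiable r s))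
      (hT.differentiable r s) (fun ζ hζ => ?_) ζ
    ext1 u
    rw [hT.eq_resolvent _ _ ζ hζ, ContinuousLinearMap.comp_apply, ContinuousLinearMap.comp_apply]
    exact mulOp_mul_ballIndicator (hb r) (fun x hx => ballIndicator_of_notMem hx) _
  have h1 : mulOp (ballIndicator r) (T r s ζ g) = T r s ζ g :=
    congrArg (fun A : L2 →L[ℂ] L2 => A g) h
  change ∀ᵐ x, x ∉ Metric.closedBall (0 : Plane) r → T r s ζ g x = 0
  filter_upwards [coeFn_mulOp (hb r) (T r s ζ g)] with x h2 hx
  rw [← h1, h2, ballIndicator_of_notMem hx, zero_mul]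

theorem exists_mem_L2On_closedBall (g : Hcomp) :
    ∃ s : ℝ, (g : L2) ∈ L2On (Metric.closedBall (0 : Plane) s) := by
  obtain ⟨g, K, hK, hg⟩ := g
  obtain ⟨s, hs⟩ := hK.isBounded.subset_closedBall (0 : Plane)
  exact ⟨s, L2On_mono hs hg⟩

theorem ae_eq_of_forall_ballIndicator {u v : Plane → ℂ}
    (h : ∀ n : ℕ, ∀ᵐ x, ballIndicator n x * u x = ballIndicator n x * v x) : u =ᵐ[volume] v := by
  filter_upwards [ae_all_iff.2 h] with x hx
  have h1 : x ∈ Metric.closedBall (0 : Plane) (⌈‖x‖⌉₊ : ℝ) :=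
    mem_closedBall_zero_iff.2 (Nat.le_ceil _)
  simpa only [ballIndicator_of_mem h1, one_mul] using hx ⌈‖x‖⌉₊

theorem IsLocalizedContinuation.exists_glued (hT : IsLocalizedContinuation G T) (ζ : ℂ)
    (g : Hcomp) : ∃ v : Plane →ₘ[(volume : Measure Plane)] ℂ, ∀ r s : ℝ,
      (g : L2) ∈ L2On (Metric.closedBall (0 : Plane) s) →
        T r s ζ g =ᵐ[volume] fun x => ballIndicator r x * v x := by
  obtain ⟨s₀, hs₀⟩ := exists_mem_L2On_closedBall g
  -- The glued function takes at x the value of the localization to the ball of radius ⌈‖x‖⌉. Only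
  -- countably many localizations occur, so it is measurable.
  have hm : Measurable fun x : Plane => T (⌈‖x‖⌉₊ : ℝ) s₀ ζ g x := by
    have h1 : Measurable fun p : ℕ × Plane => T (p.1 : ℝ) s₀ ζ g p.2 :=
      measurable_from_prod_countable_right fun n => (Lp.stronglyMeasurable (T (n : ℝ) s₀ ζ g)).measurable
    exact h1.comp ((Nat.measurable_ceil.comp measurable_norm).prodMk measurable_id)
  refine ⟨AEEqFun.mk _ hm.aestronglyMeasurable, fun r s hs => ?_⟩
  filter_upwards [AEEqFun.coeFn_mk _ hm.aestronglyMeasurable, hT.mem_L2On r s ζ g,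
    ae_all_iff.2 fun n : ℕ => hT.ae_eq (r := r) (r' := n) hs hs₀ ζ] with x h1 h2 h3
  have hx : x ∈ Metric.closedBall (0 : Plane) (⌈‖x‖⌉₊ : ℝ) :=
    mem_closedBall_zero_iff.2 (Nat.le_ceil _)
  rw [h1, ← h3 ⌈‖x‖⌉₊, ballIndicator_of_mem hx, one_mul]

theorem IsLocalizedContinuation.exists_gluedMap (hT : IsLocalizedContinuation G T) (ζ : ℂ) :
    ∃ S : Hcomp →ₗ[ℂ] Plane →ₘ[(volume : Measure Plane)] ℂ, ∀ (g : Hcomp) (r s : ℝ),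
      (g : L2) ∈ L2On (Metric.closedBall (0 : Plane) s) →
        T r s ζ g =ᵐ[volume] fun x => ballIndicator r x * S g x := by
  choose S hS using hT.exists_glued ζ
  refine ⟨⟨⟨S, fun g h => ?_⟩, fun a g => ?_⟩, hS⟩
  · obtain ⟨s, hs⟩ := exists_mem_L2On_closedBall g
    obtain ⟨s', hs'⟩ := exists_mem_L2On_closedBall h
    have h1 := L2On_mono (Metric.closedBall_subset_closedBall (le_max_left s s')) hs
    have h2 := L2On_mono (Metric.closedBall_subset_closedBall (le_max_right s s')) hs'
    refine AEEqFun.ext (ae_eq_of_forall_ballIndicator fun n => ?_)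
    filter_upwards [hS (g + h) n _ (add_mem h1 h2), hS g n _ h1, hS h n _ h2,
      AEEqFun.coeFn_add (S g) (S h),
      Lp.coeFn_add (T n (max s s') ζ g) (T n (max s s') ζ h)] with x e1 e2 e3 e4 e5
    rw [← e1, e4, Submodule.coe_add, map_add, e5, Pi.add_apply, Pi.add_apply, e2, e3, mul_add]
  · obtain ⟨s, hs⟩ := exists_mem_L2On_closedBall g
    refine AEEqFun.ext (ae_eq_of_forall_ballIndicator fun n => ?_)
    filter_upwards [hS (a • g) n s (Submodule.smul_mem _ a hs), hS g n s hs,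
      AEEqFun.coeFn_smul a (S g), Lp.coeFn_smul a (T n s ζ g)] with x e1 e2 e3 e4
    rw [← e1, RingHom.id_apply, e3, Submodule.coe_smul, map_smul, e4, Pi.smul_apply,
      Pi.smul_apply, e2, smul_eq_mul, smul_eq_mul, mul_left_comm]

end Localized

/-! ### The continued resolvent as a family of operators into the local domain -/

section CutoffFamily

variable {β : ℝ} {c : Plane} {f : Plane → ℝ} {hf : ContDiff ℝ ∞ f} {G : L2 →L[ℂ] L2}
  {T : ℝ → ℝ → ℂ → L2 →L[ℂ] L2}

/-- Continues the cutoff resolvent in graph norm by applying Θ to localized pairs (u, P u); on the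
continued sheets no function u in the domain of P is available. -/
theorem exists_graph_family {P : L2 →ₗ.[ℂ] L2} (hG : IsPosResolvent P G)
    (hT : IsLocalizedContinuation G T) {χ : Plane → ℂ} (hχ : IsMultiplier χ) {r : ℝ}
    (hχr : ∀ x ∉ Metric.closedBall (0 : Plane) r, χ x = 0) (Θ : WithLp 2 (L2 × L2) →L[ℂ] P.graph)
    (hΘ : ∀ u : P.domain, (Θ (WithLp.toLp 2 (mulOp (ballIndicator r) u,
      mulOp (ballIndicator r) (P u))) : L2 × L2).1 = mulOp χ u) (s : ℝ) :
    ∃ F : ℂ → L2 →L[ℂ] P.graph, Differentiable ℂ F ∧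
      ∀ ζ g, (F ζ g : L2 × L2).1 = mulOp χ (T r s ζ g) := by
  let e : L2 × L2 →L[ℂ] WithLp 2 (L2 × L2) := (WithLp.prodContinuousLinearEquiv 2 ℂ L2 L2).symm
  -- On the physical strip, (P - z) u = 1_s g gives P u = z u + 1_s g. Hence the localization of P u
  -- is z T g plus a constant operator, and it continues along with T.
  let N : ℂ → L2 →L[ℂ] L2 × L2 := fun ζ => ContinuousLinearMap.inl ℂ L2 L2 ∘L T r s ζ +
    ContinuousLinearMap.inr ℂ L2 L2 ∘L (Complex.exp (2 * ζ) • T r s ζ +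
      mulOp (ballIndicator r) ∘L mulOp (ballIndicator s))
  let F : ℂ → L2 →L[ℂ] P.graph := fun ζ => Θ ∘L e ∘L N ζ
  have hTd := hT.differentiable r s
  have hexp : Differentiable ℂ fun ζ : ℂ => Complex.exp (2 * ζ) := by fun_prop
  have hN : Differentiable ℂ N :=
    ((differentiable_const _).clm_comp hTd).fun_add ((differentiable_const _).clm_comp
      ((hexp.fun_smul hTd).fun_add (differentiable_const _)))
  have hF : Differentiable ℂ F :=
    (differentiable_const _).clm_comp ((differentiable_const _).clm_comp hN)
  let p : P.graph →L[ℂ] L2 := ContinuousLinearMap.fst ℂ L2 L2 ∘L P.graph.subtypeL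
  have hpF : Differentiable ℂ fun ζ => p ∘L F ζ := (differentiable_const p).clm_comp hF
  have hχT : Differentiable ℂ fun ζ => mulOp χ ∘L T r s ζ :=
    (differentiable_const (mulOp χ)).clm_comp hTd
  refine ⟨F, hF, fun ζ g => ?_⟩
  have key : p ∘L F ζ = mulOp χ ∘L T r s ζ := by
    refine eq_of_eqOn_physical hpF hχT (fun ζ hζ => ?_) ζ
    ext1 g
    obtain ⟨hu, hPu⟩ := (hG.isResolvent_resolventOf (exp_two_mul_ne hζ)).1
      (mulOp (ballIndicator s) g)
    have hTu : T r s ζ g = mulOp (ballIndicator r)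
        (resolventOf G (Complex.exp (2 * ζ)) (mulOp (ballIndicator s) g)) := by
      rw [hT.eq_resolvent r s ζ hζ]; rfl
    generalize resolventOf G (Complex.exp (2 * ζ)) (mulOp (ballIndicator s) g) = u at hu hPu hTu
    have hNu : N ζ g = (mulOp (ballIndicator r) u, mulOp (ballIndicator r) (P ⟨u, hu⟩)) := by
      rw [sub_eq_iff_eq_add'.1 hPu, map_add, map_smul, ← hTu]
      simp [N]
    have h1 : (p ∘L F ζ) g = (Θ (e (N ζ g)) : L2 × L2).1 := rfl
    rw [h1, hNu]
    refine (hΘ ⟨u, hu⟩).trans ?_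
    rw [ContinuousLinearMap.comp_apply, hTu, mulOp_mul_ballIndicator hχ hχr]
  exact congrArg (fun A : L2 →L[ℂ] L2 => A g) key

theorem exists_cutoff_family (hG : IsPosResolvent (freeHamiltonian β c f hf) G)
    (hT : IsLocalizedContinuation G T) (χ : 𝓓((⊤ : Opens Plane), ℂ)) (s : ℝ) :
    ∃ (r : ℝ) (F : ℂ → L2 →L[ℂ] (freeHamiltonian β c f hf).graph), Differentiable ℂ F ∧
      (∀ x ∉ Metric.closedBall (0 : Plane) r, χ x = 0) ∧
      ∀ ζ g, (F ζ g : L2 × L2).1 = mulOp χ (T r s ζ g) := by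
  obtain ⟨r₀, hr₀⟩ := exists_graph_map (β := β) (c := c) (f := f) (hf := hf) χ
  obtain ⟨r₁, hr₁⟩ := χ.hasCompactSupport.isBounded.subset_closedBall (0 : Plane)
  obtain ⟨Θ, hΘ⟩ := hr₀ (max r₀ r₁) (le_max_left _ _)
  have hχ : ∀ x ∉ Metric.closedBall (0 : Plane) (max r₀ r₁), χ x = 0 := fun x hx =>
    image_eq_zero_of_notMem_tsupport fun h =>
      hx (Metric.closedBall_subset_closedBall (le_max_right _ _) (hr₁ h))
  obtain ⟨F, hF, hFT⟩ := exists_graph_family hG hT (isMultiplier_test χ) hχ Θ hΘ s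
  exact ⟨_, F, hF, hχ, hFT⟩

/-- `S ζ : H_comp → L²_loc` is glued from the localizations `T r s ζ`. -/
def IsGluing (T : ℝ → ℝ → ℂ → L2 →L[ℂ] L2)
    (S : ℂ → Hcomp →ₗ[ℂ] Plane →ₘ[(volume : Measure Plane)] ℂ) : Prop :=
  ∀ (ζ : ℂ) (g : Hcomp) (r s : ℝ), (g : L2) ∈ L2On (Metric.closedBall (0 : Plane) s) →
    T r s ζ g =ᵐ[volume] fun x => ballIndicator r x * S ζ g x

variable {S : ℂ → Hcomp →ₗ[ℂ] Plane →ₘ[(volume : Measure Plane)] ℂ}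

theorem exists_cutoff_family_glued (hG : IsPosResolvent (freeHamiltonian β c f hf) G)
    (hT : IsLocalizedContinuation G T) (hS : IsGluing T S) (χ : 𝓓((⊤ : Opens Plane), ℂ)) (s : ℝ) :
    ∃ F : ℂ → L2 →L[ℂ] (freeHamiltonian β c f hf).graph, Differentiable ℂ F ∧
      ∀ ζ (g : Hcomp), (g : L2) ∈ L2On (Metric.closedBall (0 : Plane) s) →
        (((F ζ g : L2 × L2).1 : L2) : Plane → ℂ) =ᵐ[volume] fun x => χ x * S ζ g x := by
  obtain ⟨r, F, hF, hχ, hFT⟩ := exists_cutoff_family hG hT χ s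
  refine ⟨F, hF, fun ζ g hg => ?_⟩
  rw [hFT]
  filter_upwards [coeFn_mulOp (isMultiplier_test χ) (T r s ζ g), hS ζ g r s hg] with x h1 h2
  rw [h1, h2]
  by_cases hx : x ∈ Metric.closedBall (0 : Plane) r
  · rw [ballIndicator_of_mem hx, one_mul]
  · rw [hχ x hx, zero_mul, zero_mul]

theorem IsGluing.mem_Hloc (hS : IsGluing T S) (ζ : ℂ) (g : Hcomp) : S ζ g ∈ Hloc := by
  intro K hK
  obtain ⟨s, hs⟩ := exists_mem_L2On_closedBall g
  obtain ⟨r, hr⟩ := hK.isBounded.subset_closedBall (0 : Plane)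
  refine (memLp_congr_ae ?_).1 ((Lp.memLp (T r s ζ g)).restrict K)
  filter_upwards [ae_restrict_of_ae (hS ζ g r s hs), ae_restrict_mem hK.measurableSet] with x h1 h2
  rw [h1, ballIndicator_of_mem (hr h2), one_mul]

theorem IsGluing.mem_Dloc (hG : IsPosResolvent (freeHamiltonian β c f hf) G)
    (hT : IsLocalizedContinuation G T) (hS : IsGluing T S) (R₀ : ℝ) (ζ : ℂ) (g : Hcomp) :
    S ζ g ∈ Dloc (freeHamiltonian β c f hf) R₀ := by
  refine ⟨hS.mem_Hloc ζ g, fun χ _ => ?_⟩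
  obtain ⟨s, hs⟩ := exists_mem_L2On_closedBall g
  obtain ⟨F, -, hF⟩ := exists_cutoff_family_glued hG hT hS χ s
  exact ⟨_, LinearPMap.mem_domain_of_mem_graph (F ζ g).2, hF ζ g hs⟩

theorem IsGluing.eq_resolvent (hT : IsLocalizedContinuation G T) (hS : IsGluing T S) {ζ : ℂ}
    (hζ : ζ ∈ LogCover.physical) (g : Hcomp) :
    S ζ g = (resolventOf G (Complex.exp (2 * ζ)) g : L2) := by
  obtain ⟨s, hs⟩ := exists_mem_L2On_closedBall g
  refine AEEqFun.ext (ae_eq_of_forall_ballIndicator fun n => ?_)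
  have h1 : T n s ζ g =
      mulOp (ballIndicator n) (resolventOf G (Complex.exp (2 * ζ)) g) := by
    rw [hT.eq_resolvent _ _ ζ hζ, ContinuousLinearMap.comp_apply, ContinuousLinearMap.comp_apply,
      mulOp_ballIndicator_of_mem hs]
  filter_upwards [hS ζ g n s hs, coeFn_mulOp (isMultiplier_ballIndicator n)
    (resolventOf G (Complex.exp (2 * ζ)) g)] with x h2 h3
  rw [← h2, h1, h3]

theorem exists_analyticFamily (hG : IsPosResolvent (freeHamiltonian β c f hf) G) (R₀ : ℝ) :
    ∃ Rc : LogCover → Hcomp →ₗ[ℂ] Dloc (freeHamiltonian β c f hf) R₀,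
      IsAnalyticFamily (freeHamiltonian β c f hf) R₀ Rc ∧ ∀ ζ ∈ LogCover.physical, ∀ g : Hcomp,
        (Rc ζ g : Plane →ₘ[(volume : Measure Plane)] ℂ) =
          (resolventOf G (Complex.exp (2 * ζ)) g : L2) := by
  obtain ⟨T, hT⟩ := exists_isLocalizedContinuation hG
  choose S hS using hT.exists_gluedMap
  have hS' : IsGluing T S := hS
  refine ⟨fun ζ => (S ζ).codRestrict _ fun g => hS'.mem_Dloc hG hT R₀ ζ g,
    fun K hK χ _ => ?_, fun ζ hζ g => hS'.eq_resolvent hT hζ g⟩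
  obtain ⟨s, hs⟩ := hK.isBounded.subset_closedBall (0 : Plane)
  obtain ⟨F, hF, hFS⟩ := exists_cutoff_family_glued hG hT hS' χ s
  have hcomplete : CompleteSpace (freeHamiltonian β c f hf).graph :=
    -- Completeness of the graph lets complex differentiability in operator norm be upgraded to
    -- analyticity.
    hG.isClosed_graph.completeSpace_coe
  have hF' : Differentiable ℂ fun ζ => F ζ ∘L (L2On K).subtypeL :=
    hF.clm_comp (differentiable_const _)
  exact ⟨fun ζ => F ζ ∘L (L2On K).subtypeL, hF'.differentiableOn.analyticOnNhd isOpen_univ,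
    fun ζ g => hFS ζ (Submodule.inclusion (L2On_le_Hcomp hK) g) (L2On_mono hs g.2)⟩

theorem analyticOnNhd_resolventOf_sq (hG : IsPosResolvent (freeHamiltonian β c f hf) G) :
    AnalyticOnNhd ℂ (fun lam : ℂ => resolventOf G (lam ^ 2)) {lam : ℂ | 0 < lam.im} := by
  refine DifferentiableOn.analyticOnNhd (fun lam h => ?_)
    (isOpen_lt continuous_const Complex.continuous_im)
  have h1 : DifferentiableAt ℂ (fun lam : ℂ => lam ^ 2) lam := differentiableAt_pow 2
  have h2 : DifferentiableAt ℂ (resolventOf G) (lam ^ 2) :=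
    hG.differentiableAt_resolventOf (sq_ne_of_im_pos h)
  exact (DifferentiableAt.comp (g := resolventOf G) lam h2 h1).differentiableWithinAt

end CutoffFamily

end AharonovBohm

end

open AharonovBohm in
theorem proposition3p2 {n : ℕ} (α : Fin n → ℝ) (hα : ∀ i, ∀ m : ℤ, α i ≠ m)
    (s : Fin n → Plane) (hs : Function.Injective s)
    (R₀ : ℝ) (hR₀ : ∀ i, s i ∈ Metric.ball (0 : Plane) R₀)
    (f : Plane → ℝ) (hf : ContDiff ℝ ∞ f)
    (hgauge : ∀ φ : Plane → ℂ, ContDiff ℝ ∞ φ → ∀ x : Plane, x ∉ Metric.ball (0 : Plane) R₀ →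
      freeExpr (totalFlux α) (fluxCenter α s) f φ x = multiFluxExpr α s φ x) :
    let P₀ : L2 →ₗ.[ℂ] L2 := freeHamiltonian (totalFlux α) (fluxCenter α s) f hf
    ∃ R : ℂ → L2 →L[ℂ] L2,
      (∀ lam : ℂ, 0 < lam.im → IsResolvent P₀ (lam ^ 2) (R lam)) ∧
      AnalyticOnNhd ℂ R {lam : ℂ | 0 < lam.im} ∧
      ∃ Rc : LogCover → Hcomp →ₗ[ℂ] Dloc P₀ R₀,
        IsAnalyticFamily P₀ R₀ Rc ∧
        ∀ ζ ∈ LogCover.physical, ∀ g : Hcomp,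
          (Rc ζ g : Plane →ₘ[(volume : Measure Plane)] ℂ) = (R ζ.proj (g : L2) : L2) := by
  intro P₀
  obtain ⟨G, hG⟩ := exists_isPosResolvent (totalFlux α) (fluxCenter α s) f hf
  obtain ⟨Rc, hRc, hRc'⟩ := exists_analyticFamily hG R₀
  refine ⟨fun lam => resolventOf G (lam ^ 2),
    fun lam h => hG.isResolvent_resolventOf (sq_ne_of_im_pos h),
    analyticOnNhd_resolventOf_sq hG, Rc, hRc, fun ζ hζ g => ?_⟩
  rw [hRc' ζ hζ g, LogCover.proj, two_mul, Complex.exp_add, ← sq]
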